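/- Let $n,m\in\mathbb N$, $T\in(0,\infty)$, and let $W=(W_1,\dots,W_m)^\top$ be an $m$-dimensional Brownian motion on a complete probability space $(\Omega,\mathcal F,P)$, where $(\mathcal F_s)_{s\in[0,T]}$ is the augmented natural filtration of $W$. Let $O\in\mathbb R^{n\times n}$ be orthogonal, $\lambda_1,\dots,\lambda_n\in(0,\infty)$, and for $\alpha\in\mathbb R$ set $\gamma^\alpha=O^\top\operatorname{diag}(\lambda_1^\alpha,\dots,\lambda_n^\alpha)O$, $\gamma=\gamma^1$ (price impact). Let $\rho\in\mathbb R^{n\times n}\setminus\{0\}$ (resilience), and let $x,d\in\mathbb R^n$ with $d\neq\gamma x$. Put $$\mathscr B=-\gamma^{-\frac12}\rho\gamma^{\frac12},\qquad \mathscr R=\kappa=\tfrac12\bigl(\gamma^{-\frac12}\rho\gamma^{\frac12}+\gamma^{\frac12}\rho^\top\gamma^{-\frac12}\bigr),\qquad \nu(s)=e^{s\rho},\qquad h_0=\gamma^{-\frac12}d-\gamma^{\frac12}x,$$ and assume that $\kappa$ is positive definite. \emph{Strategies.} For an $\mathbb R^n$-valued progressively measurable process $X=(X(s))_{s\in[0,T]}$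 with prescribed value $X(0-)=x$ and $\int_0^T\|X(s)\|^2ds<\infty$ a.s., the associated deviation is $D^X(0-)=d$ and $$D^X(r)=\gamma X(r)+\nu(r)^{-1}\Bigl(d-\gamma x-\int_0^r\nu(s)\rho\gamma X(s)\,ds\Bigr),\quad r\in[0,T].$$ Let $\mathcal A^{pm}_0(x,d)$ be the set of such $X$ with $X(T)=0$ and $E\bigl[\int_0^T\|\gamma^{-\frac12}D^X(s)\|^2ds\bigr]<\infty$, identified up to $dP\times ds$-null sets, and set $$J^{pm}_0(x,d,X)=\tfrac12E\bigl[D^X(T)^\top\gamma^{-1}D^X(T)\,\big|\,\mathcal F_0\bigr]+E\Bigl[\int_0^TD^X(s)^\top\gamma^{-\frac12}\kappa\gamma^{-\frac12}D^X(s)\,ds\,\Big|\,\mathcal F_0\Bigr]-\tfrac12d^\top\gamma^{-1}d.$$ Let $\mathcal A^{fv}_0(x,d)$ be the set of adapted càdlàg finite-variation processes $X$ with $X(0-)=x$, $X(T)=0$ such that the solution $D$ of $dD(s)=-\rho D(s)\,ds+\gamma\,dX(s)$, $D(0-)=d$, satisfies $E\bigl[\int_0^T\|\gamma^{-\frac12}D(s)\|^2ds\bigr]<\infty$.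 \emph{Claim.} The inverse matrices below exist, and the following hold. (i) The Riccati BSDE $$d\mathscr Y(s)=\mathscr Y(s)\mathscr B\mathscr R^{-1}\mathscr B^\top\mathscr Y(s)\,ds+\sum_{k=1}^m\mathscr Z^k(s)\,dW_k(s),\quad s\in[0,T],\qquad\mathscr Y(T)=\tfrac12I_n,$$ has exactly one solution $(\mathscr Y,\mathscr Z)$ with $\mathscr Y$ symmetric-matrix-valued, bounded, adapted and continuous and with $\mathscr Z^1,\dots,\mathscr Z^m$ symmetric-matrix-valued, progressively measurable and square integrable ($\mathscr Y$ unique up to indistinguishability, $\mathscr Z$ unique $dP\times ds$-a.e.), namely $$\mathscr Y(s)=\tfrac12\bigl(I_n+\tfrac12(T-s)\mathscr B\mathscr R^{-1}\mathscr B^\top\bigr)^{-1},\quad s\in[0,T],\qquad\mathscr Z=0.$$ (ii) The associated feedback matrix is $\theta(s)=-\mathscr R^{-1}\mathscr B^\top\mathscr Y(s)$, and the unique solution of $d\mathcal H^*(s)=\mathscr B\theta(s)\mathcal H^*(s)\,ds$, $\mathcal H^*(0)=h_0$, is $$\mathcal H^*(s)=h_0-\tfrac12\mathscr B\mathscr R^{-1}\mathscr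 B^\top\bigl(I_n+\tfrac12T\mathscr B\mathscr R^{-1}\mathscr B^\top\bigr)^{-1}h_0\,s,\quad s\in[0,T].$$ (iii) There is a minimizer $X^*$ of $J^{pm}_0(x,d,\cdot)$ over $\mathcal A^{pm}_0(x,d)$, unique up to $dP\times ds$-null sets. It belongs to $\mathcal A^{fv}_0(x,d)$ and is given by $X^*(0-)=x$, $X^*(T)=0$, and, for $s\in[0,T)$, $$X^*(s)=-\tfrac12\gamma^{-\frac12}\Bigl(\mathscr R^{-1}\mathscr B^\top\bigl(I_n+\tfrac12T\mathscr B\mathscr R^{-1}\mathscr B^\top\bigr)^{-1}+2I_n\Bigr)h_0+\tfrac12\gamma^{-\frac12}\mathscr B\mathscr R^{-1}\mathscr B^\top\bigl(I_n+\tfrac12T\mathscr B\mathscr R^{-1}\mathscr B^\top\bigr)^{-1}h_0\,s.$$ In particular, block trades occur at most at the times $0$ and $T$, and the position is affine-linear in between. (iv) The deviation $D^*=D^{X^*}$ (which also solves $dD^*=-\rho D^*ds+\gamma\,dX^*$) satisfies $D^*(0-)=d$ and $$D^*(s)=-\tfrac12\gamma^{\frac12}\mathscr R^{-1}\mathscr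 B^\top\bigl(I_n+\tfrac12T\mathscr B\mathscr R^{-1}\mathscr B^\top\bigr)^{-1}h_0,\ s\in[0,T),\qquad D^*(T)=\gamma^{\frac12}\bigl(I_n+\tfrac12T\mathscr B\mathscr R^{-1}\mathscr B^\top\bigr)^{-1}h_0;$$ in particular it is constant on $[0,T)$. -/

import Mathlib

open MeasureTheory ProbabilityTheory Filter Topology Matrix
open scoped ENNReal

noncomputable section

namespace TradeExecution

/-! ### Time interval, Brownian motion and its filtration -/

/-- The time interval `[0, T]`. -/
abbrev Time (T : ℝ) : Type := Set.Icc (0 : ℝ) T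

/-- The time interval carries the restriction of Lebesgue measure as `volume`. -/
instance instMeasureSpaceTime (T : ℝ) : MeasureSpace (Time T) := Measure.Subtype.measureSpace

/-- The initial time `0`. -/
def startTime {T : ℝ} (hT : 0 < T) : Time T := ⟨0, Set.left_mem_Icc.2 hT.le⟩

/-- The terminal time `T`. -/
def endTime {T : ℝ} (hT : 0 < T) : Time T := ⟨T, Set.right_mem_Icc.2 hT.le⟩

/-- `W` is an `m`-dimensional standard Brownian motion on `[0, T]` with respect to `ℱ`. -/
structure IsBrownianMotion {T : ℝ} {Ω : Type*} {mΩ : MeasurableSpace Ω} {m : ℕ}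
    (ℱ : Filtration (Time T) mΩ) (P : Measure Ω) (W : Fin m → Time T → Ω → ℝ) : Prop where
  adapted : ∀ k, StronglyAdapted ℱ (W k)
  zero : ∀ᵐ ω ∂P, ∀ k, ∀ s : Time T, (s : ℝ) = 0 → W k s ω = 0
  continuous : ∀ᵐ ω ∂P, ∀ k, Continuous fun s => W k s ω
  indep : ∀ s t : Time T, s ≤ t →
    Indep (MeasurableSpace.comap (fun ω k => W k t ω - W k s ω) inferInstance) (ℱ s) P
  law : ∀ s t : Time T, s ≤ t →
    P.map (fun ω k => W k t ω - W k s ω)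
      = Measure.pi fun _ : Fin m => gaussianReal 0 (Real.toNNReal ((t : ℝ) - s))

/-- `ℱ` is the natural filtration of `W`, augmented by all `P`-null sets
(`P A = 0` means that `A` is contained in a measurable set of probability zero). -/
def IsAugmentedNaturalFiltration {T : ℝ} {Ω : Type*} {mΩ : MeasurableSpace Ω} {m : ℕ}
    (ℱ : Filtration (Time T) mΩ) (P : Measure Ω) (W : Fin m → Time T → Ω → ℝ) : Prop :=
  ∀ t : Time T, (ℱ t : MeasurableSpace Ω) =
    (⨆ k : Fin m, ⨆ s : Set.Iic t, MeasurableSpace.comap (W k s) inferInstance)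
      ⊔ MeasurableSpace.generateFrom {A : Set Ω | P A = 0}

/-! ### The Itô integral of square-integrable integrands -/

/-- A simple process `∑_{i < N} cᵢ 1_{(tᵢ, tᵢ₊₁]}` with bounded `ℱ_{tᵢ}`-measurable `cᵢ`. -/
structure SimpleProcess {T : ℝ} {Ω : Type*} {mΩ : MeasurableSpace Ω}
    (ℱ : Filtration (Time T) mΩ) where
  N : ℕ
  t : ℕ → Time T
  mono : Monotone t
  c : ℕ → Ω → ℝ
  meas : ∀ i, StronglyMeasurable[ℱ (t i)] (c i)
  bdd : ∃ K : ℝ, ∀ i ω, |c i ω| ≤ K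

namespace SimpleProcess

variable {T : ℝ} {Ω : Type*} {mΩ : MeasurableSpace Ω} {ℱ : Filtration (Time T) mΩ}

/-- The value of a simple process at time `s`. -/
def eval (S : SimpleProcess ℱ) (s : Time T) (ω : Ω) : ℝ :=
  ∑ i ∈ Finset.range S.N, (Set.Ioc (S.t i) (S.t (i + 1))).indicator (fun _ => S.c i ω) s

/-- The elementary integral `∫₀^r S dw = ∑ cᵢ (w(tᵢ₊₁ ∧ r) - w(tᵢ ∧ r))`. -/
def integral (S : SimpleProcess ℱ) (w : Time T → Ω → ℝ) (r : Time T) (ω : Ω) : ℝ :=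
  ∑ i ∈ Finset.range S.N, S.c i ω * (w (min (S.t (i + 1)) r) ω - w (min (S.t i) r) ω)

end SimpleProcess

/-- `I` is the Itô integral process `r ↦ ∫₀^r H dw` of the square-integrable integrand `H`:
a continuous adapted process which is the `L²` limit of the elementary integrals of simple
processes that approximate `H` in `L²(P ⊗ ds)`. -/
def IsItoIntegral {T : ℝ} {Ω : Type*} {mΩ : MeasurableSpace Ω}
    (ℱ : Filtration (Time T) mΩ) (P : Measure Ω) (w : Time T → Ω → ℝ)
    (H I : Time T → Ω → ℝ) : Prop :=
  IsStronglyProgressive ℱ H ∧ StronglyAdapted ℱ I ∧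
  (∀ᵐ ω ∂P, Continuous fun s => I s ω) ∧
  ∃ S : ℕ → SimpleProcess ℱ,
    Tendsto (fun j => ∫⁻ ω, (∫⁻ s, ENNReal.ofReal ((H s ω - (S j).eval s ω) ^ 2)) ∂P)
      atTop (𝓝 0) ∧
    ∀ r : Time T,
      Tendsto (fun j => ∫⁻ ω, ENNReal.ofReal ((I r ω - (S j).integral w r ω) ^ 2) ∂P)
        atTop (𝓝 0)

/-! ### Coefficients

All coefficients are given at a fixed time, as functions of the values of the orthogonal matrix
`O`, the powers `γh = γ^{1/2}` and `γmh = γ^{-1/2}` of the price impact, the resilience `ρ`,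
the drift `μ` and volatility `σ` of the eigenvalues of the price impact, and the risk matrix `Ξ`. -/

section Coefficients

variable {n m : ℕ}

/-- `𝒞^k = ½ Oᵀ diag(σ_{1,k}, …, σ_{n,k}) O`. -/
def coeffC (O : Matrix (Fin n) (Fin n) ℝ) (σ : Matrix (Fin n) (Fin m) ℝ) (k : Fin m) :
    Matrix (Fin n) (Fin n) ℝ :=
  (1 / 2 : ℝ) • (Oᵀ * Matrix.diagonal (fun j => σ j k) * O)

/-- `𝒜 = ½ Oᵀ diag(μ) O - ½ ∑ₖ 𝒞^k 𝒞^k`. -/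
def coeffA (O : Matrix (Fin n) (Fin n) ℝ) (μ : Fin n → ℝ) (σ : Matrix (Fin n) (Fin m) ℝ) :
    Matrix (Fin n) (Fin n) ℝ :=
  (1 / 2 : ℝ) • (Oᵀ * Matrix.diagonal μ * O)
    - (1 / 2 : ℝ) • ∑ k, coeffC O σ k * coeffC O σ k

/-- `ℬ = -γ^{-1/2} ρ γ^{1/2} - Oᵀ diag(μ) O + 2 ∑ₖ 𝒞^k 𝒞^k`. -/
def coeffB (O γh γmh ρ : Matrix (Fin n) (Fin n) ℝ) (μ : Fin n → ℝ)
    (σ : Matrix (Fin n) (Fin m) ℝ) : Matrix (Fin n) (Fin n) ℝ :=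
  -(γmh * ρ * γh) - Oᵀ * Matrix.diagonal μ * O
    + (2 : ℝ) • ∑ k, coeffC O σ k * coeffC O σ k

/-- `κ = ½ Oᵀ diag(μ) O - 2 ∑ₖ 𝒞^k 𝒞^k + ½ γ^{-1/2} ρ γ^{1/2} + ½ γ^{1/2} ρᵀ γ^{-1/2}`. -/
def coeffKappa (O γh γmh ρ : Matrix (Fin n) (Fin n) ℝ) (μ : Fin n → ℝ)
    (σ : Matrix (Fin n) (Fin m) ℝ) : Matrix (Fin n) (Fin n) ℝ :=
  (1 / 2 : ℝ) • (Oᵀ * Matrix.diagonal μ * O)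
    - (2 : ℝ) • ∑ k, coeffC O σ k * coeffC O σ k
    + (1 / 2 : ℝ) • (γmh * ρ * γh) + (1 / 2 : ℝ) • (γh * ρᵀ * γmh)

/-- `𝒬 = γ^{-1/2} Ξ γ^{-1/2}`. -/
def coeffQ (γmh Ξ : Matrix (Fin n) (Fin n) ℝ) : Matrix (Fin n) (Fin n) ℝ :=
  γmh * Ξ * γmh

/-- The driver `g` of the Riccati BSDE. -/
def driver (A B Q R : Matrix (Fin n) (Fin n) ℝ) (C : Fin m → Matrix (Fin n) (Fin n) ℝ)
    (Y : Matrix (Fin n) (Fin n) ℝ) (Z : Fin m → Matrix (Fin n) (Fin n) ℝ) :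
    Matrix (Fin n) (Fin n) ℝ :=
  Y * A + A * Y + Q + ∑ k, (C k * Y * C k + Z k * C k + C k * Z k)
    - (Y * B - Q - (2 : ℝ) • ∑ k, (C k * Y * C k + Z k * C k))
      * (R + (4 : ℝ) • ∑ k, C k * Y * C k)⁻¹
      * (Bᵀ * Y - Q - (2 : ℝ) • ∑ k, (C k * Y * C k + C k * Z k))

/-- The feedback matrix `θ` associated to `(𝒴, 𝒵)`. -/
def feedback (B Q R : Matrix (Fin n) (Fin n) ℝ) (C : Fin m → Matrix (Fin n) (Fin n) ℝ)
    (Y : Matrix (Fin n) (Fin n) ℝ) (Z : Fin m → Matrix (Fin n) (Fin n) ℝ) :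
    Matrix (Fin n) (Fin n) ℝ :=
  -((R + (4 : ℝ) • ∑ k, C k * Y * C k)⁻¹
      * (Bᵀ * Y - Q - (2 : ℝ) • ∑ k, (C k * Y * C k + C k * Z k)))

end Coefficients

/-! ### The Riccati BSDE and the SDE of the optimal state -/

section Equations

variable {T : ℝ} {Ω : Type*} {mΩ : MeasurableSpace Ω} {n m : ℕ}

/-- `(Y, Z)` is a solution of the Riccati BSDE
`dY = -g(Y, Z) ds + ∑ₖ Z^k dWₖ`, `Y(T) = ½ I`. -/
structure IsRiccatiSolution (hT : 0 < T) (ℱ : Filtration (Time T) mΩ) (P : Measure Ω)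
    (W : Fin m → Time T → Ω → ℝ)
    (A B Q R : Time T → Ω → Matrix (Fin n) (Fin n) ℝ)
    (C : Fin m → Time T → Ω → Matrix (Fin n) (Fin n) ℝ)
    (Y : Time T → Ω → Matrix (Fin n) (Fin n) ℝ)
    (Z : Fin m → Time T → Ω → Matrix (Fin n) (Fin n) ℝ) : Prop where
  symm_Y : ∀ s ω, (Y s ω).IsSymm
  bounded_Y : ∃ K : ℝ, ∀ᵐ ω ∂P, ∀ s i j, |Y s ω i j| ≤ K
  adapted_Y : StronglyAdapted ℱ Y
  continuous_Y : ∀ᵐ ω ∂P, Continuous fun s => Y s ω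
  symm_Z : ∀ k s ω, (Z k s ω).IsSymm
  prog_Z : ∀ k, IsStronglyProgressive ℱ (Z k)
  sq_integrable_Z : ∀ k,
    ∫⁻ ω, (∫⁻ s, ENNReal.ofReal (∑ i, ∑ j, (Z k s ω i j) ^ 2)) ∂P < ⊤
  posDef : ∀ᵐ p ∂((volume : Measure (Time T)).prod P),
    (R p.1 p.2 + (4 : ℝ) • ∑ k, C k p.1 p.2 * Y p.1 p.2 * C k p.1 p.2).PosDef
  integrable_driver : ∀ᵐ ω ∂P, ∀ i j, Integrable (fun s : Time T =>
    driver (A s ω) (B s ω) (Q s ω) (R s ω) (fun k => C k s ω) (Y s ω) (fun k => Z k s ω) i j)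
  terminal : ∀ᵐ ω ∂P, Y (endTime hT) ω = (1 / 2 : ℝ) • (1 : Matrix (Fin n) (Fin n) ℝ)
  equation : ∃ N : Fin m → Time T → Ω → Matrix (Fin n) (Fin n) ℝ,
    (∀ k i j, IsItoIntegral ℱ P (W k) (fun s ω => Z k s ω i j) (fun s ω => N k s ω i j)) ∧
    ∀ᵐ ω ∂P, ∀ s i j, Y s ω i j = Y (startTime hT) ω i j
      - (∫ r in Set.Iic s, driver (A r ω) (B r ω) (Q r ω) (R r ω) (fun k => C k r ω) (Y r ω)
          (fun k => Z k r ω) i j)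
      + ∑ k, N k s ω i j

/-- `H` is a solution of the SDE
`dH = (A + B θ) H ds + ∑ₖ C^k (I - 2 θ) H dWₖ`, `H(0) = h₀`. -/
structure IsOptimalStateSolution (hT : 0 < T) (ℱ : Filtration (Time T) mΩ) (P : Measure Ω)
    (W : Fin m → Time T → Ω → ℝ)
    (A B θ : Time T → Ω → Matrix (Fin n) (Fin n) ℝ)
    (C : Fin m → Time T → Ω → Matrix (Fin n) (Fin n) ℝ)
    (h₀ : Fin n → ℝ) (H : Time T → Ω → Fin n → ℝ) : Prop where
  adapted : StronglyAdapted ℱ H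
  continuous : ∀ᵐ ω ∂P, Continuous fun s => H s ω
  initial : ∀ᵐ ω ∂P, H (startTime hT) ω = h₀
  integrable_drift : ∀ᵐ ω ∂P, Integrable fun s : Time T =>
    (A s ω + B s ω * θ s ω) *ᵥ H s ω
  equation : ∃ N : Fin m → Time T → Ω → Fin n → ℝ,
    (∀ k i, IsItoIntegral ℱ P (W k)
      (fun s ω => ((C k s ω * (1 - (2 : ℝ) • θ s ω)) *ᵥ H s ω) i) (fun s ω => N k s ω i)) ∧
    ∀ᵐ ω ∂P, ∀ s, H s ω =
      h₀ + (∫ r in Set.Iic s, (A r ω + B r ω * θ r ω) *ᵥ H r ω) + ∑ k, N k s ω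

end Equations

/-! ### The multi-asset Obizhaeva–Wang model -/

/-- The data of the model with constant price impact `γ = Oᵀ diag(λ) O` and constant
resilience `ρ`. Zero drift `μ = 0` and volatility `σ = 0` of the eigenvalues `λ` and zero risk
term `Ξ = 0` are put into the general coefficients below. -/
structure OWModel (n : ℕ) where
  O : Matrix (Fin n) (Fin n) ℝ
  orth : O ∈ Matrix.orthogonalGroup (Fin n) ℝ
  lam : Fin n → ℝ
  lam_pos : ∀ j, 0 < lam j
  rho : Matrix (Fin n) (Fin n) ℝ

/-- An `ℝⁿ`-valued process on `[0, T]` together with its value at `0-`. -/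
structure StartedProcess (T : ℝ) (Ω : Type*) (n : ℕ) where
  pre : Fin n → ℝ
  path : Time T → Ω → Fin n → ℝ

namespace OWModel

variable {n : ℕ} (M : OWModel n)

/-- The power `γ^α = Oᵀ diag(λ₁^α, …, λₙ^α) O`. -/
def gammaPow (α : ℝ) : Matrix (Fin n) (Fin n) ℝ :=
  M.Oᵀ * Matrix.diagonal (fun j => M.lam j ^ α) * M.O

/-- The price impact `γ = Oᵀ diag(λ) O`. -/
def gamma : Matrix (Fin n) (Fin n) ℝ := M.Oᵀ * Matrix.diagonal M.lam * M.O

/-- `𝒜` with `μ = 0` and `σ = 0`; `m` is the dimension of the Brownian motion. -/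
def scrA (m : ℕ) : Matrix (Fin n) (Fin n) ℝ :=
  coeffA M.O 0 (0 : Matrix (Fin n) (Fin m) ℝ)

/-- `ℬ` with `μ = 0` and `σ = 0`. -/
def scrB (m : ℕ) : Matrix (Fin n) (Fin n) ℝ :=
  coeffB M.O (M.gammaPow (1 / 2)) (M.gammaPow (-(1 / 2))) M.rho 0
    (0 : Matrix (Fin n) (Fin m) ℝ)

/-- `𝒞^k` with `σ = 0`. -/
def scrC (m : ℕ) (k : Fin m) : Matrix (Fin n) (Fin n) ℝ :=
  coeffC M.O (0 : Matrix (Fin n) (Fin m) ℝ) k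

/-- `κ` with `μ = 0` and `σ = 0`. -/
def kappa (m : ℕ) : Matrix (Fin n) (Fin n) ℝ :=
  coeffKappa M.O (M.gammaPow (1 / 2)) (M.gammaPow (-(1 / 2))) M.rho 0
    (0 : Matrix (Fin n) (Fin m) ℝ)

/-- `𝒬` with `Ξ = 0`. -/
def scrQ : Matrix (Fin n) (Fin n) ℝ := coeffQ (M.gammaPow (-(1 / 2))) 0

/-- `ℛ = 𝒬 + κ`. -/
def scrR (m : ℕ) : Matrix (Fin n) (Fin n) ℝ := M.scrQ + M.kappa m

/-- `ℬ ℛ⁻¹ ℬᵀ`. -/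
def scrBRB (m : ℕ) : Matrix (Fin n) (Fin n) ℝ := M.scrB m * (M.scrR m)⁻¹ * (M.scrB m)ᵀ

/-- `γ^{-1/2} d - γ^{1/2} x`. -/
def initialState (x d : Fin n → ℝ) : Fin n → ℝ :=
  M.gammaPow (-(1 / 2)) *ᵥ d - M.gammaPow (1 / 2) *ᵥ x

/-- The fundamental matrix `ν(s) = e^{sρ}`, the solution of `dν = ν ρ ds`, `ν(0) = I`. -/
def nu (s : ℝ) : Matrix (Fin n) (Fin n) ℝ := NormedSpace.exp (s • M.rho)

theorem nu_zero : M.nu 0 = 1 := by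
  simp [nu]

section

open scoped Matrix.Norms.Operator

theorem hasDerivAt_nu (s : ℝ) (i j : Fin n) :
    HasDerivAt (fun r => M.nu r i j) ((M.nu s * M.rho) i j) s := by
  have h : HasDerivAt (fun r : ℝ => M.nu r) (M.nu s * M.rho) s :=
    hasDerivAt_exp_smul_const M.rho s
  exact (Matrix.entryLinearMap ℝ ℝ i j).toContinuousLinearMap.hasFDerivAt.comp_hasDerivAt s h

end

/-- `½ (I + ½ (T - s) ℬ ℛ⁻¹ ℬᵀ)⁻¹`. -/
def explicitY (m : ℕ) (T s : ℝ) : Matrix (Fin n) (Fin n) ℝ :=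
  (1 / 2 : ℝ) • (1 + ((1 / 2) * (T - s)) • M.scrBRB m)⁻¹

/-- `h₀ - ½ ℬ ℛ⁻¹ ℬᵀ (I + ½ T ℬ ℛ⁻¹ ℬᵀ)⁻¹ h₀ s` with `h₀ = γ^{-1/2} d - γ^{1/2} x`. -/
def explicitState (m : ℕ) (T : ℝ) (x d : Fin n → ℝ) (s : ℝ) : Fin n → ℝ :=
  M.initialState x d - s • (((1 / 2 : ℝ) •
    (M.scrBRB m * (1 + ((1 / 2) * T) • M.scrBRB m)⁻¹)) *ᵥ M.initialState x d)

section Deviation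

variable {T : ℝ} {Ω : Type*} {mΩ : MeasurableSpace Ω}

/-- The deviation of a progressively measurable strategy `X` started from `D(0-) = d`:
`D(r) = γ X(r) + ν(r)⁻¹ (d - γ X(0-) - ∫₀^r d(ν(s) γ) X(s))`. As `γ` is constant,
`d(ν(s) γ) = ν(s) ρ γ ds`. -/
def deviation (d : Fin n → ℝ) (X : StartedProcess T Ω n) : StartedProcess T Ω n where
  pre := d
  path r ω := M.gamma *ᵥ X.path r ω
    + (M.nu r)⁻¹ *ᵥ (d - M.gamma *ᵥ X.pre
      - ∫ s in Set.Iic r, (M.nu s * M.rho * M.gamma) *ᵥ X.path s ω)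

/-- `D` solves `dD = -ρ D ds + γ dX`, `D(0-) = d`, almost surely. As `γ` is constant,
`∫_{[0,r]} γ dX = γ (X(r) - X(0-))`. -/
def IsFVDeviation (P : Measure Ω) (d : Fin n → ℝ) (X D : StartedProcess T Ω n) : Prop :=
  D.pre = d ∧ ∀ᵐ ω ∂P,
    (Integrable fun s : Time T => M.rho *ᵥ D.path s ω) ∧
    ∀ r, D.path r ω = d - (∫ s in Set.Iic r, M.rho *ᵥ D.path s ω)
      + M.gamma *ᵥ (X.path r ω - X.pre)

/-- `E[∫₀^T ‖γ^{-1/2} D(s)‖² ds] < ∞`. -/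
def SqIntegrableDeviation (P : Measure Ω) (D : StartedProcess T Ω n) : Prop :=
  ∫⁻ ω, (∫⁻ s, ENNReal.ofReal
    ((M.gammaPow (-(1 / 2)) *ᵥ D.path s ω) ⬝ᵥ (M.gammaPow (-(1 / 2)) *ᵥ D.path s ω))) ∂P < ⊤

/-- `∑ₖ E[(∫₀^T |(γ^{-1/2} D)ᵀ Oᵀ diag(σ_{·,k}) O γ^{-1/2} D|² ds)^{1/2}] < ∞`. -/
def VolIntegrableDeviation {m : ℕ} (σ : Matrix (Fin n) (Fin m) ℝ) (P : Measure Ω)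
    (D : StartedProcess T Ω n) : Prop :=
  ∑ k, ∫⁻ ω, (∫⁻ s, ENNReal.ofReal
    (((M.gammaPow (-(1 / 2)) *ᵥ D.path s ω) ⬝ᵥ
      ((M.Oᵀ * Matrix.diagonal (fun j => σ j k) * M.O) *ᵥ
        (M.gammaPow (-(1 / 2)) *ᵥ D.path s ω))) ^ 2)) ^ (1 / 2 : ℝ) ∂P < ⊤

/-- The progressively measurable execution strategies with initial position `x`, initial
deviation `d` and terminal target `ξ`. -/
structure MemPM (hT : 0 < T) (ℱ : Filtration (Time T) mΩ) (P : Measure Ω)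
    (ξ : Ω → Fin n → ℝ) (x d : Fin n → ℝ) (X : StartedProcess T Ω n) : Prop where
  prog : IsStronglyProgressive ℱ X.path
  initial : X.pre = x
  terminal : ∀ᵐ ω ∂P, X.path (endTime hT) ω = ξ ω
  sq_integrable : ∀ᵐ ω ∂P, ∫⁻ s, ENNReal.ofReal (X.path s ω ⬝ᵥ X.path s ω) < ⊤
  dev : M.SqIntegrableDeviation P (M.deviation d X)

/-- The finite-variation execution strategies with initial position `x`, initial deviation `d`
and terminal target `ξ`, in the model with volatility `σ = 0`. -/
structure MemFV (m : ℕ) (hT : 0 < T) (ℱ : Filtration (Time T) mΩ) (P : Measure Ω)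
    (ξ : Ω → Fin n → ℝ) (x d : Fin n → ℝ) (X : StartedProcess T Ω n) : Prop where
  adapted : StronglyAdapted ℱ X.path
  rightContinuous : ∀ᵐ ω ∂P, ∀ s, ContinuousWithinAt (fun r => X.path r ω) (Set.Ici s) s
  leftLimits : ∀ᵐ ω ∂P, ∀ s, ∃ l, Tendsto (fun r => X.path r ω) (𝓝[<] s) (𝓝 l)
  finiteVariation : ∀ᵐ ω ∂P, BoundedVariationOn (fun r => X.path r ω) Set.univ
  initial : X.pre = x
  terminal : ∀ᵐ ω ∂P, X.path (endTime hT) ω = ξ ω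
  dev : ∃ D : StartedProcess T Ω n, M.IsFVDeviation P d X D ∧ StronglyAdapted ℱ D.path ∧
    M.SqIntegrableDeviation P D ∧
    M.VolIntegrableDeviation (0 : Matrix (Fin n) (Fin m) ℝ) P D

/-- The cost functional `J₀^{pm}` with risk matrix `Ξ` and running target `ζ`; `E₀` is the
conditional expectation with respect to `ℱ₀`. -/
def costPMGeneral (m : ℕ) (hT : 0 < T) (ℱ : Filtration (Time T) mΩ) (P : Measure Ω)
    (Ξ : Matrix (Fin n) (Fin n) ℝ) (ζ : Time T → Ω → Fin n → ℝ) (d : Fin n → ℝ)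
    (X : StartedProcess T Ω n) : Ω → ℝ := fun ω =>
  (1 / 2) * (P[fun ω => (M.deviation d X).path (endTime hT) ω ⬝ᵥ
      (M.gammaPow (-1) *ᵥ (M.deviation d X).path (endTime hT) ω) | ℱ (startTime hT)]) ω
  + (P[fun ω => ∫ s, (X.path s ω - ζ s ω) ⬝ᵥ (Ξ *ᵥ (X.path s ω - ζ s ω))
      | ℱ (startTime hT)]) ω
  + (P[fun ω => ∫ s, (M.deviation d X).path s ω ⬝ᵥ
      ((M.gammaPow (-(1 / 2)) * M.kappa m * M.gammaPow (-(1 / 2))) *ᵥ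
        (M.deviation d X).path s ω) | ℱ (startTime hT)]) ω
  - (1 / 2) * (d ⬝ᵥ (M.gammaPow (-1) *ᵥ d))

/-- The cost functional `J₀^{pm}` with `Ξ = 0` and `ζ = 0`. -/
def costPM (m : ℕ) (hT : 0 < T) (ℱ : Filtration (Time T) mΩ) (P : Measure Ω)
    (d : Fin n → ℝ) (X : StartedProcess T Ω n) : Ω → ℝ :=
  M.costPMGeneral m hT ℱ P 0 (fun _ _ => 0) d X

/-- `X` minimizes `J₀^{pm}` over the progressively measurable strategies with target `ξ = 0`. -/
def IsOptimal (m : ℕ) (hT : 0 < T) (ℱ : Filtration (Time T) mΩ) (P : Measure Ω)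
    (x d : Fin n → ℝ) (X : StartedProcess T Ω n) : Prop :=
  M.MemPM hT ℱ P (fun _ => 0) x d X ∧
  ∀ X' : StartedProcess T Ω n, M.MemPM hT ℱ P (fun _ => 0) x d X' →
    M.costPM m hT ℱ P d X ≤ᵐ[P] M.costPM m hT ℱ P d X'

end Deviation

end OWModel

end TradeExecution

end

open TradeExecution

/-! ### Integrals over the time interval and two Grönwall arguments -/

namespace TradeExecution

section TimeIntegral

variable {T : ℝ} {E : Type*} [NormedAddCommGroup E] [NormedSpace ℝ E]

/-! Since γ and ρ are constant and there is no risk term, 𝒜, 𝒞 and 𝒬 vanish and ℛ = κ. Write S =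
ℬℛ⁻¹ℬᵀ, which is positive semidefinite, and E_s = I + ½(T−s)S, which is therefore invertible on
[0,T].

Riccati equation. The driver collapses to −YSY and no longer sees Z, so the equation Y' = YSY, Y(T)
= ½I, is solved by ½E_s⁻¹ with Z = 0. For uniqueness, the difference of a bounded solution and the
explicit one is tested with its own sign at time t: the martingale increments have mean zero
(`IsItoIntegral.integral_mul_sub`), the driver is Lipschitz on bounded matrices, and a backward
Grönwall argument applies to the expected distance. Once Y is known to be deterministic, the
stochastic integrals sum to zero at T, and the isometry over the independent components kills every
Z (`IsItoIntegral.integrand_eq_zero`). The Itô integral is specified by L² approximation, so the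
isometry and the martingale property are first derived for simple processes from the second moments
of Brownian increments.

Optimal state. ℋ*(s) = E_s E_0⁻¹h₀, so Y(s)ℋ*(s) is constant and the linear equation has constant
drift; uniqueness is pathwise Grönwall.

Optimization. This part does not pass through the Riccati equation. The process w = D − γX satisfies
w(r) = d − γx − ∫₀ʳ ρD ds (`resiliencePart_eq`). Put u = γ^{-1/2}D. As X(T) = 0, this gives
γ^{-1/2}D(T) = h₀ + ℬ∫u, so up to a constant the cost is, path by path, ½|h₀ + ℬ∫u|² + ∫uᵀκu. Let v
be the constant control with 2κv + ℬᵀη = 0, where η = h₀ + Tℬv; here η = E_0⁻¹h₀. Completing the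
square (`quadratic_cost_eq`) writes the cost as a constant plus ½|ℬ∫(u−v)|² + ∫(u−v)ᵀκ(u−v). This
excess is nonnegative and, κ being positive definite, vanishes only for u = v almost everywhere. The
stated X* realizes u = v on [0,T) with w = γ^{1/2}ℋ*, and D determines X almost everywhere through
the equation for w. -/

theorem isFiniteMeasure_volume_time (T : ℝ) : IsFiniteMeasure (volume : Measure (Time T)) := by
  refine ⟨?_⟩
  have : (volume : Measure (Time T)) Set.univ = volume (Set.Icc (0 : ℝ) T) := by
    rw [← Subtype.coe_image_univ (Set.Icc (0 : ℝ) T)]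
    exact (comap_subtype_coe_apply measurableSet_Icc volume _)
  rw [this]
  simp

attribute [instance] isFiniteMeasure_volume_time

theorem measurePreserving_time_coe (T : ℝ) :
    MeasurePreserving ((↑) : Time T → ℝ) volume (volume.restrict (Set.Icc 0 T)) :=
  ⟨measurable_subtype_coe, map_comap_subtype_coe measurableSet_Icc volume⟩

theorem measurableEmbedding_time_coe (T : ℝ) : MeasurableEmbedding ((↑) : Time T → ℝ) :=
  MeasurableEmbedding.subtype_coe measurableSet_Icc

theorem setIntegral_Iic_time (f : ℝ → E) (r : Time T) :
    ∫ s in Set.Iic r, f s = ∫ s in (0 : ℝ)..r, f s := by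
  have h := (measurePreserving_time_coe T).setIntegral_preimage_emb
    (measurableEmbedding_time_coe T) f (Set.Iic (r : ℝ))
  rw [Measure.restrict_restrict measurableSet_Iic] at h
  have h1 : ((↑) : Time T → ℝ) ⁻¹' Set.Iic (r : ℝ) = Set.Iic r := by ext; simp
  have h2 : Set.Iic (r : ℝ) ∩ Set.Icc 0 T = Set.Icc 0 (r : ℝ) := by
    ext s; have := r.2.2; simp only [Set.mem_inter_iff, Set.mem_Iic, Set.mem_Icc]; grind
  rw [h1, h2] at h
  rw [h, intervalIntegral.integral_of_le r.2.1, integral_Icc_eq_integral_Ioc]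

theorem setIntegral_Ioi_time (f : ℝ → E) (r : Time T) :
    ∫ s in Set.Ioi r, f s = ∫ s in (r : ℝ)..T, f s := by
  have h := (measurePreserving_time_coe T).setIntegral_preimage_emb
    (measurableEmbedding_time_coe T) f (Set.Ioi (r : ℝ))
  rw [Measure.restrict_restrict measurableSet_Ioi] at h
  have h1 : ((↑) : Time T → ℝ) ⁻¹' Set.Ioi (r : ℝ) = Set.Ioi r := by ext; simp
  have h2 : Set.Ioi (r : ℝ) ∩ Set.Icc 0 T = Set.Ioc (r : ℝ) T := by
    ext s; have := r.2.1; simp only [Set.mem_inter_iff, Set.mem_Ioi, Set.mem_Icc, Set.mem_Ioc]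
    grind
  rw [h1, h2] at h
  rw [h, intervalIntegral.integral_of_le r.2.2]

theorem Iic_endTime (hT : 0 < T) : Set.Iic (endTime hT) = Set.univ := by
  ext s; simpa [endTime] using Subtype.mk_le_mk.2 s.2.2

theorem le_endTime (hT : 0 < T) (s : Time T) : s ≤ endTime hT := Subtype.mk_le_mk.2 s.2.2

theorem measure_endTime (hT : 0 < T) : (volume : Measure (Time T)) {endTime hT} = 0 := by
  have h := (measurePreserving_time_coe T).measure_preimage_emb
    (measurableEmbedding_time_coe T) {T}
  have h1 : ((↑) : Time T → ℝ) ⁻¹' {T} = {endTime hT} := by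
    ext s; simp [endTime, Subtype.ext_iff]
  rw [h1] at h
  rw [h]
  rw [Measure.restrict_apply (measurableSet_singleton T)]
  exact measure_mono_null Set.inter_subset_left Real.volume_singleton

/-- The terminal block trade happens at a null time, so formulas valid on [0,T) may be used under
every time integral. -/
theorem ae_lt_endTime (hT : 0 < T) : ∀ᵐ s : Time T, (s : ℝ) < T := by
  have : ∀ᵐ s : Time T, s ∉ ({endTime hT} : Set (Time T)) :=
    measure_eq_zero_iff_ae_notMem.1 (measure_endTime hT)
  filter_upwards [this] with s hs
  refine lt_of_le_of_ne s.2.2 fun h => hs ?_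
  exact Subtype.ext h

theorem continuous_setIntegral_Iic (hT : 0 < T) {f : Time T → E} (hf : Integrable f) :
    Continuous fun r : Time T => ∫ s in Set.Iic r, f s := by
  have hg : IntegrableOn (Set.IccExtend hT.le f) (Set.Icc 0 T) := by
    have := ((measurePreserving_time_coe T).integrable_comp_emb
      (measurableEmbedding_time_coe T) (g := Set.IccExtend hT.le f)).1
      (by simpa [Function.comp_def, Set.IccExtend_val] using hf)
    exact this
  have h := intervalIntegral.continuousOn_primitive_interval (a := 0) (b := T)
    (by rwa [Set.uIcc_of_le hT.le])
  rw [Set.uIcc_of_le hT.le] at h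
  have h2 := continuousOn_iff_continuous_domRestrict.1 h
  refine h2.congr fun r => ?_
  have := setIntegral_Iic_time (Set.IccExtend hT.le f) r
  simp only [Set.IccExtend_val] at this
  rw [this]
  rfl

/-- A backward Grönwall inequality without continuity. -/
theorem eq_zero_of_le_mul_setIntegral_Ioi {u : Time T → ℝ} {C K : ℝ} (hC : 0 ≤ C)
    (hu0 : ∀ t, 0 ≤ u t) (huK : ∀ t, u t ≤ K) (hum : AEStronglyMeasurable u volume)
    (hu : ∀ t, u t ≤ C * ∫ s in Set.Ioi t, u s) (t : Time T) : u t = 0 := by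
  have hint : Integrable u := Integrable.of_bound hum K
    (ae_of_all _ fun t => by rw [Real.norm_of_nonneg (hu0 t)]; exact huK t)
  -- Inserting the bound into itself k times gives a Taylor-type remainder, which tends to 0.
  -- Boundedness and measurability of `u` suffice.
  have key : ∀ (k : ℕ) (t : Time T), u t ≤ K * ((C * (T - t)) ^ k / k.factorial) := by
    intro k
    induction k with
    | zero => intro t; simpa using huK t
    | succ k ih =>
      intro t
      have hb : Integrable fun s : Time T => K * ((C * (T - (s : ℝ))) ^ k / k.factorial) := by
        have : Continuous fun s : Time T => K * ((C * (T - (s : ℝ))) ^ k / k.factorial) := by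
          fun_prop
        exact this.integrable_of_hasCompactSupport (HasCompactSupport.of_compactSpace _)
      refine (hu t).trans ?_
      calc C * ∫ s in Set.Ioi t, u s
          ≤ C * ∫ s in Set.Ioi t, K * ((C * (T - (s : ℝ))) ^ k / k.factorial) := by
            refine mul_le_mul_of_nonneg_left ?_ hC
            exact setIntegral_mono hint.integrableOn hb.integrableOn ih
        _ = K * ((C * (T - t)) ^ (k + 1) / (k + 1).factorial) := by
            rw [setIntegral_Ioi_time (fun s : ℝ => K * ((C * (T - s)) ^ k / k.factorial))]
            have hd : ∀ s ∈ Set.uIcc (t : ℝ) T, HasDerivAt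
                (fun s : ℝ => -(K * (C ^ k * (T - s) ^ (k + 1) / (k + 1).factorial)))
                (K * ((C * (T - s)) ^ k / k.factorial)) s := by
              intro s _
              have h1 : HasDerivAt (fun s : ℝ => T - s) (-1) s := by
                simpa using (hasDerivAt_id s).const_sub T
              have h2 := ((((h1.pow (k + 1)).const_mul (C ^ k)).div_const
                ((k + 1).factorial : ℝ)).const_mul K).neg
              convert! h2 using 1
              have : ((k + 1).factorial : ℝ) = (k + 1) * k.factorial := by
                rw [Nat.factorial_succ]; push_cast; ring
              rw [this]
              have : (k.factorial : ℝ) ≠ 0 := by positivity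
              have : (k + 1 : ℝ) ≠ 0 := by positivity
              push_cast
              rw [mul_pow]
              field_simp
            rw [intervalIntegral.integral_eq_sub_of_hasDerivAt hd
              (by apply Continuous.intervalIntegrable; fun_prop)]
            rw [mul_pow]
            simp
            ring
  refine le_antisymm ?_ (hu0 t)
  have h := (FloorSemiring.tendsto_pow_div_factorial_atTop (C * (T - (t : ℝ)))).const_mul K
  rw [mul_zero] at h
  exact ge_of_tendsto' h fun k => key k t

/-- A forward Grönwall inequality for integral equations with continuous right-hand side. -/
theorem eq_zero_of_eq_setIntegral_Iic [CompleteSpace E] (hT : 0 < T) {h F : Time T → E} {K : ℝ}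
    (hF : Continuous F) (hFh : ∀ s, ‖F s‖ ≤ K * ‖h s‖)
    (heq : ∀ t, h t = ∫ s in Set.Iic t, F s) (t : Time T) : h t = 0 := by
  -- `F` is extended by its end values to the whole line, so that its primitive is differentiable
  -- everywhere and the uniqueness statement for |f'| ≤ K|f|, f(0) = 0 applies to the primitive.
  have hg : Continuous (Set.IccExtend hT.le F) := hF.Icc_extend'
  have hf : ∀ x, HasDerivAt (fun x => ∫ s in (0 : ℝ)..x, Set.IccExtend hT.le F s)
      (Set.IccExtend hT.le F x) x := fun x =>
    intervalIntegral.integral_hasDerivAt_right (hg.intervalIntegrable _ _)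
      hg.aestronglyMeasurable.stronglyMeasurableAtFilter hg.continuousAt
  have hhf : ∀ s : Time T, h s = ∫ r in (0 : ℝ)..s, Set.IccExtend hT.le F r := by
    intro s
    have := setIntegral_Iic_time (Set.IccExtend hT.le F) s
    simp only [Set.IccExtend_val] at this
    rw [heq s, this]
  have := eq_zero_of_abs_deriv_le_mul_abs_self_of_eq_zero_right (K := K) (a := 0) (b := T)
    (fun x _ => (hf x).continuousAt.continuousWithinAt)
    (fun x _ => (hf x).hasDerivWithinAt) (by simp) ?_ t t.2
  · rw [hhf t]; exact this
  · intro x hx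
    have hx' : x ∈ Set.Icc 0 T := ⟨hx.1, hx.2.le⟩
    have h1 := hFh ⟨x, hx'⟩
    rw [hhf ⟨x, hx'⟩] at h1
    rwa [Set.IccExtend_of_mem _ _ hx']

end TimeIntegral

end TradeExecution

/-! ### Second moments of Brownian increments -/

namespace TradeExecution

section Gaussian

variable {m : ℕ} (v : NNReal)

theorem memLp_eval_pi_gaussianReal (k : Fin m) :
    MemLp (fun y : Fin m → ℝ => y k) 2 (Measure.pi fun _ => gaussianReal 0 v) :=
  (memLp_id_gaussianReal 2).comp_measurePreserving
    (measurePreserving_eval (fun _ : Fin m => gaussianReal 0 v) k)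

theorem integral_eval_pi_gaussianReal (k : Fin m) :
    ∫ y : Fin m → ℝ, y k ∂(Measure.pi fun _ => gaussianReal 0 v) = 0 := by
  have h := (measurePreserving_eval (fun _ : Fin m => gaussianReal 0 v) k).map_eq
  have h2 := integral_map (μ := Measure.pi fun _ : Fin m => gaussianReal 0 v)
    (φ := Function.eval k) (measurable_pi_apply k).aemeasurable (f := fun x : ℝ => x)
    (by fun_prop)
  rw [h, integral_id_gaussianReal] at h2
  exact h2.symm

theorem integral_eval_mul_eval_pi_gaussianReal (k l : Fin m) :
    ∫ y : Fin m → ℝ, y k * y l ∂(Measure.pi fun _ => gaussianReal 0 v)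
      = if k = l then (v : ℝ) else 0 := by
  split_ifs with hkl
  · subst hkl
    have h := (measurePreserving_eval (fun _ : Fin m => gaussianReal 0 v) k).map_eq
    have h2 := integral_map (μ := Measure.pi fun _ : Fin m => gaussianReal 0 v)
      (φ := Function.eval k) (measurable_pi_apply k).aemeasurable (f := fun x : ℝ => x * x)
      (by fun_prop)
    rw [h] at h2
    have h3 := variance_of_integral_eq_zero (μ := gaussianReal 0 v) (X := fun x => x)
      (by fun_prop) integral_id_gaussianReal
    rw [variance_fun_id_gaussianReal] at h3
    simp only [← pow_two] at h2 ⊢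
    rw [h3, h2]
  · have hind : iIndepFun (fun (i : Fin m) (ω : Fin m → ℝ) => ω i)
        (Measure.pi fun _ => gaussianReal 0 v) :=
      iIndepFun_pi (X := fun _ x => x) (fun i => by fun_prop)
    have h := (hind.indepFun hkl).integral_fun_mul_eq_mul_integral
      (measurable_pi_apply k).aestronglyMeasurable (measurable_pi_apply l).aestronglyMeasurable
    rw [h, integral_eval_pi_gaussianReal, zero_mul]

end Gaussian

variable {T : ℝ} {Ω : Type*} {mΩ : MeasurableSpace Ω} {m : ℕ}
  {ℱ : Filtration (Time T) mΩ} {P : Measure Ω} {W : Fin m → Time T → Ω → ℝ}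

theorem memLp_bdd_mul {c f : Ω → ℝ} {K : ℝ} {p : ℝ≥0∞} (hc : AEStronglyMeasurable c P)
    (hK : ∀ ω, |c ω| ≤ K) (hf : MemLp f p P) : MemLp (fun ω => c ω * f ω) p P := by
  refine MemLp.of_le_mul (c := K) hf (hc.mul hf.1) (ae_of_all _ fun ω => ?_)
  rw [norm_mul]
  exact mul_le_mul_of_nonneg_right (hK ω) (norm_nonneg _)

namespace IsBrownianMotion

theorem stronglyMeasurable_incr (hW : IsBrownianMotion ℱ P W) (k : Fin m) {a b r : Time T}
    (ha : a ≤ r) (hb : b ≤ r) :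
    StronglyMeasurable[ℱ r] fun ω => W k b ω - W k a ω :=
  ((hW.adapted k b).mono (ℱ.mono hb)).sub ((hW.adapted k a).mono (ℱ.mono ha))

theorem measurable_incr (hW : IsBrownianMotion ℱ P W) (a b : Time T) :
    Measurable fun ω k => W k b ω - W k a ω :=
  measurable_pi_lambda _ fun k =>
    (((hW.adapted k b).mono (ℱ.le b)).sub ((hW.adapted k a).mono (ℱ.le a))).measurable

theorem memLp_incr (hW : IsBrownianMotion ℱ P W) (k : Fin m) {a b : Time T} (hab : a ≤ b) :
    MemLp (fun ω => W k b ω - W k a ω) 2 P := by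
  have h := memLp_eval_pi_gaussianReal (Real.toNNReal ((b : ℝ) - a)) k
  rw [← hW.law a b hab] at h
  exact (memLp_map_measure_iff h.1 (hW.measurable_incr a b).aemeasurable).1 h

/-- Independence of the increment from the past factorizes the expectation. No integrability is
assumed: the product formula survives with the default value 0. -/
theorem integral_mul_comp_incr (hW : IsBrownianMotion ℱ P W) {a b : Time T} (hab : a ≤ b)
    {X : Ω → ℝ} (hX : StronglyMeasurable[ℱ a] X) {φ : (Fin m → ℝ) → ℝ} (hφ : Measurable φ) :
    ∫ ω, X ω * φ (fun k => W k b ω - W k a ω) ∂P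
      = (∫ ω, X ω ∂P) * ∫ y, φ y ∂(Measure.pi fun _ : Fin m =>
          gaussianReal 0 (Real.toNNReal ((b : ℝ) - a))) := by
  have h1 : IndepFun (fun ω k => W k b ω - W k a ω) X P :=
    (IndepFun_iff_Indep _ _ _).2
      (indep_of_indep_of_le_right (hW.indep a b hab) hX.measurable.comap_le)
  have h2 := (h1.comp hφ measurable_id).symm.integral_fun_mul_eq_mul_integral
    (hX.mono (ℱ.le a)).aestronglyMeasurable
    (hφ.comp (hW.measurable_incr a b)).aestronglyMeasurable
  rw [← hW.law a b hab, integral_map (hW.measurable_incr a b).aemeasurable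
    hφ.aestronglyMeasurable]
  exact h2

theorem integral_mul_incr (hW : IsBrownianMotion ℱ P W) (k : Fin m) {a b : Time T} (hab : a ≤ b)
    {X : Ω → ℝ} (hX : StronglyMeasurable[ℱ a] X) :
    ∫ ω, X ω * (W k b ω - W k a ω) ∂P = 0 := by
  rw [hW.integral_mul_comp_incr hab hX (φ := fun y => y k) (by fun_prop),
    integral_eval_pi_gaussianReal, mul_zero]

theorem integral_mul_incr_mul_incr (hW : IsBrownianMotion ℱ P W) (k l : Fin m) {a b : Time T}
    (hab : a ≤ b) {X : Ω → ℝ} (hX : StronglyMeasurable[ℱ a] X) :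
    ∫ ω, X ω * ((W k b ω - W k a ω) * (W l b ω - W l a ω)) ∂P
      = (∫ ω, X ω ∂P) * if k = l then (b : ℝ) - a else 0 := by
  rw [hW.integral_mul_comp_incr hab hX (φ := fun y => y k * y l) (by fun_prop),
    integral_eval_mul_eval_pi_gaussianReal, Real.coe_toNNReal _ (sub_nonneg.2 hab)]

/-- The length of the overlap of the intervals `(a, b]` and `(a', b']`. -/
def _root_.TradeExecution.overlap (a b a' b' : Time T) : ℝ :=
  max 0 (min (b : ℝ) b' - max (a : ℝ) a')

theorem _root_.TradeExecution.overlap_comm (a b a' b' : Time T) :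
    overlap a b a' b' = overlap a' b' a b := by
  rw [overlap, overlap, min_comm, max_comm (a : ℝ)]

/-- Both increments are cut at `a'` and at the smaller right end. A product of increments over
successive intervals has mean zero, since the later one is independent of everything before it; only
the common interval contributes. The order `a ≤ a'` makes both weights measurable at `a'`. -/
theorem integral_incr_mul_incr_of_le (hW : IsBrownianMotion ℱ P W)
    (k l : Fin m) {a b a' b' : Time T} (hab' : a' ≤ b') (haa' : a ≤ a')
    {c c' : Ω → ℝ} {K : ℝ}
    (hc : StronglyMeasurable[ℱ a] c) (hc' : StronglyMeasurable[ℱ a'] c')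
    (hK : ∀ ω, |c ω| ≤ K) (hK' : ∀ ω, |c' ω| ≤ K) :
    ∫ ω, (c ω * (W k b ω - W k a ω)) * (c' ω * (W l b' ω - W l a' ω)) ∂P
      = (if k = l then overlap a b a' b' else 0) * ∫ ω, c ω * c' ω ∂P := by
  have hcc' : StronglyMeasurable[ℱ a'] fun ω => c ω * c' ω := (hc.mono (ℱ.mono haa')).mul hc'
  have hbdd : ∀ ω, |c ω * c' ω| ≤ K * K := fun ω => by
    rw [abs_mul]
    exact mul_le_mul (hK ω) (hK' ω) (abs_nonneg _) ((abs_nonneg _).trans (hK ω))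
  have hint : ∀ {p q p' q' : Time T}, p ≤ q → p' ≤ q' → Integrable (fun ω =>
      (c ω * c' ω) * ((W k q ω - W k p ω) * (W l q' ω - W l p' ω))) P := by
    intro p q p' q' hpq hpq'
    exact memLp_one_iff_integrable.1 <| memLp_bdd_mul (hcc'.mono (ℱ.le a')).aestronglyMeasurable
      hbdd (memLp_one_iff_integrable.2
        ((hW.memLp_incr k hpq).integrable_mul (hW.memLp_incr l hpq')))
  have hright : ∀ {p q p' q' : Time T}, a' ≤ p' → q ≤ p' → p ≤ p' → p' ≤ q' →
      ∫ ω, (c ω * c' ω) * ((W k q ω - W k p ω) * (W l q' ω - W l p' ω)) ∂P = 0 := by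
    intro p q p' q' h1 h2 h3 h4
    rw [← hW.integral_mul_incr l h4
      ((hcc'.mono (ℱ.mono h1)).mul (hW.stronglyMeasurable_incr k h3 h2))]
    refine integral_congr_ae (ae_of_all _ fun ω => ?_)
    simp only [Pi.mul_apply]
    ring
  have hleft : ∀ {p q p' q' : Time T}, a' ≤ p → q' ≤ p → p' ≤ p → p ≤ q →
      ∫ ω, (c ω * c' ω) * ((W k q ω - W k p ω) * (W l q' ω - W l p' ω)) ∂P = 0 := by
    intro p q p' q' h1 h2 h3 h4
    rw [← hW.integral_mul_incr k h4
      ((hcc'.mono (ℱ.mono h1)).mul (hW.stronglyMeasurable_incr l h3 h2))]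
    refine integral_congr_ae (ae_of_all _ fun ω => ?_)
    simp only [Pi.mul_apply]
    ring
  have hrw : ∀ ω, (c ω * (W k b ω - W k a ω)) * (c' ω * (W l b' ω - W l a' ω))
      = (c ω * c' ω) * ((W k b ω - W k a ω) * (W l b' ω - W l a' ω)) := fun ω => by ring
  simp only [hrw]
  rcases le_total b a' with hba' | hba'
  · rw [hright le_rfl hba' haa' hab']
    have : overlap a b a' b' = 0 := by
      refine max_eq_left (sub_nonpos.2 ?_)
      exact (min_le_left _ _).trans ((show (b : ℝ) ≤ a' from hba').trans (le_max_right _ _))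
    rw [this]
    simp
  · set p := min b b' with hp
    have hap : a' ≤ p := le_min hba' hab'
    have hpb : p ≤ b := min_le_left _ _
    have hpb' : p ≤ b' := min_le_right _ _
    have hov : overlap a b a' b' = (p : ℝ) - a' := by
      have h1 : min (b : ℝ) b' = p := by
        rcases le_total b b' with h | h
        · rw [hp, min_eq_left h, min_eq_left (show (b : ℝ) ≤ b' from h)]
        · rw [hp, min_eq_right h, min_eq_right (show (b' : ℝ) ≤ b from h)]
      rw [overlap, h1, max_eq_right (show (a : ℝ) ≤ a' from haa'),
        max_eq_right (sub_nonneg.2 (show (a' : ℝ) ≤ p from hap))]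
    -- `p` is one of `b`, `b'`, so one of the two remaining increments is over an empty interval.
    have hlast : ∀ ω, (W k b ω - W k p ω) * (W l b' ω - W l p ω) = 0 := fun ω => by
      rcases min_choice b b' with h | h
      · rw [hp, h]; simp
      · rw [hp, h]; simp
    have hsplit : ∀ ω, (c ω * c' ω) * ((W k b ω - W k a ω) * (W l b' ω - W l a' ω))
        = (c ω * c' ω) * ((W k a' ω - W k a ω) * (W l b' ω - W l a' ω))
        + (c ω * c' ω) * ((W k p ω - W k a' ω) * (W l p ω - W l a' ω))
        + (c ω * c' ω) * ((W k p ω - W k a' ω) * (W l b' ω - W l p ω))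
        + (c ω * c' ω) * ((W k b ω - W k p ω) * (W l p ω - W l a' ω)) := fun ω => by
      linear_combination (c ω * c' ω) * hlast ω
    simp only [hsplit]
    have i1 := hint haa' hab'
    have i2 := hint hap hap
    have i3 := hint hap hpb'
    have i4 := hint hpb hap
    rw [integral_add (by simpa using! (i1.add i2).add i3) i4,
      integral_add (by simpa using! i1.add i2) i3, integral_add i1 i2,
      hright le_rfl le_rfl haa' hab', hright hap le_rfl hap hpb', hleft hap le_rfl hap hpb,
      hW.integral_mul_incr_mul_incr k l hap hcc', hov]
    ring

theorem integral_incr_mul_incr (hW : IsBrownianMotion ℱ P W)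
    (k l : Fin m) {a b a' b' : Time T} (hab : a ≤ b) (hab' : a' ≤ b')
    {c c' : Ω → ℝ} {K : ℝ}
    (hc : StronglyMeasurable[ℱ a] c) (hc' : StronglyMeasurable[ℱ a'] c')
    (hK : ∀ ω, |c ω| ≤ K) (hK' : ∀ ω, |c' ω| ≤ K) :
    ∫ ω, (c ω * (W k b ω - W k a ω)) * (c' ω * (W l b' ω - W l a' ω)) ∂P
      = (if k = l then overlap a b a' b' else 0) * ∫ ω, c ω * c' ω ∂P := by
  rcases le_total a a' with h | h
  · exact hW.integral_incr_mul_incr_of_le k l hab' h hc hc' hK hK'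
  · have := hW.integral_incr_mul_incr_of_le (b := b') l k hab h hc' hc hK' hK
    rw [overlap_comm a' b', integral_congr_ae (ae_of_all _ fun ω => mul_comm (c' ω) (c ω)),
      integral_congr_ae (ae_of_all _ fun ω =>
        mul_comm (c' ω * (W l b' ω - W l a' ω)) (c ω * (W k b ω - W k a ω)))] at this
    simpa only [eq_comm (a := l)] using this

end IsBrownianMotion

end TradeExecution

/-! ### Itô isometry and martingale property for simple processes -/

namespace TradeExecution

variable {T : ℝ} {Ω : Type*} {mΩ : MeasurableSpace Ω} {m : ℕ}
  {ℱ : Filtration (Time T) mΩ} {P : Measure Ω} {W : Fin m → Time T → Ω → ℝ}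

theorem volume_real_Ioc_time (a b : Time T) :
    (volume : Measure (Time T)).real (Set.Ioc a b) = max 0 ((b : ℝ) - a) := by
  have h := (measurePreserving_time_coe T).measure_preimage_emb
    (measurableEmbedding_time_coe T) (Set.Ioc (a : ℝ) b)
  have h1 : ((↑) : Time T → ℝ) ⁻¹' Set.Ioc (a : ℝ) b = Set.Ioc a b := by ext; simp
  have h2 : Set.Ioc (a : ℝ) b ∩ Set.Icc 0 T = Set.Ioc (a : ℝ) b := by
    refine Set.inter_eq_left.2 fun s hs => ⟨a.2.1.trans hs.1.le, hs.2.trans b.2.2⟩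
  rw [h1, Measure.restrict_apply measurableSet_Ioc, h2, Real.volume_Ioc] at h
  rw [Measure.real, h, ENNReal.toReal_ofReal', max_comm]

theorem integral_indicator_Ioc_mul (a b a' b' : Time T) (x y : ℝ) :
    ∫ s, (Set.Ioc a b).indicator (fun _ => x) s * (Set.Ioc a' b').indicator (fun _ => y) s
      = overlap a b a' b' * (x * y) := by
  have h : ∀ s, (Set.Ioc a b).indicator (fun _ => x) s * (Set.Ioc a' b').indicator (fun _ => y) s
      = (Set.Ioc (max a a') (min b b')).indicator (fun _ => x * y) s := by
    intro s
    rw [← Set.inter_indicator_mul, Set.Ioc_inter_Ioc]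
  simp only [h]
  rw [integral_indicator measurableSet_Ioc, setIntegral_const, volume_real_Ioc_time, smul_eq_mul,
    overlap]
  congr 3

namespace SimpleProcess

theorem stronglyMeasurable_coeff (S : SimpleProcess ℱ) (i : ℕ) : StronglyMeasurable (S.c i) :=
  (S.meas i).mono (ℱ.le _)

theorem measurable_eval (S : SimpleProcess ℱ) :
    Measurable fun p : Time T × Ω => S.eval p.1 p.2 := by
  unfold SimpleProcess.eval
  refine Finset.measurable_sum _ fun i _ => ?_
  have h : (fun p : Time T × Ω => (Set.Ioc (S.t i) (S.t (i + 1))).indicator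
      (fun _ => S.c i p.2) p.1)
      = (Prod.fst ⁻¹' Set.Ioc (S.t i) (S.t (i + 1))).indicator fun p => S.c i p.2 := by
    ext p; simp [Set.indicator]
  rw [h]
  exact ((S.stronglyMeasurable_coeff i).measurable.comp measurable_snd).indicator
    (measurable_fst measurableSet_Ioc)

theorem integrable_indicator_Ioc_mul (a b a' b' : Time T) (x y : ℝ) :
    Integrable fun s : Time T =>
      (Set.Ioc a b).indicator (fun _ => x) s * (Set.Ioc a' b').indicator (fun _ => y) s := by
  simp only [← Set.inter_indicator_mul]
  exact (integrable_const (x * y)).indicator (measurableSet_Ioc.inter measurableSet_Ioc)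

theorem eval_sq (S : SimpleProcess ℱ) (s : Time T) (ω : Ω) :
    S.eval s ω ^ 2 = ∑ i ∈ Finset.range S.N, ∑ j ∈ Finset.range S.N,
      (Set.Ioc (S.t i) (S.t (i + 1))).indicator (fun _ => S.c i ω) s
        * (Set.Ioc (S.t j) (S.t (j + 1))).indicator (fun _ => S.c j ω) s := by
  rw [pow_two, SimpleProcess.eval, Finset.sum_mul_sum]

theorem integrable_eval_sq (S : SimpleProcess ℱ) (ω : Ω) :
    Integrable fun s => S.eval s ω ^ 2 := by
  simp only [eval_sq]
  exact integrable_finsetSum _ fun i _ => integrable_finsetSum _ fun j _ =>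
    integrable_indicator_Ioc_mul _ _ _ _ _ _

theorem integral_eval_sq (S : SimpleProcess ℱ) (ω : Ω) :
    ∫ s, S.eval s ω ^ 2 = ∑ i ∈ Finset.range S.N, ∑ j ∈ Finset.range S.N,
      overlap (S.t i) (S.t (i + 1)) (S.t j) (S.t (j + 1)) * (S.c i ω * S.c j ω) := by
  simp only [eval_sq]
  rw [integral_finsetSum _ fun i _ => integrable_finsetSum _ fun j _ =>
    integrable_indicator_Ioc_mul _ _ _ _ _ _]
  refine Finset.sum_congr rfl fun i _ => ?_
  rw [integral_finsetSum _ fun j _ => integrable_indicator_Ioc_mul _ _ _ _ _ _]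
  exact Finset.sum_congr rfl fun j _ => integral_indicator_Ioc_mul _ _ _ _ _ _

theorem integrable_coeff_mul [IsFiniteMeasure P] (S : SimpleProcess ℱ) (i j : ℕ) :
    Integrable (fun ω => S.c i ω * S.c j ω) P := by
  obtain ⟨K, hK⟩ := S.bdd
  refine Integrable.of_bound (C := K * K)
    ((S.stronglyMeasurable_coeff i).mul (S.stronglyMeasurable_coeff j)).aestronglyMeasurable
    (ae_of_all _ fun ω => ?_)
  rw [norm_mul]
  exact mul_le_mul (hK i ω) (hK j ω) (abs_nonneg _) ((abs_nonneg _).trans (hK i ω))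

theorem lintegral_eval_sq [IsFiniteMeasure P] (S : SimpleProcess ℱ) :
    ∫⁻ ω, (∫⁻ s, ENNReal.ofReal (S.eval s ω ^ 2)) ∂P
      = ENNReal.ofReal (∑ i ∈ Finset.range S.N, ∑ j ∈ Finset.range S.N,
        overlap (S.t i) (S.t (i + 1)) (S.t j) (S.t (j + 1)) * ∫ ω, S.c i ω * S.c j ω ∂P) := by
  have h1 : ∀ ω, ∫⁻ s, ENNReal.ofReal (S.eval s ω ^ 2) = ENNReal.ofReal (∫ s, S.eval s ω ^ 2) :=
    fun ω => (ofReal_integral_eq_lintegral_ofReal (S.integrable_eval_sq ω)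
      (ae_of_all _ fun s => sq_nonneg _)).symm
  have hint : ∀ i j, Integrable (fun ω => overlap (S.t i) (S.t (i + 1)) (S.t j) (S.t (j + 1))
      * (S.c i ω * S.c j ω)) P := fun i j => (S.integrable_coeff_mul i j).const_mul _
  simp only [h1]
  rw [← ofReal_integral_eq_lintegral_ofReal]
  · congr 1
    simp only [integral_eval_sq]
    rw [integral_finsetSum _ fun i _ => integrable_finsetSum _ fun j _ => hint i j]
    refine Finset.sum_congr rfl fun i _ => ?_
    rw [integral_finsetSum _ fun j _ => hint i j]
    exact Finset.sum_congr rfl fun j _ => integral_const_mul _ _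
  · simp only [integral_eval_sq]
    exact integrable_finsetSum _ fun i _ => integrable_finsetSum _ fun j _ => hint i j
  · exact ae_of_all _ fun ω => integral_nonneg fun s => sq_nonneg _

theorem integral_endTime (hT : 0 < T) (S : SimpleProcess ℱ) (w : Time T → Ω → ℝ) (ω : Ω) :
    S.integral w (endTime hT) ω
      = ∑ i ∈ Finset.range S.N, S.c i ω * (w (S.t (i + 1)) ω - w (S.t i) ω) := by
  simp only [SimpleProcess.integral, min_eq_left (le_endTime hT _)]

theorem memLp_integral (hW : IsBrownianMotion ℱ P W) (S : SimpleProcess ℱ) (k : Fin m)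
    (r : Time T) : MemLp (S.integral (W k) r) 2 P := by
  obtain ⟨K, hK⟩ := S.bdd
  have : S.integral (W k) r = fun ω => ∑ i ∈ Finset.range S.N,
    S.c i ω * (W k (min (S.t (i + 1)) r) ω - W k (min (S.t i) r) ω) := rfl
  rw [this]
  exact memLp_finsetSum _ fun i _ => memLp_bdd_mul
    (S.stronglyMeasurable_coeff i).aestronglyMeasurable (hK i)
    (hW.memLp_incr k (min_le_min_right _ (S.mono (Nat.le_succ i))))

/-- For `S = S'` and `k = l` the right-hand side is the double sum of overlaps that computes the L²
norm of the integrand in `lintegral_eval_sq`, which is the isometry. For `k ≠ l` the integrals are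
uncorrelated. -/
theorem integral_integral_mul_integral [IsFiniteMeasure P] (hT : 0 < T)
    (hW : IsBrownianMotion ℱ P W)
    (S S' : SimpleProcess ℱ) (k l : Fin m) :
    ∫ ω, S.integral (W k) (endTime hT) ω * S'.integral (W l) (endTime hT) ω ∂P
      = if k = l then ∑ i ∈ Finset.range S.N, ∑ j ∈ Finset.range S'.N,
        overlap (S.t i) (S.t (i + 1)) (S'.t j) (S'.t (j + 1)) * ∫ ω, S.c i ω * S'.c j ω ∂P
        else 0 := by
  obtain ⟨K, hK⟩ := S.bdd
  obtain ⟨K', hK'⟩ := S'.bdd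
  have hm : ∀ i, S.t i ≤ S.t (i + 1) := fun i => S.mono (Nat.le_succ i)
  have hm' : ∀ i, S'.t i ≤ S'.t (i + 1) := fun i => S'.mono (Nat.le_succ i)
  have hint : ∀ i j, Integrable (fun ω => (S.c i ω * (W k (S.t (i + 1)) ω - W k (S.t i) ω))
      * (S'.c j ω * (W l (S'.t (j + 1)) ω - W l (S'.t j) ω))) P := fun i j =>
    (memLp_bdd_mul (S.stronglyMeasurable_coeff i).aestronglyMeasurable (hK i)
      (hW.memLp_incr k (hm i))).integrable_mul
    (memLp_bdd_mul (S'.stronglyMeasurable_coeff j).aestronglyMeasurable (hK' j)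
      (hW.memLp_incr l (hm' j)))
  simp only [integral_endTime, Finset.sum_mul_sum]
  rw [integral_finsetSum _ fun i _ => integrable_finsetSum _ fun j _ => hint i j]
  have h : ∀ i j, ∫ ω, (S.c i ω * (W k (S.t (i + 1)) ω - W k (S.t i) ω))
      * (S'.c j ω * (W l (S'.t (j + 1)) ω - W l (S'.t j) ω)) ∂P
      = (if k = l then overlap (S.t i) (S.t (i + 1)) (S'.t j) (S'.t (j + 1)) else 0)
        * ∫ ω, S.c i ω * S'.c j ω ∂P := fun i j =>
    hW.integral_incr_mul_incr k l (hm i) (hm' j) (S.meas i) (S'.meas j) (K := max K K')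
      (fun ω => (hK i ω).trans (le_max_left _ _)) (fun ω => (hK' j ω).trans (le_max_right _ _))
  split_ifs at h ⊢ with hkl
  · refine Finset.sum_congr rfl fun i _ => ?_
    rw [integral_finsetSum _ fun j _ => hint i j]
    exact Finset.sum_congr rfl fun j _ => h i j
  · refine Finset.sum_eq_zero fun i _ => ?_
    rw [integral_finsetSum _ fun j _ => hint i j]
    exact Finset.sum_eq_zero fun j _ => by rw [h i j, zero_mul]

/-- The Itô isometry for simple integrands against a multidimensional Brownian motion. -/
theorem lintegral_sum_integral_sq [IsFiniteMeasure P] (hT : 0 < T) (hW : IsBrownianMotion ℱ P W)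
    (S : Fin m → SimpleProcess ℱ) :
    ∫⁻ ω, ENNReal.ofReal ((∑ k, (S k).integral (W k) (endTime hT) ω) ^ 2) ∂P
      = ∑ k, ∫⁻ ω, (∫⁻ s, ENNReal.ofReal ((S k).eval s ω ^ 2)) ∂P := by
  have hL := fun k => (S k).memLp_integral hW k (endTime hT)
  have hint : ∀ k l, Integrable (fun ω => (S k).integral (W k) (endTime hT) ω
      * (S l).integral (W l) (endTime hT) ω) P := fun k l => (hL k).integrable_mul (hL l)
  rw [← ofReal_integral_eq_lintegral_ofReal]
  · simp only [lintegral_eval_sq]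
    rw [← ENNReal.ofReal_sum_of_nonneg]
    · congr 1
      simp only [pow_two, Finset.sum_mul_sum]
      rw [integral_finsetSum _ fun i _ => integrable_finsetSum _ fun j _ => hint i j]
      refine Finset.sum_congr rfl fun k _ => ?_
      rw [integral_finsetSum _ fun j _ => hint k j]
      simp only [integral_integral_mul_integral hT hW]
      simp
    · intro k _
      have h := integral_integral_mul_integral hT hW (S k) (S k) k k
      rw [if_pos rfl] at h
      rw [← h]
      exact integral_nonneg fun ω => mul_self_nonneg _
  · simp only [pow_two, Finset.sum_mul_sum]
    exact integrable_finsetSum _ fun i _ => integrable_finsetSum _ fun j _ => hint i j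
  · exact ae_of_all _ fun ω => sq_nonneg _

theorem lintegral_integral_sq [IsFiniteMeasure P] (hT : 0 < T) (hW : IsBrownianMotion ℱ P W)
    (S : SimpleProcess ℱ) (k : Fin m) :
    ∫⁻ ω, ENNReal.ofReal (S.integral (W k) (endTime hT) ω ^ 2) ∂P
      = ∫⁻ ω, (∫⁻ s, ENNReal.ofReal (S.eval s ω ^ 2)) ∂P := by
  have hL := S.memLp_integral hW k (endTime hT)
  rw [← ofReal_integral_eq_lintegral_ofReal hL.integrable_sq (ae_of_all _ fun ω => sq_nonneg _),
    lintegral_eval_sq]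
  simp only [pow_two]
  rw [integral_integral_mul_integral hT hW, if_pos rfl]

/-- The part of the integral after `t` uses only increments between max(tᵢ, t) and max(tᵢ₊₁, t), by
the relation min + max = sum along the path. The weights `c` and `S.c i` are both measurable at the
left end, so every term has mean zero. -/
theorem integral_mul_integral_sub [IsFiniteMeasure P] (hT : 0 < T) (hW : IsBrownianMotion ℱ P W)
    (S : SimpleProcess ℱ) (k : Fin m) {t : Time T} {c : Ω → ℝ} {K : ℝ}
    (hc : StronglyMeasurable[ℱ t] c) (hK : ∀ ω, |c ω| ≤ K) :
    ∫ ω, c ω * (S.integral (W k) (endTime hT) ω - S.integral (W k) t ω) ∂P = 0 := by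
  obtain ⟨K', hK'⟩ := S.bdd
  have hm : ∀ i, S.t i ≤ S.t (i + 1) := fun i => S.mono (Nat.le_succ i)
  have hw : ∀ (u : Time T) ω, W k (min u t) ω + W k (max u t) ω = W k u ω + W k t ω := by
    intro u ω
    rcases le_total u t with h | h
    · rw [min_eq_left h, max_eq_right h]
    · rw [min_eq_right h, max_eq_left h, add_comm]
  have hrw : ∀ ω, c ω * (S.integral (W k) (endTime hT) ω - S.integral (W k) t ω)
      = ∑ i ∈ Finset.range S.N, (c ω * S.c i ω)
        * (W k (max (S.t (i + 1)) t) ω - W k (max (S.t i) t) ω) := by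
    intro ω
    rw [integral_endTime, SimpleProcess.integral, ← Finset.sum_sub_distrib, Finset.mul_sum]
    refine Finset.sum_congr rfl fun i _ => ?_
    linear_combination (c ω * S.c i ω) * (hw (S.t i) ω - hw (S.t (i + 1)) ω)
  have hcm : ∀ i, StronglyMeasurable[ℱ (max (S.t i) t)] fun ω => c ω * S.c i ω := fun i =>
    (hc.mono (ℱ.mono (le_max_right _ _))).mul ((S.meas i).mono (ℱ.mono (le_max_left _ _)))
  simp only [hrw]
  rw [integral_finsetSum]
  · exact Finset.sum_eq_zero fun i _ =>
      hW.integral_mul_incr k (max_le_max_right _ (hm i)) (hcm i)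
  · intro i _
    refine (memLp_bdd_mul (K := K * K') ((hcm i).mono (ℱ.le _)).aestronglyMeasurable (fun ω => ?_)
      (hW.memLp_incr k (max_le_max_right _ (hm i)))).integrable one_le_two
    rw [abs_mul]
    exact mul_le_mul (hK ω) (hK' i ω) (abs_nonneg _) ((abs_nonneg _).trans (hK ω))

end SimpleProcess

end TradeExecution

/-! ### Isometry and martingale property of the Itô integral -/

namespace TradeExecution

variable {T : ℝ} {Ω : Type*} {mΩ : MeasurableSpace Ω} {m : ℕ}
  {ℱ : Filtration (Time T) mΩ} {P : Measure Ω} {W : Fin m → Time T → Ω → ℝ}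

/-- Progressive measurability evaluated at the terminal time is joint measurability. -/
theorem stronglyMeasurable_uncurry_of_progressive {β : Type*} [TopologicalSpace β] (hT : 0 < T)
    {u : Time T → Ω → β} (h : IsStronglyProgressive ℱ u) :
    StronglyMeasurable fun p : Time T × Ω => u p.1 p.2 := by
  have h1 : StronglyMeasurable fun p : Set.Iic (endTime hT) × Ω => u p.1 p.2 :=
    (h (endTime hT)).mono (sup_le_sup le_rfl (MeasurableSpace.comap_mono (ℱ.le _)))
  have h2 : Measurable fun p : Time T × Ω =>
      ((⟨p.1, le_endTime hT p.1⟩ : Set.Iic (endTime hT)), p.2) :=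
    measurable_fst.subtype_mk.prodMk measurable_snd
  exact h1.comp_measurable h2

/-- Replaces the triangle inequality in L² while staying in `ℝ≥0∞`, where no integrability has to be
checked. -/
theorem ofReal_sq_le_two_mul (a b : ℝ) :
    ENNReal.ofReal (a ^ 2) ≤ 2 * ENNReal.ofReal ((a - b) ^ 2) + 2 * ENNReal.ofReal (b ^ 2) := by
  have h2 : (2 : ℝ≥0∞) = ENNReal.ofReal 2 := by simp
  rw [h2, ← ENNReal.ofReal_mul zero_le_two, ← ENNReal.ofReal_mul zero_le_two,
    ← ENNReal.ofReal_add (by positivity) (by positivity)]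
  exact ENNReal.ofReal_le_ofReal (by nlinarith [sq_nonneg (a - 2 * b)])

theorem lintegral_sq_le_two_mul [SFinite P] {u v : Time T → Ω → ℝ}
    (hu : Measurable fun p : Time T × Ω => u p.1 p.2)
    (hv : Measurable fun p : Time T × Ω => v p.1 p.2) :
    ∫⁻ ω, (∫⁻ s, ENNReal.ofReal (u s ω ^ 2)) ∂P
      ≤ 2 * ∫⁻ ω, (∫⁻ s, ENNReal.ofReal ((u s ω - v s ω) ^ 2)) ∂P
        + 2 * ∫⁻ ω, (∫⁻ s, ENNReal.ofReal (v s ω ^ 2)) ∂P := by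
  have h1 := (hu.pow_const 2).ennreal_ofReal
  have h2 := ((hu.sub hv).pow_const 2).ennreal_ofReal
  have h3 := (hv.pow_const 2).ennreal_ofReal
  have e1 := lintegral_prod_symm' (μ := (volume : Measure (Time T))) (ν := P) _ h1
  have e2 := lintegral_prod_symm' (μ := (volume : Measure (Time T))) (ν := P) _ h2
  have e3 := lintegral_prod_symm' (μ := (volume : Measure (Time T))) (ν := P) _ h3
  refine e1.symm.le.trans (le_trans ?_
    (add_le_add (mul_le_mul_right e2.le 2) (mul_le_mul_right e3.le 2)))
  rw [← lintegral_const_mul _ h2, ← lintegral_const_mul _ h3, ← lintegral_add_left (h2.const_mul 2)]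
  exact lintegral_mono fun p => ofReal_sq_le_two_mul _ _

theorem eq_zero_of_tendsto_two_mul {x : ℝ≥0∞} {f g : ℕ → ℝ≥0∞} (hf : Tendsto f atTop (𝓝 0))
    (hg : Tendsto g atTop (𝓝 0)) (h : ∀ j, x ≤ 2 * f j + 2 * g j) : x = 0 := by
  have h1 : Tendsto (fun j => 2 * f j + 2 * g j) atTop (𝓝 (2 * 0 + 2 * 0)) :=
    (ENNReal.Tendsto.const_mul hf (Or.inr (by simp))).add
      (ENNReal.Tendsto.const_mul hg (Or.inr (by simp)))
  rw [mul_zero, add_zero] at h1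
  exact le_antisymm (ge_of_tendsto' h1 h) bot_le

namespace IsItoIntegral

variable {k : Fin m} {H I : Time T → Ω → ℝ}

theorem stronglyMeasurable (h : IsItoIntegral ℱ P (W k) H I) (r : Time T) :
    StronglyMeasurable (I r) := (h.2.1 r).mono (ℱ.le r)

/-- Some simple integral lies at finite L² distance from `I r`, and simple integrals are square
integrable. -/
theorem memLp (hW : IsBrownianMotion ℱ P W) (h : IsItoIntegral ℱ P (W k) H I) (r : Time T) :
    MemLp (I r) 2 P := by
  have hI := h.stronglyMeasurable r
  obtain ⟨-, -, -, S, -, hS⟩ := h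
  obtain ⟨j, hj⟩ := ((hS r).eventually (gt_mem_nhds (zero_lt_one))).exists
  have hA := (S j).memLp_integral hW k r
  have hd : MemLp (fun ω => I r ω - (S j).integral (W k) r ω) 2 P := by
    have hm : AEStronglyMeasurable (fun ω => I r ω - (S j).integral (W k) r ω) P :=
      hI.aestronglyMeasurable.sub hA.1
    refine (memLp_two_iff_integrable_sq hm).2 ?_
    exact (lintegral_ofReal_ne_top_iff_integrable (hm.pow 2)
      (ae_of_all _ fun ω => sq_nonneg _)).1 (hj.trans ENNReal.one_lt_top).ne
  convert! hd.add hA using 1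
  ext ω
  simp

/-- The Itô integral has the martingale property. -/
theorem integral_mul_sub [IsProbabilityMeasure P] (hT : 0 < T) (hW : IsBrownianMotion ℱ P W)
    (h : IsItoIntegral ℱ P (W k) H I) {t : Time T} {c : Ω → ℝ} {K : ℝ}
    (hc : StronglyMeasurable[ℱ t] c) (hK : ∀ ω, |c ω| ≤ K) :
    ∫ ω, c ω * (I (endTime hT) ω - I t ω) ∂P = 0 := by
  have hL := fun r => h.memLp hW r
  obtain ⟨-, -, -, S, -, hS⟩ := h
  have hcm := (hc.mono (ℱ.le t)).aestronglyMeasurable (μ := P)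
  have hA := fun j r => (S j).memLp_integral hW k r
  -- The L¹ norm is at most the L² norm on a probability space, so L² convergence of the simple
  -- integrals passes to expectations against the bounded factor `c`.
  have h1 : ∀ (r : Time T), Tendsto (fun j => ∫ ω, c ω * (S j).integral (W k) r ω ∂P) atTop
      (𝓝 (∫ ω, c ω * I r ω ∂P)) := by
    intro r
    refine tendsto_integral_of_L1 _
      ((memLp_bdd_mul hcm hK (hL r)).integrable one_le_two).aestronglyMeasurable
      (Eventually.of_forall fun j => (memLp_bdd_mul hcm hK (hA j r)).integrable one_le_two) ?_
    have hbd : ∀ j, ∫⁻ ω, ‖c ω * (S j).integral (W k) r ω - c ω * I r ω‖ₑ ∂P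
        ≤ ENNReal.ofReal K *
          (∫⁻ ω, ENNReal.ofReal ((I r ω - (S j).integral (W k) r ω) ^ 2) ∂P) ^ (1 / 2 : ℝ) := by
      intro j
      have hm : AEStronglyMeasurable (fun ω => I r ω - (S j).integral (W k) r ω) P :=
        (hL r).1.sub (hA j r).1
      have e1 := eLpNorm_le_eLpNorm_of_exponent_le (μ := P) (p := 1) (q := 2) one_le_two hm
      rw [eLpNorm_one_eq_lintegral_enorm, eLpNorm_eq_lintegral_rpow_enorm_toReal
        (by simp) (by simp)] at e1
      have e2 : ∀ x : ℝ, ‖x‖ₑ ^ (2 : ℝ) = ENNReal.ofReal (x ^ 2) := by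
        intro x
        rw [Real.enorm_eq_ofReal_abs, ENNReal.ofReal_rpow_of_nonneg (abs_nonneg x) zero_le_two]
        simp
      simp only [ENNReal.toReal_ofNat, e2] at e1
      refine le_trans ?_ (mul_le_mul_right e1 _)
      rw [← lintegral_const_mul'' _ hm.enorm]
      refine lintegral_mono fun ω => ?_
      rw [← mul_sub, enorm_mul, Real.enorm_eq_ofReal_abs (c ω), enorm_sub_rev]
      exact mul_le_mul_left (ENNReal.ofReal_le_ofReal (hK ω)) _
    have hlim : Tendsto (fun j => ENNReal.ofReal K *
        (∫⁻ ω, ENNReal.ofReal ((I r ω - (S j).integral (W k) r ω) ^ 2) ∂P) ^ (1 / 2 : ℝ))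
        atTop (𝓝 0) := by
      have := ENNReal.Tendsto.const_mul (a := ENNReal.ofReal K)
        ((hS r).ennrpow_const (1 / 2 : ℝ)) (Or.inr ENNReal.ofReal_ne_top)
      simpa using this
    exact tendsto_of_tendsto_of_tendsto_of_le_of_le tendsto_const_nhds hlim
      (fun _ => bot_le) hbd
  have h2 := (h1 (endTime hT)).sub (h1 t)
  have h3 : ∀ j, ∫ ω, c ω * (S j).integral (W k) (endTime hT) ω ∂P
      - ∫ ω, c ω * (S j).integral (W k) t ω ∂P = 0 := by
    intro j
    rw [← integral_sub ((memLp_bdd_mul hcm hK (hA j _)).integrable one_le_two)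
      ((memLp_bdd_mul hcm hK (hA j _)).integrable one_le_two)]
    simp only [← mul_sub]
    exact (S j).integral_mul_integral_sub hT hW k hc hK
  simp only [h3] at h2
  simp only [mul_sub]
  rw [integral_sub ((memLp_bdd_mul hcm hK (hL _)).integrable one_le_two)
      ((memLp_bdd_mul hcm hK (hL _)).integrable one_le_two)]
  exact (tendsto_nhds_unique h2 tendsto_const_nhds)

/-- If the Itô integrals against independent Brownian motions sum up to zero at the terminal
time, then all integrands vanish. -/
theorem integrand_eq_zero [IsProbabilityMeasure P] (hT : 0 < T) (hW : IsBrownianMotion ℱ P W)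
    {H I : Fin m → Time T → Ω → ℝ} (h : ∀ k, IsItoIntegral ℱ P (W k) (H k) (I k))
    (h0 : ∀ᵐ ω ∂P, ∑ k, I k (endTime hT) ω = 0) (k : Fin m) :
    ∀ᵐ p ∂((volume : Measure (Time T)).prod P), H k p.1 p.2 = 0 := by
  have hI := fun k => (h k).stronglyMeasurable (endTime hT)
  have hH := stronglyMeasurable_uncurry_of_progressive hT (h k).1
  choose S hS1 hS2 using fun k => (h k).2.2.2
  have hA := fun j k => ((S k j).memLp_integral hW k (endTime hT)).1
  -- The joint isometry bounds one simple integrand by the squared sum of all simple integrals.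
  -- Since the limits `I l` sum to zero, that sum equals, up to sign, the sum of the approximation
  -- errors; the factor `m` is Cauchy–Schwarz over the components.
  have hb : ∀ j, ∫⁻ ω, (∫⁻ s, ENNReal.ofReal ((S k j).eval s ω ^ 2)) ∂P
      ≤ ENNReal.ofReal m * ∑ l, ∫⁻ ω, ENNReal.ofReal
        ((I l (endTime hT) ω - (S l j).integral (W l) (endTime hT) ω) ^ 2) ∂P := by
    intro j
    refine (Finset.single_le_sum (f := fun k => ∫⁻ ω, (∫⁻ s, ENNReal.ofReal
      ((S k j).eval s ω ^ 2)) ∂P) (fun _ _ => bot_le) (Finset.mem_univ k)).trans ?_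
    rw [← SimpleProcess.lintegral_sum_integral_sq hT hW fun k => S k j]
    have hm : ∀ l ∈ Finset.univ, AEMeasurable (fun ω => ENNReal.ofReal
        ((I l (endTime hT) ω - (S l j).integral (W l) (endTime hT) ω) ^ 2)) P := fun l _ =>
      (((hI l).aestronglyMeasurable.sub (hA j l)).aemeasurable.pow_const 2).ennreal_ofReal
    rw [← lintegral_finsetSum' _ hm]
    rw [← lintegral_const_mul' _ _ ENNReal.ofReal_ne_top]
    refine lintegral_mono_ae ?_
    filter_upwards [h0] with ω hω
    rw [← ENNReal.ofReal_sum_of_nonneg fun _ _ => sq_nonneg _,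
      ← ENNReal.ofReal_mul (Nat.cast_nonneg m)]
    refine ENNReal.ofReal_le_ofReal ?_
    have e : (∑ l, (S l j).integral (W l) (endTime hT) ω) ^ 2
        = (∑ l, (I l (endTime hT) ω - (S l j).integral (W l) (endTime hT) ω)) ^ 2 := by
      rw [Finset.sum_sub_distrib, hω, zero_sub, neg_sq]
    rw [e]
    simpa using sq_sum_le_card_mul_sum_sq (s := Finset.univ)
      (f := fun l => I l (endTime hT) ω - (S l j).integral (W l) (endTime hT) ω)
  have hlim : Tendsto (fun j => ∫⁻ ω, (∫⁻ s, ENNReal.ofReal ((S k j).eval s ω ^ 2)) ∂P)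
      atTop (𝓝 0) := by
    have h1 : Tendsto (fun j => ∑ l, ∫⁻ ω, ENNReal.ofReal
        ((I l (endTime hT) ω - (S l j).integral (W l) (endTime hT) ω) ^ 2) ∂P) atTop
        (𝓝 (∑ l : Fin m, 0)) := tendsto_finsetSum _ fun l _ => hS2 l (endTime hT)
    have h2 := ENNReal.Tendsto.const_mul (a := ENNReal.ofReal m) h1
      (Or.inr ENNReal.ofReal_ne_top)
    rw [Finset.sum_const_zero, mul_zero] at h2
    exact tendsto_of_tendsto_of_tendsto_of_le_of_le tendsto_const_nhds h2 (fun _ => bot_le) hb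
  have hzero : ∫⁻ ω, (∫⁻ s, ENNReal.ofReal (H k s ω ^ 2)) ∂P = 0 := by
    refine eq_zero_of_tendsto_two_mul (hS1 k) hlim fun j => ?_
    exact lintegral_sq_le_two_mul hH.measurable (S k j).measurable_eval
  have hmH : Measurable fun p : Time T × Ω => ENNReal.ofReal (H k p.1 p.2 ^ 2) :=
    (hH.measurable.pow_const 2).ennreal_ofReal
  rw [← lintegral_prod_symm' (fun p : Time T × Ω => ENNReal.ofReal (H k p.1 p.2 ^ 2)) hmH,
    lintegral_eq_zero_iff hmH] at hzero
  filter_upwards [hzero] with p hp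
  have : H k p.1 p.2 ^ 2 ≤ 0 := ENNReal.ofReal_eq_zero.1 hp
  exact pow_eq_zero_iff two_ne_zero |>.1 (le_antisymm this (sq_nonneg _))

/-- The approximating simple integrands tend to 0, hence so do their integrals by the isometry, and
these also tend to `I` in L². -/
theorem endTime_eq_zero [IsProbabilityMeasure P] (hT : 0 < T) (hW : IsBrownianMotion ℱ P W)
    (h : IsItoIntegral ℱ P (W k) (fun _ _ => 0) I) : ∀ᵐ ω ∂P, I (endTime hT) ω = 0 := by
  have hI := h.stronglyMeasurable (endTime hT)
  obtain ⟨-, -, -, S, hS1, hS2⟩ := h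
  have hzero : ∫⁻ ω, ENNReal.ofReal (I (endTime hT) ω ^ 2) ∂P = 0 := by
    refine eq_zero_of_tendsto_two_mul (hS2 (endTime hT)) hS1 fun j => ?_
    simp only [zero_sub, neg_sq]
    rw [← (S j).lintegral_integral_sq hT hW k, ← lintegral_const_mul' _ _ (by simp),
      ← lintegral_const_mul' _ _ (by simp), ← lintegral_add_left']
    · exact lintegral_mono fun ω => ofReal_sq_le_two_mul _ _
    · exact ((hI.aestronglyMeasurable.sub
        ((S j).memLp_integral hW k (endTime hT)).1).aemeasurable.pow_const 2).ennreal_ofReal.const_mul 2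
  rw [lintegral_eq_zero_iff (hI.measurable.pow_const 2).ennreal_ofReal] at hzero
  filter_upwards [hzero] with ω hω
  have : I (endTime hT) ω ^ 2 ≤ 0 := ENNReal.ofReal_eq_zero.1 hω
  exact pow_eq_zero_iff two_ne_zero |>.1 (le_antisymm this (sq_nonneg _))

end IsItoIntegral

/-- The sign of an ℱₜ-measurable variable serves as a bounded ℱₜ-measurable test factor, which
converts martingale identities into L¹ bounds. -/
theorem abs_sign_le_one (x : ℝ) : |(SignType.sign x : ℝ)| ≤ 1 := by
  rcases lt_trichotomy x 0 with h | h | h <;> simp [h]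

theorem stronglyMeasurable_sign {m' : MeasurableSpace Ω} {f : Ω → ℝ}
    (hf : StronglyMeasurable[m'] f) :
    StronglyMeasurable[m'] fun ω => ((SignType.sign (f ω) : SignType) : ℝ) := by
  have h : (fun ω => ((SignType.sign (f ω) : SignType) : ℝ))
      = fun ω => (f ⁻¹' Set.Ioi 0).indicator 1 ω - (f ⁻¹' Set.Iio 0).indicator 1 ω := by
    ext ω
    rcases lt_trichotomy (f ω) 0 with h | h | h
    · simp [h, h.le]
    · simp [h]
    · simp [h, h.le]
  rw [h]
  exact (stronglyMeasurable_one.indicator (hf.measurable measurableSet_Ioi)).sub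
    (stronglyMeasurable_one.indicator (hf.measurable measurableSet_Iio))

/-- Equality at the times of a countable dense set holds on one common event of full measure, and
continuity extends it to all times. -/
theorem ae_forall_eq_of_continuous {β : Type*} [TopologicalSpace β] [T2Space β]
    {u v : Time T → Ω → β}
    (hu : ∀ᵐ ω ∂P, Continuous fun s => u s ω) (hv : ∀ᵐ ω ∂P, Continuous fun s => v s ω)
    (h : ∀ s, ∀ᵐ ω ∂P, u s ω = v s ω) : ∀ᵐ ω ∂P, ∀ s, u s ω = v s ω := by
  obtain ⟨D, hDc, hD⟩ := TopologicalSpace.exists_countable_dense (Time T)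
  have h1 : ∀ᵐ ω ∂P, ∀ s ∈ D, u s ω = v s ω := (ae_ball_iff hDc).2 fun s _ => h s
  filter_upwards [h1, hu, hv] with ω h1 h2 h3 s
  exact congrFun (h2.ext_on hD h3 h1) s

/-- The terminal value vanishes, so the martingale property tested with the sign of `I t` yields
E|I(t)| = 0; path continuity does the rest. -/
theorem IsItoIntegral.eq_zero_of_integrand_eq_zero [IsProbabilityMeasure P] (hT : 0 < T)
    (hW : IsBrownianMotion ℱ P W) {k : Fin m} {I : Time T → Ω → ℝ}
    (h : IsItoIntegral ℱ P (W k) (fun _ _ => 0) I) : ∀ᵐ ω ∂P, ∀ s, I s ω = 0 := by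
  refine ae_forall_eq_of_continuous h.2.2.1 (ae_of_all _ fun ω => continuous_const) fun t => ?_
  have hs := stronglyMeasurable_sign (h.2.1 t)
  have h1 := h.integral_mul_sub hT hW hs fun ω => abs_sign_le_one _
  have h2 : ∫ ω, |I t ω| ∂P = 0 := by
    rw [← neg_eq_zero, ← integral_neg, ← h1]
    refine integral_congr_ae ?_
    filter_upwards [h.endTime_eq_zero hT hW] with ω hω
    rw [hω, zero_sub, mul_neg, sign_mul_self]
  rw [integral_eq_zero_iff_of_nonneg (fun ω => abs_nonneg _)
    ((h.memLp hW t).integrable one_le_two).abs] at h2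
  filter_upwards [h2] with ω hω
  exact abs_eq_zero.1 hω

end TradeExecution

/-! ### Reduced coefficients and existence for the Riccati equation -/

namespace TradeExecution

namespace OWModel

variable {n : ℕ} (M : OWModel n) (m : ℕ)

theorem gammaPow_mul (α β : ℝ) : M.gammaPow α * M.gammaPow β = M.gammaPow (α + β) := by
  have hO : M.O * M.Oᵀ = 1 := by
    have := (Matrix.mem_orthogonalGroup_iff (Fin n) ℝ).1 M.orth
    simpa [Matrix.star_eq_conjTranspose] using this
  have h : Matrix.diagonal (fun j => M.lam j ^ α) * Matrix.diagonal (fun j => M.lam j ^ β)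
      = Matrix.diagonal (fun j => M.lam j ^ (α + β)) := by
    rw [Matrix.diagonal_mul_diagonal]
    congr 1
    ext j
    rw [Real.rpow_add (M.lam_pos j)]
  calc M.gammaPow α * M.gammaPow β
      = M.Oᵀ * (Matrix.diagonal (fun j => M.lam j ^ α) * (M.O * M.Oᵀ)
        * Matrix.diagonal (fun j => M.lam j ^ β)) * M.O := by
        simp only [gammaPow, Matrix.mul_assoc]
    _ = M.gammaPow (α + β) := by rw [hO, Matrix.mul_one, h, gammaPow]

theorem gammaPow_zero : M.gammaPow 0 = 1 := by
  have hO : M.Oᵀ * M.O = 1 := by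
    have := (Matrix.mem_orthogonalGroup_iff' (Fin n) ℝ).1 M.orth
    simpa [Matrix.star_eq_conjTranspose] using this
  simp [gammaPow, hO]

theorem gammaPow_one : M.gammaPow 1 = M.gamma := by
  simp [gammaPow, gamma]

theorem gammaPow_transpose (α : ℝ) : (M.gammaPow α)ᵀ = M.gammaPow α := by
  simp [gammaPow, Matrix.mul_assoc]

theorem gammaPow_half_mul_neg_half : M.gammaPow (1 / 2) * M.gammaPow (-(1 / 2)) = 1 := by
  rw [gammaPow_mul, add_neg_cancel, gammaPow_zero]

theorem gammaPow_neg_half_mul_half : M.gammaPow (-(1 / 2)) * M.gammaPow (1 / 2) = 1 := by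
  rw [gammaPow_mul, neg_add_cancel, gammaPow_zero]

theorem gammaPow_half_mul_half : M.gammaPow (1 / 2) * M.gammaPow (1 / 2) = M.gamma := by
  rw [gammaPow_mul, ← gammaPow_one]; norm_num

theorem gamma_mul_gammaPow_neg_half : M.gamma * M.gammaPow (-(1 / 2)) = M.gammaPow (1 / 2) := by
  rw [← gammaPow_one, gammaPow_mul]; norm_num

theorem gammaPow_neg_half_mul_neg_half :
    M.gammaPow (-(1 / 2)) * M.gammaPow (-(1 / 2)) = M.gammaPow (-1) := by
  rw [gammaPow_mul]; norm_num

theorem scrC_eq_zero (k : Fin m) : M.scrC m k = 0 := by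
  simp [scrC, coeffC]

theorem scrA_eq_zero : M.scrA m = 0 := by
  simp [scrA, coeffA, coeffC]

theorem scrB_eq : M.scrB m = -(M.gammaPow (-(1 / 2)) * M.rho * M.gammaPow (1 / 2)) := by
  simp [scrB, coeffB, coeffC]

theorem scrQ_eq_zero : M.scrQ = 0 := by
  simp [scrQ, coeffQ]

theorem scrR_eq : M.scrR m = M.kappa m := by
  simp [scrR, scrQ_eq_zero]

variable {m}

theorem isUnit_scrR (hκ : (M.kappa m).PosDef) : IsUnit (M.scrR m) := by
  rw [scrR_eq]; exact hκ.isUnit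

/-- ℛ = κ is positive definite, and congruence by ℬ preserves nonnegativity of its inverse. This is
what makes every I + cS with c ≥ 0 positive definite, hence invertible. -/
theorem posSemidef_scrBRB (hκ : (M.kappa m).PosDef) : (M.scrBRB m).PosSemidef := by
  have := hκ.inv.posSemidef.mul_mul_conjTranspose_same (M.scrB m)
  simpa [scrBRB, scrR_eq] using this

theorem scrBRB_transpose (hκ : (M.kappa m).PosDef) : (M.scrBRB m)ᵀ = M.scrBRB m := by
  simpa using (M.posSemidef_scrBRB hκ).isHermitian.eq

theorem isUnit_one_add_smul_scrBRB (hκ : (M.kappa m).PosDef) {c : ℝ} (hc : 0 ≤ c) :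
    IsUnit (1 + c • M.scrBRB m) :=
  (Matrix.PosDef.one.add_posSemidef ((M.posSemidef_scrBRB hκ).smul hc)).isUnit

theorem isUnit_half_mul (hκ : (M.kappa m).PosDef) {T s : ℝ} (hs : s ≤ T) :
    IsUnit (1 + ((1 / 2) * (T - s)) • M.scrBRB m) :=
  M.isUnit_one_add_smul_scrBRB hκ (by linarith)

/-- Every term with 𝒜, 𝒬 or 𝒞 drops out, and with 𝒞 all dependence on `Z`. What remains is a matrix
Riccati ODE perturbed by a martingale. -/
theorem driver_eq (Y : Matrix (Fin n) (Fin n) ℝ) (Z : Fin m → Matrix (Fin n) (Fin n) ℝ) :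
    driver (M.scrA m) (M.scrB m) M.scrQ (M.scrR m) (fun k => M.scrC m k) Y Z
      = -(Y * M.scrBRB m * Y) := by
  simp [driver, scrA_eq_zero, scrQ_eq_zero, scrC_eq_zero, scrBRB, Matrix.mul_assoc]

theorem feedback_eq (Y : Matrix (Fin n) (Fin n) ℝ) (Z : Fin m → Matrix (Fin n) (Fin n) ℝ) :
    feedback (M.scrB m) M.scrQ (M.scrR m) (M.scrC m) Y Z
      = -((M.scrR m)⁻¹ * (M.scrB m)ᵀ * Y) := by
  simp [feedback, scrQ_eq_zero, scrC_eq_zero, Matrix.mul_assoc]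

theorem explicitY_transpose (hκ : (M.kappa m).PosDef) (T s : ℝ) :
    (M.explicitY m T s)ᵀ = M.explicitY m T s := by
  simp [explicitY, Matrix.transpose_nonsing_inv, M.scrBRB_transpose hκ]

theorem explicitY_self (T : ℝ) : M.explicitY m T T = (1 / 2 : ℝ) • 1 := by
  simp [explicitY]

section

open scoped Matrix.Norms.Operator

/-- The inverse of E_s has derivative −E_s⁻¹E_s'E_s⁻¹ with E_s' = −½S. The resulting factor ¼ is the
product of the two factors ½ in YSY. -/
theorem hasDerivAt_explicitY (hκ : (M.kappa m).PosDef) {T s : ℝ} (hs : s ≤ T) :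
    HasDerivAt (fun r => M.explicitY m T r)
      (M.explicitY m T s * M.scrBRB m * M.explicitY m T s) s := by
  obtain ⟨E, hE⟩ := M.isUnit_half_mul hκ hs
  have h1 : HasDerivAt (fun r : ℝ => 1 + ((1 / 2) * (T - r)) • M.scrBRB m)
      ((-(1 / 2) : ℝ) • M.scrBRB m) s := by
    have := (((hasDerivAt_id s).const_sub T).const_mul (1 / 2)).smul_const (M.scrBRB m)
    rw [mul_neg_one] at this
    exact this.const_add 1
  have h2 := hasFDerivAt_ringInverse (𝕜 := ℝ) E
  rw [hE] at h2
  have h3 := (h2.comp_hasDerivAt s h1).const_smul (1 / 2 : ℝ)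
  have h4 : (fun r => M.explicitY m T r)
      = (1 / 2 : ℝ) • (Ring.inverse ∘ fun r : ℝ => 1 + ((1 / 2) * (T - r)) • M.scrBRB m) := by
    ext1 r
    simp [explicitY, Matrix.nonsing_inv_eq_ringInverse]
  rw [h4]
  convert! h3 using 1
  have h5 : ((E⁻¹ : (Matrix (Fin n) (Fin n) ℝ)ˣ) : Matrix (Fin n) (Fin n) ℝ)
      = (1 + ((1 / 2) * (T - s)) • M.scrBRB m)⁻¹ := by
    rw [← hE, Matrix.coe_units_inv]
  simp [explicitY, h5, smul_smul]

theorem hasDerivAt_explicitY_apply (hκ : (M.kappa m).PosDef) {T s : ℝ} (hs : s ≤ T)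
    (i j : Fin n) :
    HasDerivAt (fun r => M.explicitY m T r i j)
      ((M.explicitY m T s * M.scrBRB m * M.explicitY m T s) i j) s :=
  (Matrix.entryLinearMap ℝ ℝ i j).toContinuousLinearMap.hasFDerivAt.comp_hasDerivAt s
    (M.hasDerivAt_explicitY hκ hs)

end

theorem continuous_explicitY (hκ : (M.kappa m).PosDef) (T : ℝ) :
    Continuous fun s : Time T => M.explicitY m T s := by
  refine continuous_matrix fun i j => continuous_iff_continuousAt.2 fun s => ?_
  exact ContinuousAt.comp (f := ((↑) : Time T → ℝ)) (g := fun r => M.explicitY m T r i j)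
    (M.hasDerivAt_explicitY_apply hκ s.2.2 i j).continuousAt continuous_subtype_val.continuousAt

theorem explicitY_eq_add_integral (hκ : (M.kappa m).PosDef) {T : ℝ} (t : Time T)
    (i j : Fin n) :
    M.explicitY m T t i j = M.explicitY m T 0 i j
      + ∫ s : Time T in Set.Iic t, (M.explicitY m T s * M.scrBRB m * M.explicitY m T s) i j := by
  have hsub : Set.uIcc 0 (t : ℝ) ⊆ Set.Icc 0 T := by
    rw [Set.uIcc_of_le t.2.1]; exact Set.Icc_subset_Icc le_rfl t.2.2
  have hc : ContinuousOn (fun s : ℝ => (M.explicitY m T s * M.scrBRB m * M.explicitY m T s) i j)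
      (Set.Icc 0 T) := by
    rw [continuousOn_iff_continuous_domRestrict]
    have h := M.continuous_explicitY hκ T
    exact ((h.matrix_mul continuous_const).matrix_mul h).matrix_elem i j
  rw [setIntegral_Iic_time
    (fun s : ℝ => (M.explicitY m T s * M.scrBRB m * M.explicitY m T s) i j) t,
    intervalIntegral.integral_eq_sub_of_hasDerivAt
      (fun s hs => M.hasDerivAt_explicitY_apply hκ (hsub hs).2 i j)
      ((hc.mono hsub).intervalIntegrable)]
  ring

end OWModel

variable {T : ℝ} {Ω : Type*} {mΩ : MeasurableSpace Ω}
  {ℱ : Filtration (Time T) mΩ} {P : Measure Ω} {n m : ℕ} {W : Fin m → Time T → Ω → ℝ}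

theorem isItoIntegral_zero (hT : 0 < T) (w : Time T → Ω → ℝ) :
    IsItoIntegral ℱ P w (fun _ _ => 0) (fun _ _ => 0) := by
  let S : SimpleProcess ℱ :=
    { N := 0
      t := fun _ => startTime hT
      mono := monotone_const
      c := fun _ _ => 0
      meas := fun _ => stronglyMeasurable_const
      bdd := ⟨0, by simp⟩ }
  refine ⟨isStronglyProgressive_const _ _, fun _ => stronglyMeasurable_const,
    ae_of_all _ fun _ => continuous_const, fun _ => S, ?_, fun r => ?_⟩
  · simp [S, SimpleProcess.eval]
  · simp [S, SimpleProcess.integral]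

theorem integrable_of_continuous_time {E : Type*} [NormedAddCommGroup E]
    {f : Time T → E} (hf : Continuous f) : Integrable f :=
  hf.integrable_of_hasCompactSupport (HasCompactSupport.of_compactSpace _)

theorem exists_bound_of_continuous_matrix {f : Time T → Matrix (Fin n) (Fin n) ℝ}
    (hf : Continuous f) : ∃ K : ℝ, ∀ s i j, |f s i j| ≤ K := by
  have h : ∀ i j, ∃ K : ℝ, ∀ s, |f s i j| ≤ K := fun i j => by
    obtain ⟨K, hK⟩ := isCompact_univ.exists_bound_of_continuousOn
      (hf.matrix_elem i j).continuousOn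
    exact ⟨K, fun s => hK s (Set.mem_univ s)⟩
  choose K hK using h
  refine ⟨∑ i, ∑ j, |K i j|, fun s i j => ((hK i j s).trans (le_abs_self _)).trans ?_⟩
  refine le_trans ?_ (Finset.single_le_sum (f := fun i => ∑ j, |K i j|)
    (fun i _ => Finset.sum_nonneg fun j _ => abs_nonneg _) (Finset.mem_univ i))
  exact Finset.single_le_sum (f := fun j => |K i j|) (fun j _ => abs_nonneg _) (Finset.mem_univ j)

theorem OWModel.isRiccatiSolution_explicitY [IsProbabilityMeasure P] (hT : 0 < T) (M : OWModel n)
    (hκ : (M.kappa m).PosDef) :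
    IsRiccatiSolution hT ℱ P W (fun _ _ => M.scrA m) (fun _ _ => M.scrB m)
      (fun _ _ => M.scrQ) (fun _ _ => M.scrR m) (fun k _ _ => M.scrC m k)
      (fun s _ => M.explicitY m T s) (fun _ _ _ => 0) := by
  have hc := M.continuous_explicitY (m := m) hκ T
  obtain ⟨K, hK⟩ := exists_bound_of_continuous_matrix hc
  constructor
  · exact fun s _ => M.explicitY_transpose hκ T s
  · exact ⟨K, ae_of_all _ fun _ => hK⟩
  · exact fun _ => stronglyMeasurable_const
  · exact ae_of_all _ fun _ => hc
  · exact fun _ _ _ => Matrix.isSymm_zero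
  · exact fun _ => isStronglyProgressive_const _ _
  · intro k
    simp
  · refine ae_of_all _ fun p => ?_
    simpa [M.scrC_eq_zero, M.scrR_eq] using hκ
  · refine ae_of_all _ fun ω i j => ?_
    simp only [M.driver_eq]
    exact integrable_of_continuous_time
      ((((hc.matrix_mul continuous_const).matrix_mul hc).neg).matrix_elem i j)
  · exact ae_of_all _ fun ω => M.explicitY_self T
  · refine ⟨fun _ _ _ => 0, fun k i j => isItoIntegral_zero hT _, ae_of_all _ fun ω s i j => ?_⟩
    simp only [M.driver_eq, Matrix.neg_apply, integral_neg, Matrix.zero_apply,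
      Finset.sum_const_zero, add_zero, sub_neg_eq_add]
    exact M.explicitY_eq_add_integral hκ s i j

end TradeExecution

/-! ### Uniqueness for the Riccati BSDE -/

namespace TradeExecution

section SumAbs

variable {n : ℕ}

/-- The sum of the absolute values of the entries of a matrix. -/
def sumAbs (A : Matrix (Fin n) (Fin n) ℝ) : ℝ := ∑ i, ∑ j, |A i j|

theorem sumAbs_nonneg (A : Matrix (Fin n) (Fin n) ℝ) : 0 ≤ sumAbs A :=
  Finset.sum_nonneg fun _ _ => Finset.sum_nonneg fun _ _ => abs_nonneg _

theorem sum_abs_row_le_sumAbs (A : Matrix (Fin n) (Fin n) ℝ) (i : Fin n) :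
    ∑ j, |A i j| ≤ sumAbs A :=
  Finset.single_le_sum (f := fun i => ∑ j, |A i j|)
    (fun _ _ => Finset.sum_nonneg fun _ _ => abs_nonneg _) (Finset.mem_univ i)

theorem sum_abs_col_le_sumAbs (A : Matrix (Fin n) (Fin n) ℝ) (j : Fin n) :
    ∑ i, |A i j| ≤ sumAbs A := by
  rw [sumAbs, Finset.sum_comm]
  exact Finset.single_le_sum (f := fun j => ∑ i, |A i j|)
    (fun _ _ => Finset.sum_nonneg fun _ _ => abs_nonneg _) (Finset.mem_univ j)

theorem abs_mul_apply_le_sumAbs_mul (A B : Matrix (Fin n) (Fin n) ℝ) {b : ℝ} (i j : Fin n)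
    (hb : ∀ k, |B k j| ≤ b) : |(A * B) i j| ≤ sumAbs A * b := by
  have hb0 : 0 ≤ b := (abs_nonneg _).trans (hb i)
  rw [Matrix.mul_apply]
  calc |∑ k, A i k * B k j| ≤ ∑ k, |A i k * B k j| := Finset.abs_sum_le_sum_abs _ _
    _ ≤ ∑ k, |A i k| * b := Finset.sum_le_sum fun k _ => by
        rw [abs_mul]; exact mul_le_mul_of_nonneg_left (hb k) (abs_nonneg _)
    _ = (∑ k, |A i k|) * b := (Finset.sum_mul _ _ _).symm
    _ ≤ sumAbs A * b := mul_le_mul_of_nonneg_right (sum_abs_row_le_sumAbs A i) hb0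

theorem abs_mul_apply_le_mul_sumAbs (A B : Matrix (Fin n) (Fin n) ℝ) {a : ℝ} (i j : Fin n)
    (ha : ∀ k, |A i k| ≤ a) : |(A * B) i j| ≤ a * sumAbs B := by
  have ha0 : 0 ≤ a := (abs_nonneg _).trans (ha i)
  rw [Matrix.mul_apply]
  calc |∑ k, A i k * B k j| ≤ ∑ k, |A i k * B k j| := Finset.abs_sum_le_sum_abs _ _
    _ ≤ ∑ k, a * |B k j| := Finset.sum_le_sum fun k _ => by
        rw [abs_mul]; exact mul_le_mul_of_nonneg_right (ha k) (abs_nonneg _)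
    _ = a * ∑ k, |B k j| := (Finset.mul_sum _ _ _).symm
    _ ≤ a * sumAbs B := mul_le_mul_of_nonneg_left (sum_abs_col_le_sumAbs B j) ha0

/-- The Lipschitz bound for the quadratic driver on bounded matrices, from YSY − Y'SY' = (Y−Y')SY +
Y'S(Y−Y'). -/
theorem abs_mul_mul_sub_apply_le (S Y Y' : Matrix (Fin n) (Fin n) ℝ) {K : ℝ}
    (hY : ∀ i j, |Y i j| ≤ K) (hY' : ∀ i j, |Y' i j| ≤ K) (i j : Fin n) :
    |(Y * S * Y - Y' * S * Y') i j| ≤ 2 * (sumAbs S * K) * sumAbs (Y - Y') := by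
  have h : Y * S * Y - Y' * S * Y' = (Y - Y') * (S * Y) + (Y' * S) * (Y - Y') := by
    noncomm_ring
  rw [h, Matrix.add_apply]
  have h1 := abs_mul_apply_le_sumAbs_mul (Y - Y') (S * Y) i j
    (fun k => abs_mul_apply_le_sumAbs_mul S Y k j fun l => hY l j)
  have h2 := abs_mul_apply_le_mul_sumAbs (Y' * S) (Y - Y') i j
    (fun k => abs_mul_apply_le_mul_sumAbs Y' S i k fun l => hY' i l)
  refine (abs_add_le _ _).trans ((add_le_add h1 h2).trans (le_of_eq ?_))
  ring

theorem eq_zero_of_sumAbs_eq_zero {A : Matrix (Fin n) (Fin n) ℝ} (h : sumAbs A = 0) : A = 0 := by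
  ext i j
  have h1 := (Finset.single_le_sum (f := fun j => |A i j|) (fun j _ => abs_nonneg _)
    (Finset.mem_univ j)).trans (sum_abs_row_le_sumAbs A i)
  rw [h] at h1
  exact abs_eq_zero.1 (le_antisymm h1 (abs_nonneg _))

theorem sumAbs_le {A : Matrix (Fin n) (Fin n) ℝ} {K : ℝ} (h : ∀ i j, |A i j| ≤ K) :
    sumAbs A ≤ ∑ _i : Fin n, ∑ _j : Fin n, K :=
  Finset.sum_le_sum fun i _ => Finset.sum_le_sum fun j _ => h i j

theorem continuous_sumAbs : Continuous (sumAbs (n := n)) := by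
  unfold sumAbs
  fun_prop

end SumAbs

variable {T : ℝ} {Ω : Type*} {mΩ : MeasurableSpace Ω}
  {ℱ : Filtration (Time T) mΩ} {P : Measure Ω} {n m : ℕ} {W : Fin m → Time T → Ω → ℝ}

theorem setIntegral_Ioi_eq_sub (hT : 0 < T) {f : Time T → ℝ} (hf : Integrable f) (t : Time T) :
    ∫ s in Set.Ioi t, f s =
      (∫ s in Set.Iic (endTime hT), f s) - ∫ s in Set.Iic t, f s := by
  rw [Iic_endTime, setIntegral_univ, ← integral_add_compl (measurableSet_Iic (a := t)) hf,
    Set.compl_Iic]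
  ring

/-- The backward estimate for a process whose martingale part is a sum of Itô integrals. -/
theorem integral_abs_le_of_backward_eq [IsProbabilityMeasure P] (hT : 0 < T)
    (hW : IsBrownianMotion ℱ P W) {H N : Fin m → Time T → Ω → ℝ}
    (hN : ∀ k, IsItoIntegral ℱ P (W k) (H k) (N k)) {t : Time T} {e F G : Ω → ℝ}
    (he : StronglyMeasurable[ℱ t] e) (hei : Integrable e P) (hG : Integrable G P)
    (heq : ∀ᵐ ω ∂P, e ω = F ω - ∑ k, (N k (endTime hT) ω - N k t ω))
    (hFG : ∀ᵐ ω ∂P, |F ω| ≤ G ω) : ∫ ω, |e ω| ∂P ≤ ∫ ω, G ω ∂P := by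
  have hs := stronglyMeasurable_sign he
  have hb : ∀ ω, |(SignType.sign (e ω) : ℝ)| ≤ 1 := fun ω => abs_sign_le_one _
  have hNi : ∀ k, Integrable (fun ω => (SignType.sign (e ω) : ℝ)
      * (N k (endTime hT) ω - N k t ω)) P := fun k =>
    (memLp_bdd_mul (hs.mono (ℱ.le t)).aestronglyMeasurable hb
      (((hN k).memLp hW _).sub ((hN k).memLp hW t))).integrable one_le_two
  have h0 : ∫ ω, ∑ k, (SignType.sign (e ω) : ℝ) * (N k (endTime hT) ω - N k t ω) ∂P = 0 := by
    rw [integral_finsetSum _ fun k _ => hNi k]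
    exact Finset.sum_eq_zero fun k _ => (hN k).integral_mul_sub hT hW hs hb
  have hsum : Integrable (fun ω => ∑ k, (SignType.sign (e ω) : ℝ)
      * (N k (endTime hT) ω - N k t ω)) P := integrable_finsetSum _ fun k _ => hNi k
  -- Adding the martingale increment tested with sign(e) costs nothing in expectation, and it turns
  -- the integrand into sign(e)·F pointwise.
  have h1 : ∫ ω, |e ω| ∂P = ∫ ω, (|e ω| + ∑ k, (SignType.sign (e ω) : ℝ)
      * (N k (endTime hT) ω - N k t ω)) ∂P := by
    rw [integral_add hei.abs hsum, h0, add_zero]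
  rw [h1]
  refine integral_mono_ae (hei.abs.add hsum) hG ?_
  filter_upwards [heq, hFG] with ω h2 h3
  have h4 : |e ω| = (SignType.sign (e ω) : ℝ) * e ω := (sign_mul_self _).symm
  calc |e ω| + ∑ k, (SignType.sign (e ω) : ℝ) * (N k (endTime hT) ω - N k t ω)
      = (SignType.sign (e ω) : ℝ) * (e ω + ∑ k, (N k (endTime hT) ω - N k t ω)) := by
        rw [h4, ← Finset.mul_sum, mul_add]
    _ = (SignType.sign (e ω) : ℝ) * F ω := by rw [h2]; ring_nf
    _ ≤ |(SignType.sign (e ω) : ℝ) * F ω| := le_abs_self _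
    _ ≤ |F ω| := by
        rw [abs_mul]
        exact mul_le_of_le_one_left (abs_nonneg _) (hb ω)
    _ ≤ G ω := h3

namespace OWModel

/-- The expected entrywise distance to the explicit solution satisfies a backward Grönwall
inequality, because both processes have the same terminal value and the driver is Lipschitz on the
bounded set containing them. -/
theorem eq_explicitY_of_isRiccatiSolution [IsProbabilityMeasure P] (hT : 0 < T)
    (hW : IsBrownianMotion ℱ P W) (M : OWModel n) (hκ : (M.kappa m).PosDef)
    {Y : Time T → Ω → Matrix (Fin n) (Fin n) ℝ}
    {Z : Fin m → Time T → Ω → Matrix (Fin n) (Fin n) ℝ}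
    (h : IsRiccatiSolution hT ℱ P W (fun _ _ => M.scrA m) (fun _ _ => M.scrB m)
      (fun _ _ => M.scrQ) (fun _ _ => M.scrR m) (fun k _ _ => M.scrC m k) Y Z) :
    ∀ᵐ ω ∂P, ∀ s : Time T, Y s ω = M.explicitY m T s := by
  have hcE := M.continuous_explicitY hκ T
  refine ae_forall_eq_of_continuous h.continuous_Y (ae_of_all _ fun _ => hcE) ?_
  obtain ⟨K₁, hK₁⟩ := h.bounded_Y
  obtain ⟨K₂, hK₂⟩ := exists_bound_of_continuous_matrix hcE
  obtain ⟨N, hN, heq⟩ := h.equation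
  simp only [M.driver_eq, Matrix.neg_apply, integral_neg, sub_neg_eq_add] at heq
  set K := max K₁ K₂ with hK
  have hEK : ∀ (s : Time T) i j, |M.explicitY m T s i j| ≤ K := fun s i j =>
    (hK₂ s i j).trans (le_max_right _ _)
  have hgood : ∀ᵐ ω ∂P, (Continuous fun s => Y s ω) ∧ ∀ s i j, |Y s ω i j| ≤ K := by
    filter_upwards [h.continuous_Y, hK₁] with ω h1 h2
    exact ⟨h1, fun s i j => (h2 s i j).trans (le_max_left _ _)⟩
  -- Continuity and the bound hold only almost surely. Cutting out a measurable null set makes the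
  -- distance process `g` below continuous and bounded for every ω, hence jointly measurable, so
  -- that Fubini applies.
  obtain ⟨B, hBsub, hBm, hB0⟩ := exists_measurable_superset_of_null (ae_iff.1 hgood)
  have hB : ∀ ω ∉ B, (Continuous fun s => Y s ω) ∧ ∀ s i j, |Y s ω i j| ≤ K := fun ω hω => by
    by_contra hc
    exact hω (hBsub hc)
  have haeB : ∀ᵐ ω ∂P, ω ∉ B := measure_eq_zero_iff_ae_notMem.1 hB0
  have hYm : ∀ s, StronglyMeasurable (Y s) := fun s => (h.adapted_Y s).mono (ℱ.le s)
  let g : Time T → Ω → ℝ := fun s => Bᶜ.indicator fun ω => sumAbs (Y s ω - M.explicitY m T s)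
  have hg0 : ∀ s ω, 0 ≤ g s ω := fun s ω => Set.indicator_nonneg (fun _ _ => sumAbs_nonneg _) ω
  have hgB : ∀ s, ∀ ω ∉ B, g s ω = sumAbs (Y s ω - M.explicitY m T s) := fun s ω hω =>
    Set.indicator_of_mem (Set.mem_compl hω) _
  set K₃ := ∑ _i : Fin n, ∑ _j : Fin n, (K + K) with hK₃
  have hgK : ∀ s ω, g s ω ≤ K₃ := by
    intro s ω
    by_cases hω : ω ∈ B
    · have : g s ω = 0 := Set.indicator_of_notMem (by simpa using hω) _
      rw [this, hK₃]
      exact Finset.sum_nonneg fun i _ => Finset.sum_nonneg fun j _ => by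
        have := (abs_nonneg _).trans (hEK s i j); linarith
    · rw [hgB s ω hω]
      exact sumAbs_le fun i j => (abs_sub _ _).trans (add_le_add ((hB ω hω).2 s i j) (hEK s i j))
  have hgc : ∀ ω, Continuous fun s => g s ω := by
    intro ω
    by_cases hω : ω ∈ B
    · have : (fun s => g s ω) = fun _ => 0 := by
        ext s; exact Set.indicator_of_notMem (by simpa using hω) _
      rw [this]; exact continuous_const
    · have : (fun s => g s ω) = fun s : Time T => sumAbs (Y s ω - M.explicitY m T s) := by
        ext s; exact hgB s ω hω
      rw [this]
      exact continuous_sumAbs.comp ((hB ω hω).1.sub hcE)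
  have hgm : ∀ s, StronglyMeasurable (g s) := fun s =>
    (continuous_sumAbs.comp_stronglyMeasurable ((hYm s).sub stronglyMeasurable_const)).indicator
      hBm.compl
  have hgu : StronglyMeasurable (Function.uncurry g) :=
    stronglyMeasurable_uncurry_of_continuous_of_stronglyMeasurable hgc hgm
  have hnorm : ∀ s ω, ‖g s ω‖ ≤ K₃ := fun s ω => by
    rw [Real.norm_of_nonneg (hg0 s ω)]; exact hgK s ω
  have hgi : ∀ μ : Measure (Time T), IsFiniteMeasure μ → Integrable (Function.uncurry g)
      (μ.prod P) := fun μ _ =>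
    Integrable.of_bound hgu.aestronglyMeasurable K₃ (ae_of_all _ fun p => hnorm p.1 p.2)
  let u : Time T → ℝ := fun s => ∫ ω, g s ω ∂P
  -- The Lipschitz constant from `abs_mul_mul_sub_apply_le` for matrices with entries bounded by
  -- `K`.
  set c : ℝ := 2 * (sumAbs (M.scrBRB m) * K) with hc
  have hentry : ∀ (t : Time T) i j, Integrable (fun ω => Y t ω i j - M.explicitY m T t i j) P ∧
      ∫ ω, |Y t ω i j - M.explicitY m T t i j| ∂P ≤ c * ∫ s in Set.Ioi t, u s := by
    intro t i j
    have hem : StronglyMeasurable[ℱ t] fun ω => Y t ω i j - M.explicitY m T t i j :=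
      ((continuous_id.matrix_elem i j).comp_stronglyMeasurable (h.adapted_Y t)).sub
        stronglyMeasurable_const
    have hei : Integrable (fun ω => Y t ω i j - M.explicitY m T t i j) P := by
      refine Integrable.of_bound (hem.mono (ℱ.le t)).aestronglyMeasurable (K + K) ?_
      filter_upwards [haeB] with ω hω
      exact (abs_sub _ _).trans (add_le_add ((hB ω hω).2 t i j) (hEK t i j))
    refine ⟨hei, ?_⟩
    have hsw := integral_integral_swap (hgi (volume.restrict (Set.Ioi t)) inferInstance)
    have hGi : Integrable (fun ω => c * ∫ s in Set.Ioi t, g s ω) P :=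
      (hgi (volume.restrict (Set.Ioi t)) inferInstance).integral_prod_right.const_mul c
    rw [show (∫ s in Set.Ioi t, u s) = ∫ s in Set.Ioi t, ∫ ω, g s ω ∂P from rfl, hsw,
      ← integral_const_mul]
    -- With equal terminal values, the difference at `t` is minus the driver difference integrated
    -- over (t, T], minus the martingale increment.
    refine integral_abs_le_of_backward_eq hT hW (fun k => hN k i j) hem hei hGi
      (F := fun ω => -∫ s in Set.Ioi t, (Y s ω * M.scrBRB m * Y s ω
        - M.explicitY m T s * M.scrBRB m * M.explicitY m T s) i j) ?_ ?_
    · filter_upwards [haeB, heq, h.terminal] with ω hω hω1 hω2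
      have hcY := (hB ω hω).1
      have i1 : Integrable fun s => (Y s ω * M.scrBRB m * Y s ω) i j :=
        integrable_of_continuous_time
          (((hcY.matrix_mul continuous_const).matrix_mul hcY).matrix_elem i j)
      have i2 : Integrable fun s : Time T =>
          (M.explicitY m T s * M.scrBRB m * M.explicitY m T s) i j :=
        integrable_of_continuous_time
          (((hcE.matrix_mul continuous_const).matrix_mul hcE).matrix_elem i j)
      simp only [Matrix.sub_apply]
      rw [integral_sub i1.integrableOn i2.integrableOn, setIntegral_Ioi_eq_sub hT i1,
        setIntegral_Ioi_eq_sub hT i2]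
      have e1 := hω1 t i j
      have e2 := hω1 (endTime hT) i j
      have e3 := M.explicitY_eq_add_integral hκ t i j
      have e4 := M.explicitY_eq_add_integral hκ (endTime hT) i j
      have e5 : M.explicitY m T (endTime hT) = (1 / 2 : ℝ) • 1 := M.explicitY_self T
      rw [hω2] at e2
      rw [e5] at e4
      rw [Finset.sum_sub_distrib]
      linarith
    · filter_upwards [haeB] with ω hω
      rw [abs_neg]
      have i3 : Integrable fun s => c * g s ω := integrable_of_continuous_time
        (continuous_const.mul (hgc ω))
      rw [← integral_const_mul, ← Real.norm_eq_abs]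
      refine norm_integral_le_of_norm_le i3.integrableOn (ae_of_all _ fun s => ?_)
      rw [Real.norm_eq_abs, hgB s ω hω]
      exact abs_mul_mul_sub_apply_le _ _ _ ((hB ω hω).2 s) (hEK s) i j
  have hu0 : ∀ t, u t = ∑ i, ∑ j, ∫ ω, |Y t ω i j - M.explicitY m T t i j| ∂P := by
    intro t
    have hi := fun i j => (hentry t i j).1.abs
    have : u t = ∫ ω, ∑ i, ∑ j, |Y t ω i j - M.explicitY m T t i j| ∂P := by
      refine integral_congr_ae ?_
      filter_upwards [haeB] with ω hω
      exact hgB t ω hω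
    rw [this, integral_finsetSum _ fun i _ => integrable_finsetSum _ fun j _ => hi i j]
    exact Finset.sum_congr rfl fun i _ => integral_finsetSum _ fun j _ => hi i j
  intro t
  -- Each entry obeys the same bound, so the Grönwall constant for the sum of the entries is `c`
  -- summed over all of them.
  have hc0 : 0 ≤ ∑ _i : Fin n, ∑ _j : Fin n, c :=
    Finset.sum_nonneg fun i _ => Finset.sum_nonneg fun j _ => by
      have h1 := (abs_nonneg _).trans (hEK t i j)
      have h2 := sumAbs_nonneg (M.scrBRB m)
      positivity
  have hut : u t = 0 := by
    refine eq_zero_of_le_mul_setIntegral_Ioi (u := u) hc0 (fun s => integral_nonneg (hg0 s))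
      (K := K₃) (fun s => ?_) ?_ (fun s => ?_) t
    · refine (integral_mono_of_nonneg (ae_of_all _ (hg0 s)) (integrable_const K₃)
        (ae_of_all _ (hgK s))).trans ?_
      simp
    · exact hgu.integral_prod_right.aestronglyMeasurable
    · rw [hu0 s, Finset.sum_mul]
      refine Finset.sum_le_sum fun i _ => ?_
      rw [Finset.sum_mul]
      exact Finset.sum_le_sum fun j _ => (hentry s i j).2
  have hgt : g t =ᵐ[P] 0 := (integral_eq_zero_iff_of_nonneg (hg0 t)
    (Integrable.of_bound (hgm t).aestronglyMeasurable K₃ (ae_of_all _ (hnorm t)))).1 hut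
  filter_upwards [hgt, haeB] with ω h1 h2
  rw [hgB t ω h2] at h1
  exact sub_eq_zero.1 (eq_zero_of_sumAbs_eq_zero h1)

/-- As Y equals the explicit solution, the equation between 0 and T leaves nothing for the
stochastic integrals, whose sum over the components must vanish at T. -/
theorem integrand_eq_zero_of_isRiccatiSolution [IsProbabilityMeasure P] (hT : 0 < T)
    (hW : IsBrownianMotion ℱ P W) (M : OWModel n) (hκ : (M.kappa m).PosDef)
    {Y : Time T → Ω → Matrix (Fin n) (Fin n) ℝ}
    {Z : Fin m → Time T → Ω → Matrix (Fin n) (Fin n) ℝ}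
    (h : IsRiccatiSolution hT ℱ P W (fun _ _ => M.scrA m) (fun _ _ => M.scrB m)
      (fun _ _ => M.scrQ) (fun _ _ => M.scrR m) (fun k _ _ => M.scrC m k) Y Z) (k : Fin m) :
    ∀ᵐ p ∂((volume : Measure (Time T)).prod P), Z k p.1 p.2 = 0 := by
  have hY := M.eq_explicitY_of_isRiccatiSolution hT hW hκ h
  obtain ⟨N, hN, heq⟩ := h.equation
  simp only [M.driver_eq, Matrix.neg_apply, integral_neg, sub_neg_eq_add] at heq
  have h1 : ∀ i j, ∀ᵐ p ∂((volume : Measure (Time T)).prod P), Z k p.1 p.2 i j = 0 := by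
    intro i j
    refine IsItoIntegral.integrand_eq_zero hT hW (fun k => hN k i j) ?_ k
    filter_upwards [hY, heq] with ω h1 h2
    have e1 := h2 (endTime hT) i j
    have e2 := M.explicitY_eq_add_integral hκ (endTime hT) i j
    simp only [h1] at e1
    have e3 : ((startTime hT : Time T) : ℝ) = 0 := rfl
    rw [e3] at e1
    linarith
  have h2 := ae_all_iff.2 fun i => ae_all_iff.2 fun j => h1 i j
  filter_upwards [h2] with p hp
  ext i j
  exact hp i j

end OWModel

end TradeExecution

/-! ### The linear equation of the optimal state -/

namespace TradeExecution

variable {T : ℝ} {Ω : Type*} {mΩ : MeasurableSpace Ω}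
  {ℱ : Filtration (Time T) mΩ} {P : Measure Ω} {n m : ℕ} {W : Fin m → Time T → Ω → ℝ}

theorem norm_mulVec_le_sumAbs_mul (A : Matrix (Fin n) (Fin n) ℝ) (v : Fin n → ℝ) :
    ‖A *ᵥ v‖ ≤ sumAbs A * ‖v‖ := by
  refine (pi_norm_le_iff_of_nonneg (mul_nonneg (sumAbs_nonneg A) (norm_nonneg v))).2 fun i => ?_
  rw [Real.norm_eq_abs, Matrix.mulVec, dotProduct]
  calc |∑ j, A i j * v j| ≤ ∑ j, |A i j * v j| := Finset.abs_sum_le_sum_abs _ _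
    _ ≤ ∑ j, |A i j| * ‖v‖ := Finset.sum_le_sum fun j _ => by
        rw [abs_mul]; exact mul_le_mul_of_nonneg_left (norm_le_pi_norm v j) (abs_nonneg _)
    _ = (∑ j, |A i j|) * ‖v‖ := (Finset.sum_mul _ _ _).symm
    _ ≤ sumAbs A * ‖v‖ :=
        mul_le_mul_of_nonneg_right (sum_abs_row_le_sumAbs A i) (norm_nonneg v)

theorem setIntegral_Iic_const {E : Type*} [NormedAddCommGroup E] [NormedSpace ℝ E]
    [CompleteSpace E] (t : Time T) (v : E) : ∫ _s in Set.Iic t, v = (t : ℝ) • v := by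
  have := setIntegral_Iic_time (fun _ => v) t
  rw [intervalIntegral.integral_const, sub_zero] at this
  exact this

namespace OWModel

variable (M : OWModel n)

theorem scrA_add_scrB_mul_feedback (Y : Matrix (Fin n) (Fin n) ℝ)
    (Z : Fin m → Matrix (Fin n) (Fin n) ℝ) :
    M.scrA m + M.scrB m * feedback (M.scrB m) M.scrQ (M.scrR m) (M.scrC m) Y Z
      = -(M.scrBRB m * Y) := by
  rw [M.feedback_eq, M.scrA_eq_zero, zero_add, Matrix.mul_neg, scrBRB]
  simp only [Matrix.mul_assoc]

/-- The state is E_s E_0⁻¹h₀ and Y(s) = ½E_s⁻¹, so E_s cancels and the drift is constant in time.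
This is why the optimal state is affine. -/
theorem drift_explicitState (hκ : (M.kappa m).PosDef) (x d : Fin n → ℝ) {s : ℝ} (hT : 0 ≤ T)
    (hs : s ≤ T) :
    (-(M.scrBRB m * M.explicitY m T s)) *ᵥ M.explicitState m T x d s
      = -(((1 / 2 : ℝ) • (M.scrBRB m * (1 + ((1 / 2) * T) • M.scrBRB m)⁻¹))
        *ᵥ M.initialState x d) := by
  have hE0 := M.isUnit_half_mul hκ hT
  have hEs := M.isUnit_half_mul hκ hs
  rw [sub_zero] at hE0
  rw [Matrix.isUnit_iff_isUnit_det] at hE0 hEs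
  set S := M.scrBRB m with hS
  set E₀ := 1 + ((1 / 2) * T) • S with hE₀
  have h1 : M.explicitState m T x d s
      = ((1 + ((1 / 2) * (T - s)) • S) * E₀⁻¹) *ᵥ M.initialState x d := by
    have h2 : 1 + ((1 / 2) * (T - s)) • S = E₀ - (s * (1 / 2)) • S := by
      rw [hE₀, add_sub_assoc, ← sub_smul]
      congr 2
      ring
    rw [h2, Matrix.sub_mul, Matrix.mul_nonsing_inv _ hE0, Matrix.sub_mulVec, Matrix.one_mulVec,
      explicitState, Matrix.smul_mul, mul_smul s, Matrix.smul_mulVec s]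
  rw [h1, Matrix.mulVec_mulVec, Matrix.neg_mul, Matrix.neg_mulVec, explicitY, ← hS,
    Matrix.mul_smul, Matrix.smul_mul, Matrix.mul_assoc, ← Matrix.mul_assoc _ _ E₀⁻¹,
    Matrix.nonsing_inv_mul _ hEs, Matrix.one_mul]

theorem continuous_explicitState (x d : Fin n → ℝ) :
    Continuous fun s : Time T => M.explicitState m T x d s := by
  unfold explicitState
  fun_prop

theorem explicitState_eq_add_integral (hκ : (M.kappa m).PosDef) (x d : Fin n → ℝ) (hT : 0 < T)
    (t : Time T) :
    M.explicitState m T x d t = M.initialState x d + ∫ s : Time T in Set.Iic t,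
      (-(M.scrBRB m * M.explicitY m T s)) *ᵥ M.explicitState m T x d s := by
  have h : ∀ s : Time T, (-(M.scrBRB m * M.explicitY m T s)) *ᵥ M.explicitState m T x d s
      = _ := fun s => M.drift_explicitState hκ x d hT.le s.2.2
  simp only [h]
  rw [setIntegral_Iic_const, smul_neg, explicitState, sub_eq_add_neg]

theorem isOptimalStateSolution_explicitState (hT : 0 < T)
    (hκ : (M.kappa m).PosDef) (x d : Fin n → ℝ) :
    IsOptimalStateSolution hT ℱ P W (fun _ _ => M.scrA m) (fun _ _ => M.scrB m)
      (fun s _ => feedback (M.scrB m) M.scrQ (M.scrR m) (M.scrC m) (M.explicitY m T s)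
        (fun _ => 0))
      (fun k _ _ => M.scrC m k) (M.initialState x d) (fun s _ => M.explicitState m T x d s) := by
  have hY := M.continuous_explicitY (m := m) hκ T
  have hH := M.continuous_explicitState (m := m) (T := T) x d
  constructor
  · exact fun _ => stronglyMeasurable_const
  · exact ae_of_all _ fun _ => hH
  · exact ae_of_all _ fun _ => by simp [explicitState, startTime]
  · refine ae_of_all _ fun _ => ?_
    simp only [M.scrA_add_scrB_mul_feedback]
    exact integrable_of_continuous_time
      ((continuous_const.matrix_mul hY).neg.matrix_mulVec hH)
  · refine ⟨fun _ _ _ => 0, fun k i => ?_, ae_of_all _ fun ω t => ?_⟩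
    · simpa [M.scrC_eq_zero] using isItoIntegral_zero hT (W k)
    · simp only [M.scrA_add_scrB_mul_feedback, Finset.sum_const_zero, add_zero]
      exact M.explicitState_eq_add_integral hκ x d hT t

/-- The integrands vanish with 𝒞, hence so do the stochastic integrals, and the remaining linear ODE
has a unique solution on each path. -/
theorem eq_explicitState_of_isOptimalStateSolution [IsProbabilityMeasure P] (hT : 0 < T)
    (hW : IsBrownianMotion ℱ P W) (hκ : (M.kappa m).PosDef) (x d : Fin n → ℝ)
    {H : Time T → Ω → Fin n → ℝ}
    (h : IsOptimalStateSolution hT ℱ P W (fun _ _ => M.scrA m) (fun _ _ => M.scrB m)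
      (fun s _ => feedback (M.scrB m) M.scrQ (M.scrR m) (M.scrC m) (M.explicitY m T s)
        (fun _ => 0))
      (fun k _ _ => M.scrC m k) (M.initialState x d) H) :
    ∀ᵐ ω ∂P, ∀ s : Time T, H s ω = M.explicitState m T x d s := by
  have hY := M.continuous_explicitY (m := m) hκ T
  have hE := M.continuous_explicitState (m := m) (T := T) x d
  obtain ⟨N, hN, heq⟩ := h.equation
  simp only [M.scrA_add_scrB_mul_feedback] at heq
  simp only [M.scrC_eq_zero, Matrix.zero_mul, Matrix.zero_mulVec, Pi.zero_apply] at hN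
  have hN0 : ∀ᵐ ω ∂P, ∀ k i s, N k s ω i = 0 := ae_all_iff.2 fun k => ae_all_iff.2 fun i =>
    (hN k i).eq_zero_of_integrand_eq_zero hT hW
  have hA : Continuous fun s : Time T => -(M.scrBRB m * M.explicitY m T s) :=
    (continuous_const.matrix_mul hY).neg
  obtain ⟨K, hK⟩ := isCompact_univ.exists_bound_of_continuousOn
    (continuous_sumAbs.comp hA).continuousOn
  filter_upwards [heq, hN0, h.continuous] with ω h1 h2 h3 t
  have hF : Continuous fun s : Time T => (-(M.scrBRB m * M.explicitY m T s)) *ᵥ H s ω :=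
    hA.matrix_mulVec h3
  have hG : Continuous fun s : Time T =>
      (-(M.scrBRB m * M.explicitY m T s)) *ᵥ M.explicitState m T x d s := hA.matrix_mulVec hE
  refine sub_eq_zero.1 (eq_zero_of_eq_setIntegral_Iic hT
    (h := fun s : Time T => H s ω - M.explicitState m T x d s) (K := K)
    (F := fun s : Time T => (-(M.scrBRB m * M.explicitY m T s)) *ᵥ H s ω
      - (-(M.scrBRB m * M.explicitY m T s)) *ᵥ M.explicitState m T x d s)
    (hF.sub hG) (fun s => ?_) (fun s => ?_) t)
  · rw [← Matrix.mulVec_sub]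
    refine (norm_mulVec_le_sumAbs_mul _ _).trans
      (mul_le_mul_of_nonneg_right ?_ (norm_nonneg _))
    exact (le_abs_self _).trans (hK s (Set.mem_univ s))
  · rw [integral_sub (integrable_of_continuous_time hF).integrableOn
      (integrable_of_continuous_time hG).integrableOn]
    have e1 := h1 s
    have e2 : ∑ k, N k s ω = 0 := Finset.sum_eq_zero fun k _ => funext fun i => h2 k i s
    rw [e2, add_zero] at e1
    rw [e1, M.explicitState_eq_add_integral hκ x d hT s]
    abel

end OWModel

end TradeExecution

/-! ### The integral equation of the deviation -/

namespace TradeExecution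

variable {T : ℝ} {n : ℕ}

theorem integrable_IccExtend_iff {E : Type*} [NormedAddCommGroup E] (hT : 0 < T) {f : Time T → E} :
    IntervalIntegrable (Set.IccExtend hT.le f) volume 0 T ↔ Integrable f := by
  rw [intervalIntegrable_iff_integrableOn_Icc_of_le hT.le]
  have := (measurePreserving_time_coe T).integrable_comp_emb
      (measurableEmbedding_time_coe T) (g := Set.IccExtend hT.le f)
  rw [IntegrableOn, ← this]
  simp only [Function.comp_def, Set.IccExtend_val]

/-- The product rule for a continuously differentiable function and a primitive. -/
theorem mul_sub_setIntegral_Iic (hT : 0 < T) {a a' : ℝ → ℝ} (ha : ∀ x, HasDerivAt a (a' x) x)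
    (ha' : Continuous a') {f : Time T → ℝ} (hf : Integrable f) (c : ℝ) (r : Time T) :
    a r * (c - ∫ s in Set.Iic r, f s) = a 0 * c
      + ∫ s in Set.Iic r, (a' s * (c - ∫ q in Set.Iic s, f q) - a s * f s) := by
  set F := Set.IccExtend hT.le f with hF
  have hFi : IntervalIntegrable F volume 0 T := (integrable_IccExtend_iff hT).2 hf
  have hconv : ∀ s : Time T, ∫ q in Set.Iic s, f q = ∫ q in (0 : ℝ)..s, F q := fun s => by
    have := setIntegral_Iic_time F s
    simpa only [hF, Set.IccExtend_val] using this
  have hsub : Set.uIcc (0 : ℝ) r ⊆ Set.uIcc 0 T := by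
    rw [Set.uIcc_of_le r.2.1, Set.uIcc_of_le hT.le]
    exact Set.Icc_subset_Icc le_rfl r.2.2
  -- `f` is merely integrable, so its primitive is only absolutely continuous, with derivative `f`
  -- almost everywhere; integration by parts is carried out in that class.
  have hV : AbsolutelyContinuousOnInterval (fun x : ℝ => c - ∫ q in (0 : ℝ)..x, F q) 0 r := by
    have h1 : AbsolutelyContinuousOnInterval (fun _ : ℝ => c) 0 (r : ℝ) :=
      contDiffOn_const.absolutelyContinuousOnInterval
    exact h1.sub ((hFi.absolutelyContinuousOnInterval_intervalIntegral (by simp)).mono hsub)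
  have hda : deriv a = a' := funext fun x => (ha x).deriv
  have hA : AbsolutelyContinuousOnInterval a 0 r := by
    refine ContDiffOn.absolutelyContinuousOnInterval (ContDiff.contDiffOn ?_)
    exact contDiff_one_iff_deriv.2 ⟨fun x => (ha x).differentiableAt, by rw [hda]; exact ha'⟩
  have hibp := hA.integral_deriv_mul_eq_sub hV
  have hder : ∀ᵐ x : ℝ, x ∈ Set.uIoc (0 : ℝ) r →
      deriv (fun x : ℝ => c - ∫ q in (0 : ℝ)..x, F q) x = -F x := by
    filter_upwards [hFi.ae_hasDerivAt_integral] with x hx hxr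
    have := (hx (hsub (Set.uIoc_subset_uIcc hxr)) 0 (by simp)).const_sub c
    exact this.deriv
  have hrhs : ∫ s in Set.Iic r, (a' s * (c - ∫ q in Set.Iic s, f q) - a s * f s)
      = ∫ x in (0 : ℝ)..r, (a' x * (c - ∫ q in (0 : ℝ)..x, F q) - a x * F x) := by
    rw [← setIntegral_Iic_time (fun x => a' x * (c - ∫ q in (0 : ℝ)..x, F q) - a x * F x) r]
    refine integral_congr_ae (ae_of_all _ fun s => ?_)
    simp only [hconv, hF, Set.IccExtend_val]
  have hcongr : ∫ x in (0 : ℝ)..r, (a' x * (c - ∫ q in (0 : ℝ)..x, F q) - a x * F x)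
      = ∫ x in (0 : ℝ)..r, (deriv a x * (c - ∫ q in (0 : ℝ)..x, F q)
        + a x * deriv (fun x : ℝ => c - ∫ q in (0 : ℝ)..x, F q) x) := by
    refine intervalIntegral.integral_congr_ae ?_
    filter_upwards [hder] with x hx hxr
    rw [hx hxr, hda]
    ring
  rw [hrhs, hcongr, hibp, hconv]
  simp

theorem integrable_mulVec {A : Time T → Matrix (Fin n) (Fin n) ℝ} (hA : Continuous A)
    {X : Time T → Fin n → ℝ} (hX : Integrable X) : Integrable fun s => A s *ᵥ X s := by
  obtain ⟨K, hK⟩ := isCompact_univ.exists_bound_of_continuousOn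
    (continuous_sumAbs.comp hA).continuousOn
  have : TopologicalSpace.PseudoMetrizableSpace (Matrix (Fin n) (Fin n) ℝ) :=
    inferInstanceAs (TopologicalSpace.PseudoMetrizableSpace (Fin n → Fin n → ℝ))
  have hc : Continuous fun p : Matrix (Fin n) (Fin n) ℝ × (Fin n → ℝ) => p.1 *ᵥ p.2 :=
    continuous_fst.matrix_mulVec continuous_snd
  refine (hX.norm.const_mul K).mono' (hc.comp_aestronglyMeasurable
    (hA.aestronglyMeasurable.prodMk hX.1)) (ae_of_all _ fun s => ?_)
  refine (norm_mulVec_le_sumAbs_mul _ _).trans (mul_le_mul_of_nonneg_right ?_ (norm_nonneg _))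
  exact (le_abs_self _).trans (hK s (Set.mem_univ s))

theorem mulVec_setIntegral (A : Matrix (Fin n) (Fin n) ℝ) {X : Time T → Fin n → ℝ}
    (hX : Integrable X) (s : Set (Time T)) :
    ∫ r in s, A *ᵥ X r = A *ᵥ ∫ r in s, X r :=
  (Matrix.mulVecLin A).toContinuousLinearMap.integral_comp_comm hX.integrableOn

theorem setIntegral_apply {X : Time T → Fin n → ℝ} (hX : Integrable X) (s : Set (Time T))
    (i : Fin n) : (∫ r in s, X r) i = ∫ r in s, X r i :=
  ((ContinuousLinearMap.proj (R := ℝ) (φ := fun _ : Fin n => ℝ) i).integral_comp_comm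
    hX.integrableOn).symm

namespace OWModel

variable (M : OWModel n)

theorem nu_inv (s : ℝ) : (M.nu s)⁻¹ = NormedSpace.exp ((-s) • M.rho) := by
  rw [nu, neg_smul, Matrix.exp_neg]

theorem nu_inv_mul_nu (s : ℝ) : (M.nu s)⁻¹ * M.nu s = 1 := by
  refine Matrix.nonsing_inv_mul _ ((Matrix.isUnit_iff_isUnit_det _).1 ?_)
  exact Matrix.isUnit_exp _

theorem continuous_nu : Continuous M.nu :=
  continuous_matrix fun i j => continuous_iff_continuousAt.2 fun s =>
    (M.hasDerivAt_nu s i j).continuousAt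

section

open scoped Matrix.Norms.Operator

theorem hasDerivAt_nu_inv (s : ℝ) (i j : Fin n) :
    HasDerivAt (fun r => (M.nu r)⁻¹ i j) (-(M.rho * (M.nu s)⁻¹) i j) s := by
  have h1 : HasDerivAt (fun r : ℝ => NormedSpace.exp (r • M.rho))
      (M.rho * NormedSpace.exp ((-s) • M.rho)) (-s) := hasDerivAt_exp_smul_const' M.rho (-s)
  have h2 := h1.scomp s (hasDerivAt_neg s)
  have h3 : HasDerivAt (fun r => (M.nu r)⁻¹) (-(M.rho * (M.nu s)⁻¹)) s := by
    simp only [nu_inv]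
    rw [neg_one_smul] at h2
    exact h2
  exact (Matrix.entryLinearMap ℝ ℝ i j).toContinuousLinearMap.hasFDerivAt.comp_hasDerivAt s h3

end

theorem continuous_nu_inv : Continuous fun s => (M.nu s)⁻¹ :=
  continuous_matrix fun i j => continuous_iff_continuousAt.2 fun s =>
    (M.hasDerivAt_nu_inv s i j).continuousAt

/-- The continuous part of the deviation of a strategy with path `X`. -/
noncomputable def resiliencePart (v : Fin n → ℝ) (X : Time T → Fin n → ℝ) (r : Time T) :
    Fin n → ℝ :=
  (M.nu r)⁻¹ *ᵥ (v - ∫ s in Set.Iic r, (M.nu s * M.rho * M.gamma) *ᵥ X s)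

theorem continuous_nu_mul : Continuous fun s : Time T => M.nu s * M.rho * M.gamma :=
  ((M.continuous_nu.comp continuous_subtype_val).matrix_mul continuous_const).matrix_mul
    continuous_const

theorem continuous_resiliencePart (hT : 0 < T) (v : Fin n → ℝ) {X : Time T → Fin n → ℝ}
    (hX : Integrable X) : Continuous (M.resiliencePart v X) :=
  (M.continuous_nu_inv.comp continuous_subtype_val).matrix_mulVec
    (continuous_const.sub (continuous_setIntegral_Iic hT
      (integrable_mulVec M.continuous_nu_mul hX)))

/-- Variation of constants: (ν⁻¹)' = −ρν⁻¹ and ν⁻¹·νργX = ργX, so w' = −ρ(γX + w). The product rule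
is applied entry by entry. -/
theorem resiliencePart_eq (hT : 0 < T) (v : Fin n → ℝ) {X : Time T → Fin n → ℝ}
    (hX : Integrable X) (r : Time T) :
    M.resiliencePart v X r = v - ∫ s in Set.Iic r,
      M.rho *ᵥ (M.gamma *ᵥ X s + M.resiliencePart v X s) := by
  have hf := integrable_mulVec M.continuous_nu_mul hX
  have hw := integrable_of_continuous_time (M.continuous_resiliencePart hT v hX)
  have hD : Integrable fun s => M.rho *ᵥ (M.gamma *ᵥ X s + M.resiliencePart v X s) :=
    integrable_mulVec continuous_const ((integrable_mulVec continuous_const hX).add hw)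
  have hV : Continuous fun r : Time T =>
      v - ∫ s in Set.Iic r, (M.nu s * M.rho * M.gamma) *ᵥ X s :=
    continuous_const.sub (continuous_setIntegral_Iic hT hf)
  have hcont' : ∀ i j, Continuous fun s => -(M.rho * (M.nu s)⁻¹) i j := fun i j =>
    (continuous_const.matrix_mul M.continuous_nu_inv).neg.matrix_elem i j
  ext i
  have hfi : ∀ j, Integrable fun s : Time T => ((M.nu s * M.rho * M.gamma) *ᵥ X s) j :=
    fun j => hf.eval j
  have hij := fun j => mul_sub_setIntegral_Iic hT (fun x => M.hasDerivAt_nu_inv x i j)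
    (hcont' i j) (hfi j) (v j) r
  have hint : ∀ j, Integrable fun s : Time T => (-(M.rho * (M.nu s)⁻¹) i j)
      * (v j - ∫ q in Set.Iic s, ((M.nu q * M.rho * M.gamma) *ᵥ X q) j)
      - (M.nu s)⁻¹ i j * ((M.nu s * M.rho * M.gamma) *ᵥ X s) j := by
    intro j
    refine Integrable.sub (integrable_of_continuous_time ?_) ?_
    · exact ((hcont' i j).comp continuous_subtype_val).mul
        (continuous_const.sub (continuous_setIntegral_Iic hT (hfi j)))
    · obtain ⟨K, hK⟩ := exists_bound_of_continuous_matrix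
        (M.continuous_nu_inv.comp (continuous_subtype_val (p := (· ∈ Set.Icc (0 : ℝ) T))))
      exact (hfi j).bdd_mul (c := K) (((M.continuous_nu_inv.comp
        continuous_subtype_val).matrix_elem i j).aestronglyMeasurable)
        (ae_of_all _ fun s => hK s i j)
  have hlhs : M.resiliencePart v X r i = ∑ j, (M.nu r)⁻¹ i j
      * (v j - ∫ s in Set.Iic r, ((M.nu s * M.rho * M.gamma) *ᵥ X s) j) := by
    rw [resiliencePart, Matrix.mulVec, dotProduct]
    simp only [Pi.sub_apply, setIntegral_apply hf]
  rw [hlhs, Finset.sum_congr rfl fun j _ => hij j, Finset.sum_add_distrib,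
    ← integral_finsetSum _ fun j _ => (hint j).integrableOn, Pi.sub_apply,
    setIntegral_apply hD, sub_eq_add_neg, ← integral_neg]
  congr 1
  · have h0 : (M.nu 0)⁻¹ = 1 := by rw [M.nu_zero, inv_one]
    have : ∑ j, (M.nu 0)⁻¹ i j * v j = ((M.nu 0)⁻¹ *ᵥ v) i := rfl
    rw [this, h0, Matrix.one_mulVec]
  · refine integral_congr_ae (ae_of_all _ fun s => ?_)
    have e1 : ∑ j, (-(M.rho * (M.nu s)⁻¹) i j)
        * (v j - ∫ q in Set.Iic s, ((M.nu q * M.rho * M.gamma) *ᵥ X q) j)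
        = -(M.rho *ᵥ M.resiliencePart v X s) i := by
      rw [resiliencePart, Matrix.mulVec_mulVec, Matrix.mulVec, dotProduct,
        ← Finset.sum_neg_distrib]
      simp only [Pi.sub_apply, setIntegral_apply hf, neg_mul]
    have e2 : ∑ j, (M.nu s)⁻¹ i j * ((M.nu s * M.rho * M.gamma) *ᵥ X s) j
        = (M.rho *ᵥ (M.gamma *ᵥ X s)) i := by
      have : ∑ j, (M.nu s)⁻¹ i j * ((M.nu s * M.rho * M.gamma) *ᵥ X s) j
        = ((M.nu s)⁻¹ *ᵥ ((M.nu s * M.rho * M.gamma) *ᵥ X s)) i := rfl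
      rw [this, Matrix.mulVec_mulVec, ← Matrix.mul_assoc, ← Matrix.mul_assoc,
        M.nu_inv_mul_nu, Matrix.one_mul, Matrix.mulVec_mulVec]
    simp only [Finset.sum_sub_distrib]
    rw [e1, e2, Matrix.mulVec_add, Pi.add_apply]
    ring

end OWModel

end TradeExecution

/-! ### The optimal strategy, its deviation and its admissibility -/

namespace TradeExecution

variable {T : ℝ} {Ω : Type*} {mΩ : MeasurableSpace Ω}
  {ℱ : Filtration (Time T) mΩ} {P : Measure Ω} {n m : ℕ}

namespace OWModel

variable (M : OWModel n)

theorem deviation_path_eq (d : Fin n → ℝ) (X : StartedProcess T Ω n) (r : Time T) (ω : Ω) :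
    (M.deviation d X).path r ω = M.gamma *ᵥ X.path r ω
      + M.resiliencePart (d - M.gamma *ᵥ X.pre) (fun s => X.path s ω) r := rfl

theorem integrable_deviation (hT : 0 < T) (d : Fin n → ℝ) (X : StartedProcess T Ω n) {ω : Ω}
    (hX : Integrable fun s => X.path s ω) :
    Integrable fun s => (M.deviation d X).path s ω :=
  (integrable_mulVec continuous_const hX).add
    (integrable_of_continuous_time (M.continuous_resiliencePart hT _ hX))

theorem resiliencePart_eq_sub_integral_deviation (hT : 0 < T) (d : Fin n → ℝ)
    (X : StartedProcess T Ω n) {ω : Ω} (hX : Integrable fun s => X.path s ω) (r : Time T) :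
    M.resiliencePart (d - M.gamma *ᵥ X.pre) (fun s => X.path s ω) r
      = d - M.gamma *ᵥ X.pre - ∫ s in Set.Iic r, M.rho *ᵥ (M.deviation d X).path s ω :=
  M.resiliencePart_eq hT _ hX r

/-- For constant γ the finite-variation equation is a rearrangement of the integral equation for D −
γX; integrable paths suffice. -/
theorem isFVDeviation_deviation (hT : 0 < T) (d : Fin n → ℝ) (X : StartedProcess T Ω n)
    (hX : ∀ᵐ ω ∂P, Integrable fun s => X.path s ω) :
    M.IsFVDeviation P d X (M.deviation d X) := by
  refine ⟨rfl, ?_⟩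
  filter_upwards [hX] with ω hω
  refine ⟨integrable_mulVec continuous_const (M.integrable_deviation hT d X hω), fun r => ?_⟩
  rw [M.deviation_path_eq, M.resiliencePart_eq_sub_integral_deviation hT d X hω,
    Matrix.mulVec_sub]
  abel

theorem gammaPow_half_mulVec_initialState (x d : Fin n → ℝ) :
    M.gammaPow (1 / 2) *ᵥ M.initialState x d = d - M.gamma *ᵥ x := by
  rw [initialState, Matrix.mulVec_sub, Matrix.mulVec_mulVec, Matrix.mulVec_mulVec,
    M.gammaPow_half_mul_neg_half, M.gammaPow_half_mul_half, Matrix.one_mulVec]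

/-- The optimal position on `[0, T)`. -/
noncomputable def optimalPosition (m : ℕ) (T : ℝ) (x d : Fin n → ℝ) (s : ℝ) : Fin n → ℝ :=
  (-(1 / 2 : ℝ)) • ((M.gammaPow (-(1 / 2)) *
      ((M.scrR m)⁻¹ * (M.scrB m)ᵀ * (1 + ((1 / 2) * T) • M.scrBRB m)⁻¹
        + (2 : ℝ) • 1)) *ᵥ M.initialState x d)
  + s • ((1 / 2 : ℝ) • ((M.gammaPow (-(1 / 2)) * M.scrBRB m *
      (1 + ((1 / 2) * T) • M.scrBRB m)⁻¹) *ᵥ M.initialState x d))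

/-- The optimal strategy. -/
noncomputable def optimalStrategy (m : ℕ) (T : ℝ) (Ω : Type*) (x d : Fin n → ℝ) :
    StartedProcess T Ω n where
  pre := x
  path s _ := if (s : ℝ) < T then M.optimalPosition m T x d s else 0

/-- The optimal deviation on `[0, T)`. -/
noncomputable def optimalDeviation (m : ℕ) (T : ℝ) (x d : Fin n → ℝ) : Fin n → ℝ :=
  (-(1 / 2 : ℝ)) • ((M.gammaPow (1 / 2) * (M.scrR m)⁻¹ * (M.scrB m)ᵀ *
    (1 + ((1 / 2) * T) • M.scrBRB m)⁻¹) *ᵥ M.initialState x d)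

theorem gammaPow_half_mul_scrB :
    M.gammaPow (1 / 2) * M.scrB m = -(M.rho * M.gammaPow (1 / 2)) := by
  rw [M.scrB_eq, Matrix.mul_neg, Matrix.mul_assoc, ← Matrix.mul_assoc,
    M.gammaPow_half_mul_neg_half, Matrix.one_mul]

theorem gammaPow_half_mul_scrBRB :
    M.gammaPow (1 / 2) * M.scrBRB m
      = -(M.rho * (M.gammaPow (1 / 2) * (M.scrR m)⁻¹ * (M.scrB m)ᵀ)) := by
  rw [scrBRB, ← Matrix.mul_assoc, ← Matrix.mul_assoc, M.gammaPow_half_mul_scrB]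
  simp only [Matrix.neg_mul, Matrix.mul_assoc]

/-- The intertwining γ^{1/2}ℬ = −ργ^{1/2} identifies ρ times the constant deviation with the rate at
which γ^{1/2}ℋ* decreases. -/
theorem rho_mulVec_optimalDeviation (x d : Fin n → ℝ) :
    M.rho *ᵥ M.optimalDeviation m T x d = M.gammaPow (1 / 2) *ᵥ
      (((1 / 2 : ℝ) • (M.scrBRB m * (1 + ((1 / 2) * T) • M.scrBRB m)⁻¹))
        *ᵥ M.initialState x d) := by
  rw [optimalDeviation, Matrix.mulVec_smul, Matrix.mulVec_mulVec, Matrix.mulVec_mulVec,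
    Matrix.mul_smul, ← Matrix.mul_assoc (M.gammaPow (1 / 2)) (M.scrBRB m),
    M.gammaPow_half_mul_scrBRB, Matrix.smul_mulVec, Matrix.neg_mul, Matrix.neg_mulVec, neg_smul,
    smul_neg]
  simp only [Matrix.mul_assoc]

/-- The slope of the position is chosen to offset that of γ^{1/2}ℋ*, and the summand 2I offsets its
initial value γ^{1/2}h₀; a constant is left. -/
theorem gamma_mulVec_optimalPosition (x d : Fin n → ℝ) (s : ℝ) :
    M.gamma *ᵥ M.optimalPosition m T x d s + M.gammaPow (1 / 2) *ᵥ M.explicitState m T x d s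
      = M.optimalDeviation m T x d := by
  simp only [optimalPosition, explicitState, optimalDeviation, Matrix.mulVec_add,
    Matrix.mulVec_sub, Matrix.mulVec_smul, Matrix.mulVec_mulVec, Matrix.smul_mulVec]
  simp only [← Matrix.mul_assoc, M.gamma_mul_gammaPow_neg_half, Matrix.mul_add, Matrix.add_mulVec,
    Matrix.mul_smul, Matrix.mul_one, Matrix.smul_mulVec]
  module

theorem explicitState_endTime (hκ : (M.kappa m).PosDef) (hT : 0 < T) (x d : Fin n → ℝ) :
    M.explicitState m T x d T = (1 + ((1 / 2) * T) • M.scrBRB m)⁻¹ *ᵥ M.initialState x d := by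
  have hE0 := M.isUnit_half_mul hκ hT.le
  rw [sub_zero, Matrix.isUnit_iff_isUnit_det] at hE0
  have h1 : M.initialState x d = ((1 + ((1 / 2) * T) • M.scrBRB m)
      * (1 + ((1 / 2) * T) • M.scrBRB m)⁻¹) *ᵥ M.initialState x d := by
    rw [Matrix.mul_nonsing_inv _ hE0, Matrix.one_mulVec]
  rw [explicitState]
  nth_rewrite 1 [h1]
  rw [Matrix.add_mul, Matrix.one_mul, Matrix.add_mulVec, Matrix.smul_mul, Matrix.smul_mulVec,
    Matrix.smul_mulVec, smul_smul]
  module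

theorem continuous_optimalPosition (x d : Fin n → ℝ) :
    Continuous (M.optimalPosition m T x d) := by
  unfold optimalPosition
  fun_prop

theorem stronglyMeasurable_optimalPath (x d : Fin n → ℝ) :
    StronglyMeasurable fun s : Time T =>
      if (s : ℝ) < T then M.optimalPosition m T x d s else (0 : Fin n → ℝ) :=
  StronglyMeasurable.ite (measurableSet_lt measurable_subtype_coe measurable_const)
    (((M.continuous_optimalPosition x d).comp continuous_subtype_val).stronglyMeasurable)
    stronglyMeasurable_const

theorem integrable_optimalStrategy (hT : 0 < T) (x d : Fin n → ℝ) (ω : Ω) :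
    Integrable fun s => (M.optimalStrategy m T Ω x d).path s ω := by
  refine (integrable_of_continuous_time
    ((M.continuous_optimalPosition (m := m) (T := T) x d).comp
      continuous_subtype_val)).congr ?_
  filter_upwards [ae_lt_endTime hT] with s hs
  simp [optimalStrategy, hs]

/-- Both sides solve the Volterra equation w = d − γx − ∫ρ(γX* + w): the right-hand side because γX*
+ γ^{1/2}ℋ* is constant before T. Grönwall identifies them. -/
theorem resiliencePart_optimalStrategy (hT : 0 < T) (x d : Fin n → ℝ)
    (ω : Ω) (r : Time T) :
    M.resiliencePart (d - M.gamma *ᵥ x) (fun s => (M.optimalStrategy m T Ω x d).path s ω) r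
      = M.gammaPow (1 / 2) *ᵥ M.explicitState m T x d r := by
  have hX := M.integrable_optimalStrategy (m := m) hT x d ω
  have hw := M.continuous_resiliencePart hT (d - M.gamma *ᵥ x) hX
  have hG : Continuous fun s : Time T => M.gammaPow (1 / 2) *ᵥ M.explicitState m T x d s :=
    continuous_const.matrix_mulVec (M.continuous_explicitState x d)
  have hGX := integrable_mulVec (A := fun _ => M.gamma) continuous_const hX
  have h1 : ∀ t : Time T, M.gammaPow (1 / 2) *ᵥ M.explicitState m T x d t
      = d - M.gamma *ᵥ x - ∫ s : Time T in Set.Iic t, M.rho *ᵥ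
        (M.gamma *ᵥ (M.optimalStrategy m T Ω x d).path s ω
          + M.gammaPow (1 / 2) *ᵥ M.explicitState m T x d s) := by
    intro t
    have h2 : ∀ᵐ s : Time T, M.rho *ᵥ
        (M.gamma *ᵥ (M.optimalStrategy m T Ω x d).path s ω
          + M.gammaPow (1 / 2) *ᵥ M.explicitState m T x d s)
        = M.rho *ᵥ M.optimalDeviation m T x d := by
      filter_upwards [ae_lt_endTime hT] with s hs
      simp only [optimalStrategy, hs, if_true]
      rw [M.gamma_mulVec_optimalPosition]
    rw [integral_congr_ae (ae_restrict_of_ae h2), setIntegral_Iic_const,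
      M.rho_mulVec_optimalDeviation, ← M.gammaPow_half_mulVec_initialState, explicitState,
      Matrix.mulVec_sub, Matrix.mulVec_smul]
  refine sub_eq_zero.1 (eq_zero_of_eq_setIntegral_Iic hT
    (h := fun t => M.resiliencePart (d - M.gamma *ᵥ x)
      (fun s => (M.optimalStrategy m T Ω x d).path s ω) t
      - M.gammaPow (1 / 2) *ᵥ M.explicitState m T x d t)
    (F := fun t => (-M.rho) *ᵥ (M.resiliencePart (d - M.gamma *ᵥ x)
      (fun s => (M.optimalStrategy m T Ω x d).path s ω) t
      - M.gammaPow (1 / 2) *ᵥ M.explicitState m T x d t)) (K := sumAbs (-M.rho))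
    (continuous_const.matrix_mulVec (hw.sub hG)) (fun s => norm_mulVec_le_sumAbs_mul _ _)
    (fun t => ?_) r)
  have i1 : Integrable fun s : Time T => M.rho *ᵥ
      (M.gamma *ᵥ (M.optimalStrategy m T Ω x d).path s ω
        + M.gammaPow (1 / 2) *ᵥ M.explicitState m T x d s) :=
    integrable_mulVec continuous_const (hGX.add (integrable_of_continuous_time hG))
  have i2 : Integrable fun s : Time T => M.rho *ᵥ
      (M.gamma *ᵥ (M.optimalStrategy m T Ω x d).path s ω
        + M.resiliencePart (d - M.gamma *ᵥ x)
          (fun s => (M.optimalStrategy m T Ω x d).path s ω) s) :=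
    integrable_mulVec continuous_const (hGX.add (integrable_of_continuous_time hw))
  rw [M.resiliencePart_eq hT _ hX t, h1 t, sub_sub_sub_cancel_left,
    ← integral_sub i1.integrableOn i2.integrableOn]
  refine integral_congr_ae (ae_of_all _ fun s => ?_)
  beta_reduce
  rw [← Matrix.mulVec_sub, add_sub_add_left_eq_sub, Matrix.neg_mulVec, ← Matrix.mulVec_neg,
    neg_sub]

theorem deviation_optimalStrategy_of_lt (hT : 0 < T) (x d : Fin n → ℝ) (s : Time T) (ω : Ω)
    (hs : (s : ℝ) < T) :
    (M.deviation d (M.optimalStrategy m T Ω x d)).path s ω = M.optimalDeviation m T x d := by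
  have h := M.resiliencePart_optimalStrategy (m := m) hT x d ω s
  rw [M.deviation_path_eq, show (M.optimalStrategy m T Ω x d).pre = x from rfl, h,
    ← M.gamma_mulVec_optimalPosition x d s]
  simp [optimalStrategy, hs]

theorem optimalStrategy_endTime (hT : 0 < T) (x d : Fin n → ℝ) (ω : Ω) :
    (M.optimalStrategy m T Ω x d).path (endTime hT) ω = 0 := by
  simp [optimalStrategy, endTime]

theorem deviation_optimalStrategy_endTime (hκ : (M.kappa m).PosDef) (hT : 0 < T)
    (x d : Fin n → ℝ) (ω : Ω) :
    (M.deviation d (M.optimalStrategy m T Ω x d)).path (endTime hT) ω =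
      (M.gammaPow (1 / 2) * (1 + ((1 / 2) * T) • M.scrBRB m)⁻¹) *ᵥ M.initialState x d := by
  have h := M.resiliencePart_optimalStrategy (m := m) hT x d ω (endTime hT)
  rw [M.deviation_path_eq, show (M.optimalStrategy m T Ω x d).pre = x from rfl, h,
    M.optimalStrategy_endTime, Matrix.mulVec_zero, zero_add,
    show ((endTime hT : Time T) : ℝ) = T from rfl, M.explicitState_endTime hκ hT,
    Matrix.mulVec_mulVec]

theorem sqIntegrableDeviation_optimalStrategy [IsProbabilityMeasure P] (hT : 0 < T)
    (x d : Fin n → ℝ) :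
    M.SqIntegrableDeviation P (M.deviation d (M.optimalStrategy m T Ω x d)) := by
  have h : ∀ ω : Ω, ∫⁻ s, ENNReal.ofReal
      ((M.gammaPow (-(1 / 2)) *ᵥ (M.deviation d (M.optimalStrategy m T Ω x d)).path s ω) ⬝ᵥ
        (M.gammaPow (-(1 / 2)) *ᵥ (M.deviation d (M.optimalStrategy m T Ω x d)).path s ω))
      = ∫⁻ _s : Time T, ENNReal.ofReal
        ((M.gammaPow (-(1 / 2)) *ᵥ M.optimalDeviation m T x d) ⬝ᵥ
          (M.gammaPow (-(1 / 2)) *ᵥ M.optimalDeviation m T x d)) := by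
    intro ω
    refine lintegral_congr_ae ?_
    filter_upwards [ae_lt_endTime hT] with s hs
    rw [M.deviation_optimalStrategy_of_lt hT x d s ω hs]
  rw [SqIntegrableDeviation, lintegral_congr h, lintegral_const, lintegral_const]
  exact ENNReal.mul_lt_top (ENNReal.mul_lt_top ENNReal.ofReal_lt_top (measure_lt_top _ _))
    (measure_lt_top _ _)

theorem memPM_optimalStrategy [IsProbabilityMeasure P] (hT : 0 < T) (x d : Fin n → ℝ) :
    M.MemPM hT ℱ P (fun _ => 0) x d (M.optimalStrategy m T Ω x d) := by
  constructor
  · intro t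
    exact (M.stronglyMeasurable_optimalPath x d).comp_measurable
      (measurable_subtype_coe.comp measurable_fst)
  · rfl
  · exact ae_of_all _ fun ω => M.optimalStrategy_endTime hT x d ω
  · refine ae_of_all _ fun ω => ?_
    have hc : Continuous fun s : Time T =>
        M.optimalPosition m T x d s ⬝ᵥ M.optimalPosition m T x d s :=
      have := (M.continuous_optimalPosition (m := m) (T := T) x d).comp
        (continuous_subtype_val (p := (· ∈ Set.Icc (0 : ℝ) T)))
      this.dotProduct this
    have hlt := (integrable_of_continuous_time hc).lintegral_lt_top
    refine lt_of_eq_of_lt (lintegral_congr_ae ?_) hlt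
    filter_upwards [ae_lt_endTime hT] with s hs
    simp [optimalStrategy, hs]
  · exact M.sqIntegrableDeviation_optimalStrategy hT x d

theorem boundedVariationOn_optimalStrategy (x d : Fin n → ℝ) (ω : Ω) :
    BoundedVariationOn (fun s => (M.optimalStrategy m T Ω x d).path s ω) Set.univ := by
  -- The path is written as a Lipschitz map composed with a monotone function: `g` sends the
  -- terminal time to T + 1, leaving a gap of length one for the jump.
  let g : Time T → ℝ := fun s => if (s : ℝ) < T then (s : ℝ) else T + 1
  obtain ⟨a, b, hab⟩ : ∃ a b : Fin n → ℝ, ∀ s, M.optimalPosition m T x d s = a + s • b :=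
    ⟨_, _, fun s => rfl⟩
  have hg : MonotoneOn g Set.univ := by
    intro s _ t _ hst
    have h1 : (s : ℝ) ≤ t := hst
    have h2 := s.2.2
    simp only [g]
    split_ifs <;> linarith
  have hgb : BoundedVariationOn g Set.univ := by
    refine hg.boundedVariationOn (C := |T| + 1) fun s _ => ?_
    have h1 := s.2.1
    have h2 := s.2.2
    simp only [g]
    rw [abs_of_nonneg (h1.trans h2)]
    split_ifs
    · rw [abs_of_nonneg h1]; linarith
    · rw [abs_of_nonneg (by linarith)]
  -- Affine as the position up to T, then affine from T to T + 1, where it reaches 0.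
  let F : ℝ → Fin n → ℝ := fun y => a + y • b + (max 0 (y - T)) • (-(a + (T + 1) • b))
  have hF : ∃ C, LipschitzWith C F := by
    have h1 : LipschitzWith _ fun y : ℝ => y • b :=
      (ContinuousLinearMap.toSpanSingleton ℝ b).lipschitz
    have h2 : LipschitzWith _ fun y : ℝ => y • (-(a + (T + 1) • b)) :=
      (ContinuousLinearMap.toSpanSingleton ℝ (-(a + (T + 1) • b))).lipschitz
    have h3 : LipschitzWith _ fun y : ℝ => max 0 (y - T) :=
      (LipschitzWith.id.sub (LipschitzWith.const T)).const_max 0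
    exact ⟨_, ((LipschitzWith.const a).add h1).add (h2.comp h3)⟩
  obtain ⟨C, hC⟩ := hF
  convert! hC.comp_boundedVariationOn hgb using 1
  ext1 s
  have h1 := s.2.2
  simp only [optimalStrategy, Function.comp, g, F, hab]
  split_ifs with hs
  · rw [max_eq_left (by linarith), zero_smul, add_zero]
  · rw [add_sub_cancel_left, max_eq_right zero_le_one, one_smul, add_neg_cancel]

theorem memFV_optimalStrategy [IsProbabilityMeasure P] (hT : 0 < T) (x d : Fin n → ℝ) :
    M.MemFV m hT ℱ P (fun _ => 0) x d (M.optimalStrategy m T Ω x d) := by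
  have hc := (M.continuous_optimalPosition (m := m) (T := T) x d).comp
    (continuous_subtype_val (p := (· ∈ Set.Icc (0 : ℝ) T)))
  constructor
  · exact fun _ => stronglyMeasurable_const
  · refine ae_of_all _ fun ω s => ?_
    by_cases hs : (s : ℝ) < T
    · refine (hc.continuousAt.congr ?_).continuousWithinAt
      filter_upwards [(continuous_subtype_val.tendsto s).eventually (gt_mem_nhds hs)] with r hr
      simp [optimalStrategy, hr]
    · have hs' : Set.Ici s = {s} := by
        ext r
        refine ⟨fun h => Subtype.ext (le_antisymm (r.2.2.trans (not_lt.1 hs)) h), fun h => ?_⟩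
        rw [h]
        exact Set.self_mem_Ici
      rw [hs']
      exact continuousWithinAt_singleton
  · refine ae_of_all _ fun ω s => ⟨M.optimalPosition m T x d s, ?_⟩
    refine ((hc.tendsto s).mono_left nhdsWithin_le_nhds).congr' ?_
    filter_upwards [self_mem_nhdsWithin] with r hr
    have : (r : ℝ) < T := lt_of_lt_of_le (show (r : ℝ) < s from hr) s.2.2
    simp [optimalStrategy, this]
  · exact ae_of_all _ fun ω => M.boundedVariationOn_optimalStrategy x d ω
  · rfl
  · exact ae_of_all _ fun ω => M.optimalStrategy_endTime hT x d ω
  · refine ⟨M.deviation d (M.optimalStrategy m T Ω x d), M.isFVDeviation_deviation hT d _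
      (ae_of_all _ fun ω => M.integrable_optimalStrategy hT x d ω),
      fun _ => stronglyMeasurable_const' fun _ _ => rfl, M.sqIntegrableDeviation_optimalStrategy hT x d, ?_⟩
    simp [VolIntegrableDeviation]

end OWModel

end TradeExecution

/-! ### Completing the square, optimality and uniqueness -/

namespace TradeExecution

variable {T : ℝ} {Ω : Type*} {mΩ : MeasurableSpace Ω}
  {ℱ : Filtration (Time T) mΩ} {P : Measure Ω} {n m : ℕ}

theorem integral_const_time {E : Type*} [NormedAddCommGroup E] [NormedSpace ℝ E]
    [CompleteSpace E] (hT : 0 < T) (v : E) : ∫ _s : Time T, v = T • v := by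
  have := setIntegral_Iic_const (endTime hT) v
  rwa [Iic_endTime, setIntegral_univ] at this

/-- Nonnegativity of the integral of the squared distance of `f` to its mean. -/
theorem sq_integral_le (hT : 0 < T) {f : Time T → ℝ} (hf : Integrable f)
    (hf2 : Integrable fun s => f s ^ 2) : (∫ s, f s) ^ 2 ≤ T * ∫ s, f s ^ 2 := by
  set a := (∫ s, f s) / T with ha
  have h1 : 0 ≤ ∫ s, (f s - a) ^ 2 := integral_nonneg fun s => sq_nonneg _
  have h2 : ∀ s, (f s - a) ^ 2 = f s ^ 2 - 2 * a * f s + a ^ 2 := fun s => by ring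
  simp only [h2] at h1
  have hi : Integrable fun s => f s ^ 2 - 2 * a * f s := hf2.sub (hf.const_mul _)
  rw [integral_add hi (integrable_const _),
    integral_sub hf2 (hf.const_mul _), integral_const_mul, integral_const_time hT,
    smul_eq_mul] at h1
  have h3 : ∫ s, f s = T * a := by rw [ha]; field_simp
  rw [h3] at h1 ⊢
  nlinarith [mul_nonneg hT.le h1]

theorem memLp_integral_time [IsFiniteMeasure P] (hT : 0 < T) {f : Time T × Ω → ℝ}
    (hf : MemLp f 2 ((volume : Measure (Time T)).prod P)) :
    MemLp (fun ω => ∫ s, f (s, ω)) 2 P := by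
  have h1 := hf.integrable one_le_two
  have h2 := hf.integrable_sq
  have hm := h1.integral_prod_right.1
  refine (memLp_two_iff_integrable_sq hm).2 ?_
  refine (h2.integral_prod_right.const_mul T).mono' (hm.pow 2) ?_
  filter_upwards [h1.prod_left_ae, h2.prod_left_ae] with ω e1 e2
  rw [Real.norm_of_nonneg (sq_nonneg _)]
  exact sq_integral_le hT e1 e2

theorem integral_dotProduct_const (c : Fin n → ℝ) {u : Time T → Fin n → ℝ} (hu : Integrable u) :
    ∫ s, c ⬝ᵥ u s = c ⬝ᵥ ∫ s, u s := by
  have h := fun i => setIntegral_apply hu Set.univ i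
  simp only [setIntegral_univ] at h
  simp only [dotProduct, h]
  rw [integral_finsetSum _ fun i _ => (hu.eval i).const_mul (c i)]
  exact Finset.sum_congr rfl fun i _ => integral_const_mul _ _

theorem mulVec_integral (A : Matrix (Fin n) (Fin n) ℝ) {X : Time T → Fin n → ℝ}
    (hX : Integrable X) : ∫ r, A *ᵥ X r = A *ᵥ ∫ r, X r := by
  simpa using mulVec_setIntegral A hX Set.univ

theorem dotProduct_mulVec_comm {A : Matrix (Fin n) (Fin n) ℝ} (hA : Aᵀ = A) (v w : Fin n → ℝ) :
    v ⬝ᵥ A *ᵥ w = (A *ᵥ v) ⬝ᵥ w := by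
  rw [Matrix.dotProduct_mulVec, ← Matrix.mulVec_transpose, hA]

/-- Completing the square in the linear-quadratic cost of an open-loop control `u` with terminal
state `h₀ + B ∫ u`. -/
theorem quadratic_cost_eq (hT : 0 < T) {B κ : Matrix (Fin n) (Fin n) ℝ} (hκ : κᵀ = κ)
    {h₀ η v : Fin n → ℝ} (hη : η = h₀ + T • (B *ᵥ v))
    (hv : (2 : ℝ) • (κ *ᵥ v) = -(Bᵀ *ᵥ η))
    {u : Time T → Fin n → ℝ} (hu : Integrable u) (hq : Integrable fun s => u s ⬝ᵥ κ *ᵥ u s) :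
    1 / 2 * ((h₀ + B *ᵥ ∫ s, u s) ⬝ᵥ (h₀ + B *ᵥ ∫ s, u s)) + ∫ s, u s ⬝ᵥ κ *ᵥ u s
      = 1 / 2 * (η ⬝ᵥ η) + T * (v ⬝ᵥ κ *ᵥ v)
        + (1 / 2 * ((B *ᵥ ∫ s, (u s - v)) ⬝ᵥ (B *ᵥ ∫ s, (u s - v)))
          + ∫ s, (u s - v) ⬝ᵥ κ *ᵥ (u s - v)) := by
  -- `η` is the terminal state under the constant control `v`, and `hv` is the first-order condition
  -- 2κv + Bᵀη = 0: it cancels the terms linear in u − v that arise from the terminal and the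
  -- running cost.
  set w := ∫ s, u s with hw
  have hdot : Integrable fun s => ((2 : ℝ) • (κ *ᵥ v)) ⬝ᵥ u s :=
    integrable_finsetSum _ fun i _ => (hu.eval i).const_mul _
  have h1 : ∫ s, (u s - v) = w - T • v := by
    rw [integral_sub hu (integrable_const v), integral_const_time hT]
  have h2 : ∫ s, (u s - v) ⬝ᵥ κ *ᵥ (u s - v)
      = (∫ s, u s ⬝ᵥ κ *ᵥ u s) + (Bᵀ *ᵥ η) ⬝ᵥ w + T * (v ⬝ᵥ κ *ᵥ v) := by
    have : ∀ s, (u s - v) ⬝ᵥ κ *ᵥ (u s - v)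
        = u s ⬝ᵥ κ *ᵥ u s - ((2 : ℝ) • (κ *ᵥ v)) ⬝ᵥ u s + v ⬝ᵥ κ *ᵥ v := by
      intro s
      have e1 : v ⬝ᵥ κ *ᵥ u s = (κ *ᵥ v) ⬝ᵥ u s := dotProduct_mulVec_comm hκ _ _
      have e2 : u s ⬝ᵥ κ *ᵥ v = (κ *ᵥ v) ⬝ᵥ u s := dotProduct_comm _ _
      rw [Matrix.mulVec_sub, sub_dotProduct, dotProduct_sub, dotProduct_sub, e1, e2,
        smul_dotProduct, smul_eq_mul]
      ring
    simp only [this]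
    have hi : Integrable fun s => u s ⬝ᵥ κ *ᵥ u s - ((2 : ℝ) • (κ *ᵥ v)) ⬝ᵥ u s := hq.sub hdot
    rw [integral_add hi (integrable_const _), integral_sub hq hdot,
      integral_const_time hT, integral_dotProduct_const _ hu, hv, neg_dotProduct, smul_eq_mul,
      sub_neg_eq_add]
  have h3 : B *ᵥ (w - T • v) = (h₀ + B *ᵥ w) - η := by
    rw [hη, Matrix.mulVec_sub, Matrix.mulVec_smul]; abel
  have h4 : (Bᵀ *ᵥ η) ⬝ᵥ w = η ⬝ᵥ B *ᵥ w := by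
    rw [Matrix.dotProduct_mulVec, Matrix.mulVec_transpose]
  have h5 : 2 * (v ⬝ᵥ κ *ᵥ v) = -(η ⬝ᵥ B *ᵥ v) := by
    have : v ⬝ᵥ ((2 : ℝ) • (κ *ᵥ v)) = v ⬝ᵥ (-(Bᵀ *ᵥ η)) := by rw [hv]
    rw [dotProduct_smul, smul_eq_mul, dotProduct_neg] at this
    rw [this, dotProduct_comm v, Matrix.dotProduct_mulVec, Matrix.mulVec_transpose]
  have h6 : η ⬝ᵥ η = η ⬝ᵥ h₀ + T * (η ⬝ᵥ B *ᵥ v) := by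
    nth_rewrite 2 [hη]
    rw [dotProduct_add, dotProduct_smul, smul_eq_mul]
  have h7 : (h₀ + B *ᵥ w) ⬝ᵥ η = η ⬝ᵥ h₀ + η ⬝ᵥ B *ᵥ w := by
    rw [dotProduct_comm, dotProduct_add]
  have h8 : η ⬝ᵥ (h₀ + B *ᵥ w) = η ⬝ᵥ h₀ + η ⬝ᵥ B *ᵥ w := dotProduct_add _ _ _
  rw [h1, h2, h3, h4, sub_dotProduct, dotProduct_sub, dotProduct_sub, h7, h8]
  linear_combination -h6 - T * h5

theorem integrable_dotProduct_mulVec_sub {A : Matrix (Fin n) (Fin n) ℝ}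
    {u : Time T → Fin n → ℝ} (hu : Integrable u) (hq : Integrable fun s => u s ⬝ᵥ A *ᵥ u s)
    (v : Fin n → ℝ) : Integrable fun s => (u s - v) ⬝ᵥ A *ᵥ (u s - v) := by
  have h1 : Integrable fun s => u s ⬝ᵥ A *ᵥ v :=
    integrable_finsetSum _ fun i _ => (hu.eval i).mul_const _
  have h2 : Integrable fun s => v ⬝ᵥ A *ᵥ u s :=
    integrable_finsetSum _ fun i _ => ((integrable_mulVec continuous_const hu).eval i).const_mul _
  refine ((hq.sub h1).sub (h2.sub (integrable_const (v ⬝ᵥ A *ᵥ v)))).congr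
    (ae_of_all _ fun s => ?_)
  simp only [Pi.sub_apply, Matrix.mulVec_sub, sub_dotProduct, dotProduct_sub]
  ring

theorem ae_prod_of_ae_ae {α : Type*} [MeasurableSpace α] {μ : Measure α} [SFinite μ] [SFinite P]
    {p : α → Ω → Prop} (hp : MeasurableSet {q : α × Ω | p q.1 q.2})
    (h : ∀ᵐ ω ∂P, ∀ᵐ s ∂μ, p s ω) : ∀ᵐ q ∂(μ.prod P), p q.1 q.2 := by
  rw [Measure.ae_prod_iff_ae_ae hp]
  exact (Measure.ae_ae_comm hp).2 h

theorem integrable_of_lintegral_dotProduct_self {X : Time T → Fin n → ℝ}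
    (hX : StronglyMeasurable X)
    (h : ∫⁻ s, ENNReal.ofReal (X s ⬝ᵥ X s) < ⊤) : Integrable X := by
  have hm : AEStronglyMeasurable (fun s => X s ⬝ᵥ X s) volume := by
    have hc : Continuous fun v : Fin n → ℝ => v ⬝ᵥ v := continuous_id.dotProduct continuous_id
    exact (hc.comp_stronglyMeasurable hX).aestronglyMeasurable
  have h0 : ∀ v : Fin n → ℝ, 0 ≤ v ⬝ᵥ v := fun v =>
    Finset.sum_nonneg fun i _ => mul_self_nonneg _
  have hi : Integrable fun s => X s ⬝ᵥ X s :=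
    (lintegral_ofReal_ne_top_iff_integrable hm (ae_of_all _ fun s => h0 _)).1 h.ne
  refine ((integrable_const (1 : ℝ)).add hi).mono' hX.aestronglyMeasurable
    (ae_of_all _ fun s => ?_)
  refine (pi_norm_le_iff_of_nonneg (add_nonneg zero_le_one (h0 _))).2 fun i => ?_
  have h1 : X s i * X s i ≤ X s ⬝ᵥ X s :=
    Finset.single_le_sum (f := fun i => X s i * X s i) (fun i _ => mul_self_nonneg _)
      (Finset.mem_univ i)
  rw [Real.norm_eq_abs]
  refine le_trans ?_ (add_le_add_right h1 1)
  rcases abs_cases (X s i) with h | h <;> nlinarith [sq_nonneg (X s i - 1), sq_nonneg (X s i + 1)]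

theorem memLp_of_lintegral_dotProduct_self [SFinite P] {u : Time T → Ω → Fin n → ℝ}
    (hu : StronglyMeasurable fun p : Time T × Ω => u p.1 p.2)
    (h : ∫⁻ ω, (∫⁻ s, ENNReal.ofReal (u s ω ⬝ᵥ u s ω)) ∂P < ⊤) (i : Fin n) :
    MemLp (fun p : Time T × Ω => u p.1 p.2 i) 2 ((volume : Measure (Time T)).prod P) := by
  have hc : Continuous fun v : Fin n → ℝ => v ⬝ᵥ v := continuous_id.dotProduct continuous_id
  have hm := (hc.comp_stronglyMeasurable hu).measurable.ennreal_ofReal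
  have hmi : StronglyMeasurable fun p : Time T × Ω => u p.1 p.2 i :=
    (continuous_apply i).comp_stronglyMeasurable hu
  have e := lintegral_prod_symm' (μ := (volume : Measure (Time T))) (ν := P) _ hm
  refine (memLp_two_iff_integrable_sq hmi.aestronglyMeasurable).2 ?_
  refine (lintegral_ofReal_ne_top_iff_integrable (hmi.pow 2).aestronglyMeasurable
    (ae_of_all _ fun p => sq_nonneg _)).1 (ne_of_lt (lt_of_le_of_lt ?_ (e.trans_lt h)))
  refine lintegral_mono fun p => ENNReal.ofReal_le_ofReal ?_
  rw [pow_two]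
  exact Finset.single_le_sum (f := fun i => u p.1 p.2 i * u p.1 p.2 i)
    (fun i _ => mul_self_nonneg _) (Finset.mem_univ i)

theorem stronglyMeasurable_setIntegral_Iic {α E : Type*} [MeasurableSpace α]
    [TopologicalSpace α] [LinearOrder α] [OrderClosedTopology α] [SecondCountableTopology α]
    [OpensMeasurableSpace α] [NormedAddCommGroup E] [NormedSpace ℝ E] (μ : Measure α) [SFinite μ]
    {f : α → Ω → E} (hf : StronglyMeasurable fun p : α × Ω => f p.1 p.2) :
    StronglyMeasurable fun p : α × Ω => ∫ s in Set.Iic p.1, f s p.2 ∂μ := by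
  have h1 : StronglyMeasurable ({q : (α × Ω) × α | q.2 ≤ q.1.1}.indicator
      fun q => f q.2 q.1.2) := by
    refine StronglyMeasurable.indicator ?_
      (measurableSet_le measurable_snd (measurable_fst.comp measurable_fst))
    have hφ : Measurable fun q : (α × Ω) × α => (q.2, q.1.2) := by fun_prop
    exact hf.comp_measurable hφ
  have h2 : (fun p : α × Ω => ∫ s in Set.Iic p.1, f s p.2 ∂μ) = fun p => ∫ s,
      {q : (α × Ω) × α | q.2 ≤ q.1.1}.indicator (fun q => f q.2 q.1.2) (p, s) ∂μ := by
    ext p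
    rw [← integral_indicator measurableSet_Iic]
    rfl
  rw [h2]
  exact h1.integral_prod_right' (ν := μ)

theorem memLp_const_add_sum {ι : Type*} [Fintype ι] [IsFiniteMeasure P] (c : ℝ) (a : ι → ℝ)
    {g : ι → Ω → ℝ} (hg : ∀ j, MemLp (g j) 2 P) :
    MemLp (fun ω => c + ∑ j, a j * g j ω) 2 P := by
  have h : MemLp (fun ω => ∑ j, a j * g j ω) 2 P :=
    memLp_finsetSum _ fun j _ => (hg j).const_mul (a j)
  exact (memLp_const c).add h

namespace OWModel

variable (M : OWModel n)

theorem stronglyMeasurable_deviation (hT : 0 < T) (d : Fin n → ℝ) {X : StartedProcess T Ω n}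
    (hX : IsStronglyProgressive ℱ X.path) :
    StronglyMeasurable fun p : Time T × Ω => (M.deviation d X).path p.1 p.2 := by
  have hXm := stronglyMeasurable_uncurry_of_progressive hT hX
  have : TopologicalSpace.PseudoMetrizableSpace (Matrix (Fin n) (Fin n) ℝ) :=
    inferInstanceAs (TopologicalSpace.PseudoMetrizableSpace (Fin n → Fin n → ℝ))
  have hmul : Continuous fun p : Matrix (Fin n) (Fin n) ℝ × (Fin n → ℝ) => p.1 *ᵥ p.2 :=
    continuous_fst.matrix_mulVec continuous_snd
  have hf : StronglyMeasurable fun p : Time T × Ω =>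
      (M.nu p.1 * M.rho * M.gamma) *ᵥ X.path p.1 p.2 :=
    hmul.comp_stronglyMeasurable
      ((M.continuous_nu_mul.stronglyMeasurable.comp_measurable measurable_fst).prodMk hXm)
  have hI : StronglyMeasurable fun p : Time T × Ω =>
      ∫ s in Set.Iic p.1, (M.nu s * M.rho * M.gamma) *ᵥ X.path s p.2 :=
    stronglyMeasurable_setIntegral_Iic volume
      (f := fun (s : Time T) ω => (M.nu s * M.rho * M.gamma) *ᵥ X.path s ω) hf
  refine StronglyMeasurable.add ?_ ?_
  · exact (continuous_const.matrix_mulVec continuous_id).comp_stronglyMeasurable hXm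
  · exact hmul.comp_stronglyMeasurable
      ((((M.continuous_nu_inv.comp continuous_subtype_val).stronglyMeasurable).comp_measurable
        measurable_fst).prodMk (stronglyMeasurable_const.sub hI))

/-- The rescaled deviation `γ^{-1/2} D`. -/
noncomputable def scaledDeviation (d : Fin n → ℝ) (X : StartedProcess T Ω n) (s : Time T) (ω : Ω) :
    Fin n → ℝ :=
  M.gammaPow (-(1 / 2)) *ᵥ (M.deviation d X).path s ω

theorem deviation_eq_mulVec_scaledDeviation (d : Fin n → ℝ) (X : StartedProcess T Ω n)
    (s : Time T) (ω : Ω) :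
    (M.deviation d X).path s ω = M.gammaPow (1 / 2) *ᵥ M.scaledDeviation d X s ω := by
  rw [scaledDeviation, Matrix.mulVec_mulVec, M.gammaPow_half_mul_neg_half, Matrix.one_mulVec]

theorem stronglyMeasurable_scaledDeviation (hT : 0 < T) (d : Fin n → ℝ)
    {X : StartedProcess T Ω n} (hX : IsStronglyProgressive ℱ X.path) :
    StronglyMeasurable fun p : Time T × Ω => M.scaledDeviation d X p.1 p.2 :=
  (continuous_const.matrix_mulVec continuous_id).comp_stronglyMeasurable
    (M.stronglyMeasurable_deviation hT d hX)

variable {M}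

theorem MemPM.memLp_scaledDeviation [IsProbabilityMeasure P] {hT : 0 < T} {ξ : Ω → Fin n → ℝ}
    {x d : Fin n → ℝ} {X : StartedProcess T Ω n} (h : M.MemPM hT ℱ P ξ x d X) (i : Fin n) :
    MemLp (fun p : Time T × Ω => M.scaledDeviation d X p.1 p.2 i) 2
      ((volume : Measure (Time T)).prod P) :=
  memLp_of_lintegral_dotProduct_self (M.stronglyMeasurable_scaledDeviation hT d h.prog) h.dev i

theorem MemPM.integrable_path {hT : 0 < T} {ξ : Ω → Fin n → ℝ}
    {x d : Fin n → ℝ} {X : StartedProcess T Ω n} (h : M.MemPM hT ℱ P ξ x d X) :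
    ∀ᵐ ω ∂P, Integrable fun s => X.path s ω := by
  filter_upwards [h.sq_integrable] with ω hω
  exact integrable_of_lintegral_dotProduct_self
    ((stronglyMeasurable_uncurry_of_progressive hT h.prog).comp_measurable
      measurable_prodMk_right) hω

theorem MemPM.integrable_scaledDeviation {hT : 0 < T} {ξ : Ω → Fin n → ℝ}
    {x d : Fin n → ℝ} {X : StartedProcess T Ω n} (h : M.MemPM hT ℱ P ξ x d X) :
    ∀ᵐ ω ∂P, Integrable fun s => M.scaledDeviation d X s ω := by
  filter_upwards [h.integrable_path] with ω hω
  exact integrable_mulVec continuous_const (M.integrable_deviation hT d X hω)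

/-- At T the position is zero, so D(T) reduces to the resilience part, which is affine in ∫D. Hence
the terminal cost depends on X only through the time integral of the scaled deviation. -/
theorem MemPM.scaledDeviation_endTime (m : ℕ) {hT : 0 < T} {x d : Fin n → ℝ}
    {X : StartedProcess T Ω n} (h : M.MemPM hT ℱ P (fun _ => 0) x d X) :
    ∀ᵐ ω ∂P, M.scaledDeviation d X (endTime hT) ω
      = M.initialState x d + M.scrB m *ᵥ ∫ s, M.scaledDeviation d X s ω := by
  filter_upwards [h.integrable_path, h.terminal, h.integrable_scaledDeviation] with ω h1 h2 h3
  have e1 := M.resiliencePart_eq_sub_integral_deviation hT d X h1 (endTime hT)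
  rw [Iic_endTime, setIntegral_univ] at e1
  have hD := M.integrable_deviation hT d X h1
  rw [scaledDeviation, M.deviation_path_eq, h2, Matrix.mulVec_zero, zero_add, e1, h.initial,
    mulVec_integral _ hD, ← M.gammaPow_half_mulVec_initialState]
  simp only [M.deviation_eq_mulVec_scaledDeviation d X]
  rw [mulVec_integral _ h3, Matrix.mulVec_sub, Matrix.mulVec_mulVec, Matrix.mulVec_mulVec,
    Matrix.mulVec_mulVec, M.gammaPow_neg_half_mul_half, Matrix.one_mulVec, M.scrB_eq,
    Matrix.neg_mulVec, sub_eq_add_neg, Matrix.mul_assoc]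

variable (M)

/-- The constant value of the rescaled optimal deviation on `[0, T)`. -/
noncomputable def optimalControl (m : ℕ) (T : ℝ) (x d : Fin n → ℝ) : Fin n → ℝ :=
  M.gammaPow (-(1 / 2)) *ᵥ M.optimalDeviation m T x d

theorem optimalControl_eq (x d : Fin n → ℝ) :
    M.optimalControl m T x d = (-(1 / 2 : ℝ)) • (((M.scrR m)⁻¹ * (M.scrB m)ᵀ *
      (1 + ((1 / 2) * T) • M.scrBRB m)⁻¹) *ᵥ M.initialState x d) := by
  rw [optimalControl, optimalDeviation, Matrix.mulVec_smul, Matrix.mulVec_mulVec]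
  simp only [← Matrix.mul_assoc, M.gammaPow_neg_half_mul_half, Matrix.one_mul]

theorem kappa_transpose (hκ : (M.kappa m).PosDef) : (M.kappa m)ᵀ = M.kappa m := by
  simpa using hκ.isHermitian.eq

/-- The first-order condition `hv` of `quadratic_cost_eq`, obtained by cancelling κ against ℛ⁻¹. -/
theorem two_smul_kappa_mulVec_optimalControl (hκ : (M.kappa m).PosDef) (x d : Fin n → ℝ) :
    (2 : ℝ) • (M.kappa m *ᵥ M.optimalControl m T x d)
      = -((M.scrB m)ᵀ *ᵥ ((1 + ((1 / 2) * T) • M.scrBRB m)⁻¹ *ᵥ M.initialState x d)) := by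
  have hu := (Matrix.isUnit_iff_isUnit_det _).1 hκ.isUnit
  rw [optimalControl_eq, M.scrR_eq, Matrix.mulVec_smul, smul_smul, Matrix.mulVec_mulVec,
    Matrix.mulVec_mulVec]
  simp only [← Matrix.mul_assoc, Matrix.mul_nonsing_inv _ hu, Matrix.one_mul]
  norm_num

/-- The hypothesis `hη` of `quadratic_cost_eq`: ℋ*(T) is the state reached under the constant
optimal control. -/
theorem optimalState_endTime_eq (hκ : (M.kappa m).PosDef) (hT : 0 < T) (x d : Fin n → ℝ) :
    (1 + ((1 / 2) * T) • M.scrBRB m)⁻¹ *ᵥ M.initialState x d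
      = M.initialState x d + T • (M.scrB m *ᵥ M.optimalControl m T x d) := by
  rw [← M.explicitState_endTime hκ hT, explicitState, optimalControl_eq, Matrix.mulVec_smul,
    Matrix.mulVec_mulVec, scrBRB, Matrix.smul_mulVec]
  simp only [← Matrix.mul_assoc]
  module

theorem dotProduct_gammaPow_mulVec (A : Matrix (Fin n) (Fin n) ℝ) (v : Fin n → ℝ) :
    v ⬝ᵥ ((M.gammaPow (-(1 / 2)) * A * M.gammaPow (-(1 / 2))) *ᵥ v)
      = (M.gammaPow (-(1 / 2)) *ᵥ v) ⬝ᵥ A *ᵥ (M.gammaPow (-(1 / 2)) *ᵥ v) := by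
  rw [Matrix.mul_assoc, ← Matrix.mulVec_mulVec, dotProduct_mulVec_comm (M.gammaPow_transpose _),
    Matrix.mulVec_mulVec]

/-- The excess of the cost of `X` over the minimal cost, before taking expectations. -/
noncomputable def excess (m : ℕ) (x d : Fin n → ℝ) (X : StartedProcess T Ω n) (ω : Ω) : ℝ :=
  1 / 2 * ((M.scrB m *ᵥ ∫ s, (M.scaledDeviation d X s ω - M.optimalControl m T x d)) ⬝ᵥ
    (M.scrB m *ᵥ ∫ s, (M.scaledDeviation d X s ω - M.optimalControl m T x d)))
  + ∫ s, (M.scaledDeviation d X s ω - M.optimalControl m T x d) ⬝ᵥ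
    M.kappa m *ᵥ (M.scaledDeviation d X s ω - M.optimalControl m T x d)

theorem dotProduct_kappa_nonneg (hκ : (M.kappa m).PosDef) (v : Fin n → ℝ) :
    0 ≤ v ⬝ᵥ M.kappa m *ᵥ v := by
  simpa using hκ.posSemidef.dotProduct_mulVec_nonneg v

theorem excess_nonneg (hκ : (M.kappa m).PosDef) (x d : Fin n → ℝ) (X : StartedProcess T Ω n)
    (ω : Ω) : 0 ≤ M.excess m x d X ω := by
  refine add_nonneg (mul_nonneg (by norm_num) (Finset.sum_nonneg fun i _ => mul_self_nonneg _))
    (integral_nonneg fun s => M.dotProduct_kappa_nonneg hκ _)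

theorem excess_optimalStrategy (hT : 0 < T) (x d : Fin n → ℝ) (ω : Ω) :
    M.excess m x d (M.optimalStrategy m T Ω x d) ω = 0 := by
  have h : ∀ᵐ s : Time T, M.scaledDeviation d (M.optimalStrategy m T Ω x d) s ω
      - M.optimalControl m T x d = 0 := by
    filter_upwards [ae_lt_endTime hT] with s hs
    rw [scaledDeviation, M.deviation_optimalStrategy_of_lt hT x d s ω hs, optimalControl, sub_self]
  have h1 : ∫ s, (M.scaledDeviation d (M.optimalStrategy m T Ω x d) s ω
      - M.optimalControl m T x d) = 0 := integral_eq_zero_of_ae h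
  have h2 : ∫ s, (M.scaledDeviation d (M.optimalStrategy m T Ω x d) s ω
      - M.optimalControl m T x d) ⬝ᵥ M.kappa m *ᵥ
      (M.scaledDeviation d (M.optimalStrategy m T Ω x d) s ω
      - M.optimalControl m T x d) = 0 := by
    refine integral_eq_zero_of_ae ?_
    filter_upwards [h] with s hs
    simp [hs]
  rw [excess, h1, h2]
  simp

variable {M}

theorem MemPM.integrable_dotProduct_mulVec [IsProbabilityMeasure P] {hT : 0 < T}
    {ξ : Ω → Fin n → ℝ} {x d : Fin n → ℝ} {X : StartedProcess T Ω n}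
    (h : M.MemPM hT ℱ P ξ x d X) (A : Matrix (Fin n) (Fin n) ℝ) :
    Integrable (fun p : Time T × Ω => M.scaledDeviation d X p.1 p.2 ⬝ᵥ
      A *ᵥ M.scaledDeviation d X p.1 p.2) ((volume : Measure (Time T)).prod P) := by
  simp only [dotProduct, Matrix.mulVec, Finset.mul_sum]
  refine integrable_finsetSum _ fun i _ => integrable_finsetSum _ fun j _ => ?_
  have := ((h.memLp_scaledDeviation i).integrable_mul (h.memLp_scaledDeviation j)).const_mul (A i j)
  refine this.congr (ae_of_all _ fun p => ?_)
  simp only [Pi.mul_apply]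
  ring

theorem MemPM.integrable_terminal [IsProbabilityMeasure P] (m : ℕ) {hT : 0 < T}
    {x d : Fin n → ℝ} {X : StartedProcess T Ω n}
    (h : M.MemPM hT ℱ P (fun _ => 0) x d X) :
    Integrable (fun ω => (M.initialState x d + M.scrB m *ᵥ ∫ s, M.scaledDeviation d X s ω) ⬝ᵥ
      (M.initialState x d + M.scrB m *ᵥ ∫ s, M.scaledDeviation d X s ω)) P := by
  have h1 : ∀ i, MemLp (fun ω => (M.initialState x d
      + M.scrB m *ᵥ ∫ s, M.scaledDeviation d X s ω) i) 2 P := by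
    intro i
    have h2 := memLp_const_add_sum (M.initialState x d i) (M.scrB m i) fun j =>
      memLp_integral_time hT (h.memLp_scaledDeviation j)
    refine h2.ae_eq ?_
    filter_upwards [h.integrable_scaledDeviation] with ω hω
    have e := fun j => setIntegral_apply hω Set.univ j
    simp only [setIntegral_univ] at e
    simp only [Pi.add_apply, Matrix.mulVec, dotProduct, e]
  exact integrable_finsetSum _ fun i _ => (h1 i).integrable_mul (h1 i)

theorem MemPM.pathwise_cost_eq [IsProbabilityMeasure P] {hT : 0 < T} (hκ : (M.kappa m).PosDef)
    {x d : Fin n → ℝ} {X : StartedProcess T Ω n} (h : M.MemPM hT ℱ P (fun _ => 0) x d X) :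
    ∀ᵐ ω ∂P, 1 / 2 * ((M.initialState x d + M.scrB m *ᵥ ∫ s, M.scaledDeviation d X s ω) ⬝ᵥ
        (M.initialState x d + M.scrB m *ᵥ ∫ s, M.scaledDeviation d X s ω))
      + ∫ s, M.scaledDeviation d X s ω ⬝ᵥ M.kappa m *ᵥ M.scaledDeviation d X s ω
      = 1 / 2 * (((1 + ((1 / 2) * T) • M.scrBRB m)⁻¹ *ᵥ M.initialState x d) ⬝ᵥ
          ((1 + ((1 / 2) * T) • M.scrBRB m)⁻¹ *ᵥ M.initialState x d))
        + T * (M.optimalControl m T x d ⬝ᵥ M.kappa m *ᵥ M.optimalControl m T x d)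
        + M.excess m x d X ω := by
  filter_upwards [h.integrable_scaledDeviation,
    (h.integrable_dotProduct_mulVec (M.kappa m)).prod_left_ae] with ω h1 h2
  exact quadratic_cost_eq hT (M.kappa_transpose hκ) (M.optimalState_endTime_eq hκ hT x d)
    (M.two_smul_kappa_mulVec_optimalControl hκ x d) h1 h2

/-- By the pathwise identity the excess is an integrable cost minus a constant. -/
theorem MemPM.integrable_excess [IsProbabilityMeasure P] {hT : 0 < T} (hκ : (M.kappa m).PosDef)
    {x d : Fin n → ℝ} {X : StartedProcess T Ω n} (h : M.MemPM hT ℱ P (fun _ => 0) x d X) :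
    Integrable (M.excess m x d X) P := by
  have h1 := ((h.integrable_terminal m).const_mul (1 / 2)).add
    (h.integrable_dotProduct_mulVec (M.kappa m)).integral_prod_right
  refine (h1.sub (integrable_const (1 / 2 * (((1 + ((1 / 2) * T) • M.scrBRB m)⁻¹ *ᵥ
      M.initialState x d) ⬝ᵥ ((1 + ((1 / 2) * T) • M.scrBRB m)⁻¹ *ᵥ M.initialState x d))
    + T * (M.optimalControl m T x d ⬝ᵥ M.kappa m *ᵥ M.optimalControl m T x d)))).congr ?_
  filter_upwards [h.pathwise_cost_eq hκ] with ω hω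
  simp only [Pi.sub_apply, Pi.add_apply]
  rw [hω]
  ring

/-- The minimal cost. -/
noncomputable def minimalCost (M : OWModel n) (m : ℕ) (T : ℝ) (x d : Fin n → ℝ) : ℝ :=
  1 / 2 * (((1 + ((1 / 2) * T) • M.scrBRB m)⁻¹ *ᵥ M.initialState x d) ⬝ᵥ
      ((1 + ((1 / 2) * T) • M.scrBRB m)⁻¹ *ᵥ M.initialState x d))
    + T * (M.optimalControl m T x d ⬝ᵥ M.kappa m *ᵥ M.optimalControl m T x d)
    - (1 / 2) * (d ⬝ᵥ (M.gammaPow (-1) *ᵥ d))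

/-- The conditional expectation of the pathwise identity. The risk term contributes the conditional
expectation of 0. -/
theorem MemPM.costPM_ae_eq [IsProbabilityMeasure P] {hT : 0 < T} (hκ : (M.kappa m).PosDef)
    {x d : Fin n → ℝ} {X : StartedProcess T Ω n} (h : M.MemPM hT ℱ P (fun _ => 0) x d X) :
    M.costPM m hT ℱ P d X =ᵐ[P] fun ω =>
      M.minimalCost m T x d + (P[M.excess m x d X | ℱ (startTime hT)]) ω := by
  set F : Ω → ℝ := fun ω => (M.deviation d X).path (endTime hT) ω ⬝ᵥ
      (M.gammaPow (-1) *ᵥ (M.deviation d X).path (endTime hT) ω) with hF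
  set G : Ω → ℝ := fun ω => ∫ s, (M.deviation d X).path s ω ⬝ᵥ
      ((M.gammaPow (-(1 / 2)) * M.kappa m * M.gammaPow (-(1 / 2))) *ᵥ
        (M.deviation d X).path s ω) with hG
  set c := 1 / 2 * (((1 + ((1 / 2) * T) • M.scrBRB m)⁻¹ *ᵥ M.initialState x d) ⬝ᵥ
      ((1 + ((1 / 2) * T) • M.scrBRB m)⁻¹ *ᵥ M.initialState x d))
    + T * (M.optimalControl m T x d ⬝ᵥ M.kappa m *ᵥ M.optimalControl m T x d) with hc
  have hF' : F =ᵐ[P] fun ω =>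
      (M.initialState x d + M.scrB m *ᵥ ∫ s, M.scaledDeviation d X s ω) ⬝ᵥ
      (M.initialState x d + M.scrB m *ᵥ ∫ s, M.scaledDeviation d X s ω) := by
    filter_upwards [h.scaledDeviation_endTime m] with ω hω
    have e := M.dotProduct_gammaPow_mulVec 1 ((M.deviation d X).path (endTime hT) ω)
    rw [Matrix.mul_one, Matrix.one_mulVec, M.gammaPow_neg_half_mul_neg_half] at e
    rw [hF]
    beta_reduce
    rw [e, ← hω, scaledDeviation]
  have hG' : G = fun ω => ∫ s, M.scaledDeviation d X s ω ⬝ᵥ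
      M.kappa m *ᵥ M.scaledDeviation d X s ω := by
    ext ω
    refine integral_congr_ae (ae_of_all _ fun s => ?_)
    exact M.dotProduct_gammaPow_mulVec _ _
  have hFi : Integrable F P := (h.integrable_terminal m).congr hF'.symm
  have hGi : Integrable G P := by
    rw [hG']; exact (h.integrable_dotProduct_mulVec (M.kappa m)).integral_prod_right
  have hsum : (1 / 2 : ℝ) • F + G =ᵐ[P] (fun _ => c) + M.excess m x d X := by
    filter_upwards [hF', h.pathwise_cost_eq hκ] with ω h1 h2
    simp only [Pi.add_apply, Pi.smul_apply, smul_eq_mul]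
    rw [h1, hG', h2]
  have k1 := condExp_congr_ae (m := ℱ (startTime hT)) hsum
  have k2 := condExp_add (hFi.smul (1 / 2 : ℝ)) hGi (ℱ (startTime hT))
  have k3 := condExp_smul (μ := P) (1 / 2 : ℝ) F (ℱ (startTime hT))
  have k4 := condExp_add (μ := P) (integrable_const c) (h.integrable_excess hκ) (ℱ (startTime hT))
  have k5 : P[fun _ : Ω => c | ℱ (startTime hT)] = fun _ => c := condExp_const (ℱ.le _) c
  have k6 : P[fun _ : Ω => (0 : ℝ) | ℱ (startTime hT)] = fun _ => 0 := condExp_const (ℱ.le _) 0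
  filter_upwards [k1, k2, k3, k4] with ω e1 e2 e3 e4
  rw [e1] at e2
  rw [e4] at e2
  simp only [Pi.add_apply, k5, e3, Pi.smul_apply, smul_eq_mul] at e2
  simp only [costPM, costPMGeneral, Matrix.zero_mulVec, dotProduct_zero, integral_zero, k6,
    minimalCost]
  rw [← hF, ← hG, ← hc]
  linarith

/-- The excess of the candidate is zero, that of any competitor is nonnegative, and conditional
expectation preserves this. -/
theorem isOptimal_optimalStrategy [IsProbabilityMeasure P] (hT : 0 < T)
    (hκ : (M.kappa m).PosDef) (x d : Fin n → ℝ) :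
    M.IsOptimal m hT ℱ P x d (M.optimalStrategy m T Ω x d) := by
  have h0 := M.memPM_optimalStrategy (m := m) (ℱ := ℱ) (P := P) hT x d
  refine ⟨h0, fun X hX => ?_⟩
  have e0 : M.excess m x d (M.optimalStrategy m T Ω x d) = 0 :=
    funext fun ω => M.excess_optimalStrategy hT x d ω
  have h1 := h0.costPM_ae_eq hκ
  rw [e0, condExp_zero] at h1
  have h2 : 0 ≤ᵐ[P] P[M.excess m x d X | ℱ (startTime hT)] :=
    condExp_nonneg (ae_of_all _ fun ω => M.excess_nonneg hκ x d X ω)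
  filter_upwards [h1, hX.costPM_ae_eq hκ, h2] with ω e1 e2 e3
  rw [e1, e2]
  simpa using e3

/-- Both summands of the excess are nonnegative, so the κ-integral vanishes, and definiteness of κ
forces equality at almost every time. -/
theorem ae_eq_of_excess_eq_zero (hκ : (M.kappa m).PosDef) {x d : Fin n → ℝ}
    {X : StartedProcess T Ω n} {ω : Ω} (h1 : Integrable fun s => M.scaledDeviation d X s ω)
    (h2 : Integrable fun s => M.scaledDeviation d X s ω ⬝ᵥ
      M.kappa m *ᵥ M.scaledDeviation d X s ω) (h : M.excess m x d X ω = 0) :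
    ∀ᵐ s : Time T, M.scaledDeviation d X s ω = M.optimalControl m T x d := by
  have hi := integrable_dotProduct_mulVec_sub h1 h2 (M.optimalControl m T x d)
  have h3 : ∫ s, (M.scaledDeviation d X s ω - M.optimalControl m T x d) ⬝ᵥ
      M.kappa m *ᵥ (M.scaledDeviation d X s ω - M.optimalControl m T x d) = 0 := by
    refine le_antisymm ?_ (integral_nonneg fun s => M.dotProduct_kappa_nonneg hκ _)
    rw [← h, excess]
    exact le_add_of_nonneg_left
      (mul_nonneg (by norm_num) (Finset.sum_nonneg fun i _ => mul_self_nonneg _))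
  have h4 := (integral_eq_zero_iff_of_nonneg (fun s => M.dotProduct_kappa_nonneg hκ _) hi).1 h3
  filter_upwards [h4] with s hs
  by_contra hne
  have hpos := hκ.dotProduct_mulVec_pos (sub_ne_zero.2 hne)
  rw [star_trivial] at hpos
  exact hpos.ne' hs

/-- Comparing an optimal X with the candidate shows that its conditional expected excess is
nonpositive. The nonnegative excess therefore vanishes almost surely, which fixes the deviation and
then the position. -/
theorem eq_optimalStrategy_of_isOptimal [IsProbabilityMeasure P] (hT : 0 < T)
    (hκ : (M.kappa m).PosDef) {x d : Fin n → ℝ} {X : StartedProcess T Ω n}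
    (hX : M.IsOptimal m hT ℱ P x d X) :
    ∀ᵐ p ∂((volume : Measure (Time T)).prod P),
      X.path p.1 p.2 = (M.optimalStrategy m T Ω x d).path p.1 p.2 := by
  have h0 := M.memPM_optimalStrategy (m := m) (ℱ := ℱ) (P := P) hT x d
  have e0 : M.excess m x d (M.optimalStrategy m T Ω x d) = 0 :=
    funext fun ω => M.excess_optimalStrategy hT x d ω
  have h1 := h0.costPM_ae_eq hκ
  rw [e0, condExp_zero] at h1
  have hint := hX.1.integrable_excess hκ
  have h2 : P[M.excess m x d X | ℱ (startTime hT)] ≤ᵐ[P] 0 := by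
    filter_upwards [h1, hX.1.costPM_ae_eq hκ, hX.2 _ h0] with ω e1 e2 e3
    rw [e1, e2] at e3
    simpa using e3
  have h3 : ∫ ω, M.excess m x d X ω ∂P = 0 := by
    refine le_antisymm ?_ (integral_nonneg (M.excess_nonneg hκ x d X))
    rw [← integral_condExp (ℱ.le (startTime hT))]
    exact integral_nonpos_of_ae h2
  have h4 := (integral_eq_zero_iff_of_nonneg (M.excess_nonneg hκ x d X) hint).1 h3
  have hXm := stronglyMeasurable_uncurry_of_progressive hT hX.1.prog
  have hYm := stronglyMeasurable_uncurry_of_progressive hT h0.prog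
  have hset : MeasurableSet {p : Time T × Ω |
      X.path p.1 p.2 = (M.optimalStrategy m T Ω x d).path p.1 p.2} :=
    measurableSet_eq_fun hXm.measurable hYm.measurable
  have hswap : ∀ᵐ ω ∂P, ∀ᵐ s : Time T,
      X.path s ω = (M.optimalStrategy m T Ω x d).path s ω := by
    filter_upwards [h4, hX.1.integrable_path, hX.1.integrable_scaledDeviation,
      (hX.1.integrable_dotProduct_mulVec (M.kappa m)).prod_left_ae] with ω e1 e2 e3 e4
    have hv : ∀ᵐ s : Time T, M.scaledDeviation d X s ω = M.optimalControl m T x d :=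
      ae_eq_of_excess_eq_zero hκ e3 e4 e1
    have hD : ∀ᵐ s : Time T, (M.deviation d X).path s ω
        = (M.deviation d (M.optimalStrategy m T Ω x d)).path s ω := by
      filter_upwards [hv, ae_lt_endTime hT] with s h5 h6
      rw [M.deviation_optimalStrategy_of_lt hT x d s ω h6, M.deviation_eq_mulVec_scaledDeviation,
        h5, optimalControl, Matrix.mulVec_mulVec, M.gammaPow_half_mul_neg_half, Matrix.one_mulVec]
    -- D − γX depends on the path only through ∫ρD, so deviations agreeing at almost every time give
    -- resilience parts agreeing at all times. Then γX, and with it X, agrees almost everywhere.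
    have hr : ∀ r, M.resiliencePart (d - M.gamma *ᵥ X.pre) (fun s => X.path s ω) r
        = M.resiliencePart (d - M.gamma *ᵥ (M.optimalStrategy m T Ω x d).pre)
          (fun s => (M.optimalStrategy m T Ω x d).path s ω) r := by
      intro r
      rw [M.resiliencePart_eq_sub_integral_deviation hT d X e2,
        M.resiliencePart_eq_sub_integral_deviation hT d _
          (M.integrable_optimalStrategy hT x d ω), hX.1.initial, h0.initial]
      congr 1
      refine integral_congr_ae (ae_restrict_of_ae ?_)
      filter_upwards [hD] with s hs
      rw [hs]
    filter_upwards [hD] with s hs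
    rw [M.deviation_path_eq, M.deviation_path_eq, hr s] at hs
    have h5 := congrArg (M.gammaPow (-1) *ᵥ ·) (add_right_cancel hs)
    simpa only [Matrix.mulVec_mulVec, ← M.gammaPow_one, M.gammaPow_mul, neg_add_cancel,
      M.gammaPow_zero, Matrix.one_mulVec] using h5
  exact ae_prod_of_ae_ae hset hswap

end OWModel

end TradeExecution

theorem mainTheorem10 {n m : ℕ} {T : ℝ} (hT : 0 < T)
    {Ω : Type*} {mΩ : MeasurableSpace Ω} (P : Measure Ω) [IsProbabilityMeasure P]
    (ℱ : Filtration (Time T) mΩ) (W : Fin m → Time T → Ω → ℝ)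
    (hW : IsBrownianMotion ℱ P W) (hℱ : IsAugmentedNaturalFiltration ℱ P W)
    (M : OWModel n) (hρ : M.rho ≠ 0) (x d : Fin n → ℝ) (hxd : d ≠ M.gamma *ᵥ x)
    (hκ : (M.kappa m).PosDef) :
    -- the inverse matrices in the explicit formulas exist
    IsUnit (M.scrR m) ∧
    (∀ s : Time T, IsUnit (1 + ((1 / 2) * (T - s)) • M.scrBRB m)) ∧
    -- the explicit solution of the Riccati BSDE, and its uniqueness
    IsRiccatiSolution hT ℱ P W (fun _ _ => M.scrA m) (fun _ _ => M.scrB m)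
      (fun _ _ => M.scrQ) (fun _ _ => M.scrR m) (fun k _ _ => M.scrC m k)
      (fun s _ => M.explicitY m T s) (fun _ _ _ => 0) ∧
    (∀ (Y : Time T → Ω → Matrix (Fin n) (Fin n) ℝ)
        (Z : Fin m → Time T → Ω → Matrix (Fin n) (Fin n) ℝ),
      IsRiccatiSolution hT ℱ P W (fun _ _ => M.scrA m) (fun _ _ => M.scrB m)
        (fun _ _ => M.scrQ) (fun _ _ => M.scrR m) (fun k _ _ => M.scrC m k) Y Z →
      (∀ᵐ ω ∂P, ∀ s : Time T, Y s ω = M.explicitY m T s) ∧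
      ∀ k, ∀ᵐ p ∂((volume : Measure (Time T)).prod P), Z k p.1 p.2 = 0) ∧
    -- the feedback matrix `θ`
    (∀ s : Time T,
      feedback (M.scrB m) M.scrQ (M.scrR m) (M.scrC m) (M.explicitY m T s) (fun _ => 0)
        = -((M.scrR m)⁻¹ * (M.scrB m)ᵀ * M.explicitY m T s)) ∧
    -- the explicit solution of the SDE of the optimal state, and its uniqueness
    IsOptimalStateSolution hT ℱ P W (fun _ _ => M.scrA m) (fun _ _ => M.scrB m)
      (fun s _ => feedback (M.scrB m) M.scrQ (M.scrR m) (M.scrC m) (M.explicitY m T s)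
        (fun _ => 0))
      (fun k _ _ => M.scrC m k) (M.initialState x d) (fun s _ => M.explicitState m T x d s) ∧
    (∀ H : Time T → Ω → Fin n → ℝ,
      IsOptimalStateSolution hT ℱ P W (fun _ _ => M.scrA m) (fun _ _ => M.scrB m)
        (fun s _ => feedback (M.scrB m) M.scrQ (M.scrR m) (M.scrC m) (M.explicitY m T s)
          (fun _ => 0))
        (fun k _ _ => M.scrC m k) (M.initialState x d) H →
      ∀ᵐ ω ∂P, ∀ s : Time T, H s ω = M.explicitState m T x d s) ∧
    -- the unique optimal strategy and its deviation
    ∃ X : StartedProcess T Ω n,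
      M.IsOptimal m hT ℱ P x d X ∧
      (∀ X' : StartedProcess T Ω n, M.IsOptimal m hT ℱ P x d X' →
        ∀ᵐ p ∂((volume : Measure (Time T)).prod P), X'.path p.1 p.2 = X.path p.1 p.2) ∧
      M.MemFV m hT ℱ P (fun _ => 0) x d X ∧
      X.pre = x ∧
      (∀ ω, X.path (endTime hT) ω = 0) ∧
      (∀ (s : Time T) (ω : Ω), (s : ℝ) < T →
        X.path s ω =
          (-(1 / 2 : ℝ)) • ((M.gammaPow (-(1 / 2)) *
              ((M.scrR m)⁻¹ * (M.scrB m)ᵀ * (1 + ((1 / 2) * T) • M.scrBRB m)⁻¹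
                + (2 : ℝ) • 1)) *ᵥ M.initialState x d)
          + (s : ℝ) • ((1 / 2 : ℝ) • ((M.gammaPow (-(1 / 2)) * M.scrBRB m *
              (1 + ((1 / 2) * T) • M.scrBRB m)⁻¹) *ᵥ M.initialState x d))) ∧
      M.IsFVDeviation P d X (M.deviation d X) ∧
      (M.deviation d X).pre = d ∧
      (∀ ω, (M.deviation d X).path (endTime hT) ω =
        (M.gammaPow (1 / 2) * (1 + ((1 / 2) * T) • M.scrBRB m)⁻¹) *ᵥ M.initialState x d) ∧
      (∀ (s : Time T) (ω : Ω), (s : ℝ) < T →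
        (M.deviation d X).path s ω =
          (-(1 / 2 : ℝ)) • ((M.gammaPow (1 / 2) * (M.scrR m)⁻¹ * (M.scrB m)ᵀ *
              (1 + ((1 / 2) * T) • M.scrBRB m)⁻¹) *ᵥ M.initialState x d)) := by
  refine ⟨M.isUnit_scrR hκ, fun s => M.isUnit_half_mul hκ s.2.2,
    M.isRiccatiSolution_explicitY hT hκ,
    fun Y Z h => ⟨M.eq_explicitY_of_isRiccatiSolution hT hW hκ h,
      fun k => M.integrand_eq_zero_of_isRiccatiSolution hT hW hκ h k⟩,
    fun s => M.feedback_eq _ _, M.isOptimalStateSolution_explicitState hT hκ x d,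
    fun H h => M.eq_explicitState_of_isOptimalStateSolution hT hW hκ x d h,
    M.optimalStrategy m T Ω x d, M.isOptimal_optimalStrategy hT hκ x d,
    fun X hX => M.eq_optimalStrategy_of_isOptimal hT hκ hX, M.memFV_optimalStrategy hT x d, rfl,
    M.optimalStrategy_endTime hT x d, fun s ω hs => if_pos hs,
    M.isFVDeviation_deviation hT d _ (ae_of_all _ (M.integrable_optimalStrategy hT x d)), rfl,
    M.deviation_optimalStrategy_endTime hκ hT x d,
    M.deviation_optimalStrategy_of_lt hT x d⟩
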